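/- Let $n,d\ge 1$ be integers, $\alpha>-1$, $1<p<\infty$ and $\frac1p+\frac1q=1$. Let $\mathbb B_n$ be the open unit ball of $\mathbb C^n$, write $\overline z w=\sum_i\overline{z_i}w_i$, and let $dv_\alpha(z)=c_\alpha(1-|z|^2)^\alpha\,dV(z)$, where $dV$ is volume measure and $c_\alpha$ makes $v_\alpha$ a probability measure on $\mathbb B_n$. For $1<r<\infty$, $A^r_\alpha=A^r_\alpha(\mathbb B_n;\mathbb C^d)$ is the space of holomorphic $f:\mathbb B_n\to\mathbb C^d$ with $\|f\|^r=\int\|f(z)\|_r^r\,dv_\alpha(z)<\infty$, where $\|\cdot\|_r$ is the $\ell^r$-norm on $\mathbb C^d$; for $f\in A^p_\alpha$ and $g\in A^q_\alpha$ put $\langle f,g\rangle=\int\langle f(w),g(w)\rangle_{\mathbb C^d}\,dv_\alpha(w)$. For a bounded measurable $d\times d$ matrix-valued function $\varphi$ on $\mathbb B_n$ the Toeplitz operator on $A^p_\alpha$ is $$(T_\varphi f)(z)=\int_{\mathbb B_n}\frac{\varphi(w)f(w)}{(1-\overline w z)^{n+1+\alpha}}\,dv_\alpha(w),$$ and $\mathcal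 T_{p,\alpha}$ is the operator-norm closure in $\mathcal L(A^p_\alpha)$ of the set of finite sums of finite products of such operators. For $z\in\mathbb B_n$ let $\varphi_z$ be the involutive automorphism of $\mathbb B_n$ interchanging $z$ and $0$, that is $$\varphi_z(w)=\frac{z-P_zw-\sqrt{1-|z|^2}\,(w-P_zw)}{1-\overline z w},$$ with $P_z$ the orthogonal projection onto $\mathbb Cz$ (so $\varphi_0(w)=-w$), and let $\rho(z,w)=|\varphi_z(w)|$. Let $\mathcal A$ be the algebra of bounded uniformly continuous functions $(\mathbb B_n,\rho)\to\mathbb C$, and $M_{\mathcal A}$ its maximal ideal space (nonzero multiplicative linear functionals, weak-$*$ topology); $\mathbb B_n$ is regarded as a subset of $M_{\mathcal A}$ through point evaluations. For $r\in\{p,q\}$ define on $A^r_\alpha$ $$U^{(r,\alpha)}_zf(w)=f(\varphi_z(w))\,\frac{(1-|z|^2)^{(n+1+\alpha)/r}}{(1-\overline z w)^{2(n+1+\alpha)/r}}$$ (principal branch), and let $(U^{(q,\alpha)}_z)^*$ be the operator on $A^p_\alpha$ with $\langle (U_z^{(q,\alpha)})^*f,g\rangle=\langle f,U_z^{(q,\alpha)}g\rangle$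 for all $f\in A^p_\alpha$, $g\in A^q_\alpha$. For $S\in\mathcal L(A^p_\alpha)$ and $z\in\mathbb B_n$ put $\Psi_S(z)=S_z=U^{(p,\alpha)}_zS(U^{(q,\alpha)}_z)^*$, and for $x\in M_{\mathcal A}$ let $S_x$ be the limit of $S_z$ in the weak operator topology as $z\in\mathbb B_n$ tends to $x$ in $M_{\mathcal A}$. Then the operators $T_\varphi$ ($\varphi$ bounded measurable), $U_z^{(p,\alpha)}$, $U_z^{(q,\alpha)}$ and $(U_z^{(q,\alpha)})^*$ exist as bounded operators, and for every $S\in\mathcal T_{p,\alpha}$: 1. if $(z_\omega)$ is a net in $\mathbb B_n$ that tends to $x\in M_{\mathcal A}$, then $S_{z_\omega}\to S_x$ in the strong operator topology of $\mathcal L(A^p_\alpha)$; 2. in particular, $\Psi_S:\mathbb B_n\to(\mathcal L(A^p_\alpha),\mathrm{SOT})$ extends continuously to $M_{\mathcal A}$, the extension being $x\mapsto S_x$. -/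

import Mathlib

open MeasureTheory Filter Topology
open scoped ENNReal BoundedContinuousFunction

noncomputable section

namespace BergmanBall

/-! ### The unit ball, its involutive automorphisms and the pseudohyperbolic metric -/

/-- The open unit ball of `ℂⁿ` (Euclidean norm). -/
abbrev Ball (n : ℕ) : Type := Metric.ball (0 : EuclideanSpace ℂ (Fin n)) 1

lemma Ball.norm_lt {n : ℕ} (z : Ball n) : ‖(z : EuclideanSpace ℂ (Fin n))‖ < 1 :=
  mem_ball_zero_iff.mp z.2

/-- The orthogonal projection of `w` onto the complex line through `z` (it is `0` if `z = 0`).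
Mathlib's `inner ℂ z w` is conjugate linear in `z`, so it is the paper's `z̄ w`. -/
def projLine {n : ℕ} (z w : EuclideanSpace ℂ (Fin n)) : EuclideanSpace ℂ (Fin n) :=
  (inner ℂ z w / ((‖z‖ ^ 2 : ℝ) : ℂ)) • z

/-- The formula of the automorphism `φ_z` that interchanges `z` and `0`:
`φ_z(w) = (z - P_z w - (1 - |z|²)^{1/2} (w - P_z w)) / (1 - z̄ w)`, and `φ_0(w) = -w`. -/
def autFun {n : ℕ} (z w : EuclideanSpace ℂ (Fin n)) : EuclideanSpace ℂ (Fin n) :=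
  (1 - inner ℂ z w)⁻¹ •
    (z - projLine z w - ((Real.sqrt (1 - ‖z‖ ^ 2) : ℝ) : ℂ) • (w - projLine z w))

lemma one_sub_inner_ne_zero {n : ℕ} (z w : Ball n) :
    (1 : ℂ) - inner ℂ (z : EuclideanSpace ℂ (Fin n)) (w : EuclideanSpace ℂ (Fin n)) ≠ 0 := by
  intro h
  have h1 : inner ℂ (z : EuclideanSpace ℂ (Fin n)) (w : EuclideanSpace ℂ (Fin n)) = (1 : ℂ) :=
    (sub_eq_zero.mp h).symm
  have h2 := norm_inner_le_norm (𝕜 := ℂ)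
    (z : EuclideanSpace ℂ (Fin n)) (w : EuclideanSpace ℂ (Fin n))
  rw [h1, norm_one] at h2
  nlinarith [z.norm_lt, w.norm_lt, norm_nonneg (z : EuclideanSpace ℂ (Fin n)),
    norm_nonneg (w : EuclideanSpace ℂ (Fin n))]

/-- `1 - |φ_z(w)|² = (1 - |z|²)(1 - |w|²) / |1 - z̄ w|²`. -/
lemma one_sub_norm_autFun_sq {n : ℕ} (z w : Ball n) :
    1 - ‖autFun (z : EuclideanSpace ℂ (Fin n)) w‖ ^ 2 =
      (1 - ‖(z : EuclideanSpace ℂ (Fin n))‖ ^ 2) * (1 - ‖(w : EuclideanSpace ℂ (Fin n))‖ ^ 2) /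
        ‖(1 : ℂ) - inner ℂ (z : EuclideanSpace ℂ (Fin n)) (w : EuclideanSpace ℂ (Fin n))‖ ^ 2 := by
  have hne := one_sub_inner_ne_zero z w
  obtain ⟨z, hz'⟩ := z
  obtain ⟨w, hw'⟩ := w
  have hz : ‖z‖ < 1 := mem_ball_zero_iff.mp hz'
  simp only at hne ⊢
  have hs : Real.sqrt (1 - ‖z‖ ^ 2) ^ 2 = 1 - ‖z‖ ^ 2 :=
    Real.sq_sqrt (by nlinarith [norm_nonneg z])
  have hd : ‖(1 : ℂ) - inner ℂ z w‖ ^ 2 ≠ 0 := pow_ne_zero 2 (norm_ne_zero_iff.mpr hne)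
  set l : ℂ := inner ℂ z w / ((‖z‖ ^ 2 : ℝ) : ℂ) with hl
  have hlz : inner ℂ z w = l * ((‖z‖ ^ 2 : ℝ) : ℂ) := by
    rcases eq_or_ne z 0 with rfl | h0
    · simp
    · rw [hl, div_mul_cancel₀]
      simpa using h0
  have hP : projLine z w = l • z := rfl
  have horth : inner ℂ z (w - l • z) = 0 := by
    rw [inner_sub_right, inner_smul_right, inner_self_eq_norm_sq_to_K, hlz]
    push_cast
    exact sub_self _
  have horth' : ∀ a b : ℂ, ‖a • z + b • (w - l • z)‖ ^ 2 =
      ‖a‖ ^ 2 * ‖z‖ ^ 2 + ‖b‖ ^ 2 * ‖w - l • z‖ ^ 2 := by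
    intro a b
    have := norm_add_sq_eq_norm_sq_add_norm_sq_of_inner_eq_zero (𝕜 := ℂ) (a • z)
      (b • (w - l • z)) (by rw [inner_smul_left, inner_smul_right, horth]; simp)
    rw [norm_smul, norm_smul] at this
    linear_combination this
  have hw : ‖w‖ ^ 2 = ‖l‖ ^ 2 * ‖z‖ ^ 2 + ‖w - l • z‖ ^ 2 := by
    have := horth' l 1
    simpa using this
  have hnum : ‖z - l • z - ((Real.sqrt (1 - ‖z‖ ^ 2) : ℝ) : ℂ) • (w - l • z)‖ ^ 2 =
      ‖1 - l‖ ^ 2 * ‖z‖ ^ 2 + (1 - ‖z‖ ^ 2) * ‖w - l • z‖ ^ 2 := by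
    have := horth' (1 - l) (-((Real.sqrt (1 - ‖z‖ ^ 2) : ℝ) : ℂ))
    rw [norm_neg, Complex.norm_real, Real.norm_eq_abs, sq_abs, hs] at this
    rw [← this, sub_smul, one_smul, neg_smul, ← sub_eq_add_neg]
  have h1 : ‖1 - l‖ ^ 2 = (1 - l.re) ^ 2 + l.im ^ 2 := by
    rw [← Complex.normSq_eq_norm_sq, Complex.normSq_apply]; simp; ring
  have h2 : ‖l‖ ^ 2 = l.re ^ 2 + l.im ^ 2 := by
    rw [← Complex.normSq_eq_norm_sq, Complex.normSq_apply]; ring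
  have h3 : ‖(1 : ℂ) - inner ℂ z w‖ ^ 2 =
      (1 - l.re * ‖z‖ ^ 2) ^ 2 + (l.im * ‖z‖ ^ 2) ^ 2 := by
    rw [hlz, ← Complex.normSq_eq_norm_sq, Complex.normSq_apply, Complex.sub_re, Complex.sub_im,
      Complex.re_mul_ofReal, Complex.im_mul_ofReal]
    simp; ring
  rw [eq_div_iff hd, autFun, hP, norm_smul, norm_inv, mul_pow, inv_pow, hnum, sub_mul, one_mul,
    mul_right_comm, inv_mul_cancel₀ hd, one_mul, h3, h1]
  have h4 : ‖w - l • z‖ ^ 2 = ‖w‖ ^ 2 - (l.re ^ 2 + l.im ^ 2) * ‖z‖ ^ 2 := by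
    rw [← h2]; linarith
  rw [h4]
  ring

lemma norm_autFun_lt {n : ℕ} (z w : Ball n) :
    ‖autFun (z : EuclideanSpace ℂ (Fin n)) w‖ < 1 := by
  have h := one_sub_norm_autFun_sq z w
  have hz : 0 < 1 - ‖(z : EuclideanSpace ℂ (Fin n))‖ ^ 2 := by
    nlinarith [z.norm_lt, norm_nonneg (z : EuclideanSpace ℂ (Fin n))]
  have hw : 0 < 1 - ‖(w : EuclideanSpace ℂ (Fin n))‖ ^ 2 := by
    nlinarith [w.norm_lt, norm_nonneg (w : EuclideanSpace ℂ (Fin n))]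
  have hd := norm_pos_iff.mpr (one_sub_inner_ne_zero z w)
  have : 0 < 1 - ‖autFun (z : EuclideanSpace ℂ (Fin n)) w‖ ^ 2 := by
    rw [h]; positivity
  nlinarith [norm_nonneg (autFun (z : EuclideanSpace ℂ (Fin n)) w)]

/-- The automorphism `φ_z` of the ball. -/
def aut {n : ℕ} (z w : Ball n) : Ball n :=
  ⟨autFun z w, mem_ball_zero_iff.mpr (norm_autFun_lt z w)⟩

/-- The pseudohyperbolic metric `ρ(z, w) = |φ_z(w)|`. -/
def rho {n : ℕ} (z w : Ball n) : ℝ := ‖(aut z w : EuclideanSpace ℂ (Fin n))‖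

/-! ### The weighted measure -/

/-- The measure `(1 - |z|²)^α dV(z)` on the ball. -/
def weightMeasure (n : ℕ) (α : ℝ) : Measure (Ball n) :=
  ((volume : Measure (EuclideanSpace ℂ (Fin n))).comap Subtype.val).withDensity
    (fun z => ENNReal.ofReal ((1 - ‖(z : EuclideanSpace ℂ (Fin n))‖ ^ 2) ^ α))

/-- The probability measure `dv_α(z) = c_α (1 - |z|²)^α dV(z)` on the ball. -/
def vMeasure (n : ℕ) (α : ℝ) : Measure (Ball n) :=
  (weightMeasure n α Set.univ)⁻¹ • weightMeasure n α

lemma weightMeasure_univ_ne_top (n : ℕ) {α : ℝ} (hα : -1 < α) :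
    weightMeasure n α Set.univ ≠ ∞ := by
  have hball : MeasurableSet (Metric.ball (0 : EuclideanSpace ℂ (Fin n)) 1) :=
    measurableSet_ball
  have hint : IntegrableOn (fun z : EuclideanSpace ℂ (Fin n) => (1 - ‖z‖ ^ 2) ^ α)
      (Metric.ball 0 1) := by
    rcases subsingleton_or_nontrivial (EuclideanSpace ℂ (Fin n)) with h | h
    · have : (fun z : EuclideanSpace ℂ (Fin n) => (1 - ‖z‖ ^ 2) ^ α) = fun _ => 1 := by
        funext z
        simp [Subsingleton.elim z 0]
      rw [this]
      exact integrableOn_const (measure_ball_lt_top.ne)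
    · rw [integrableOn_fun_norm_addHaar volume (f := fun r : ℝ => (1 - r ^ 2) ^ α)]
      have h1 : IntegrableOn (fun r : ℝ => (1 - r) ^ α) (Set.Ioo 0 1) := by
        have h2 : IntervalIntegrable (fun r : ℝ => r ^ α) volume 0 1 :=
          intervalIntegral.intervalIntegrable_rpow' hα
        have h3 := (h2.comp_sub_left 1).symm
        simp only [sub_zero, sub_self] at h3
        exact ((intervalIntegrable_iff_integrableOn_Ioo_of_le zero_le_one).mp h3)
      have h2 : IntegrableOn (fun r : ℝ => 1 + (1 - r) ^ α) (Set.Ioo 0 1) :=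
        (integrableOn_const (by simp)).add h1
      refine h2.mono' ?_ ?_
      · exact Measurable.aestronglyMeasurable (by fun_prop)
      · refine (ae_restrict_iff' measurableSet_Ioo).mpr (ae_of_all _ fun r hr => ?_)
        obtain ⟨hr0, hr1⟩ := hr
        have hA : 0 < 1 - r ^ 2 := by nlinarith
        have hB : 0 < 1 - r := by linarith
        have hC : 0 ≤ (1 - r) ^ α := Real.rpow_nonneg hB.le _
        have hD : (1 - r ^ 2) ^ α ≤ 1 + (1 - r) ^ α := by
          rcases le_or_gt 0 α with h0 | h0
          · have := Real.rpow_le_one hA.le (by nlinarith) h0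
            linarith
          · have := Real.rpow_le_rpow_of_nonpos hB (by nlinarith : 1 - r ≤ 1 - r ^ 2) h0.le
            linarith
        have hE : 0 ≤ (1 - r ^ 2) ^ α := Real.rpow_nonneg hA.le _
        rw [smul_eq_mul, norm_mul, norm_pow, Real.norm_of_nonneg hE, Real.norm_of_nonneg hr0.le]
        calc _ ≤ 1 * (1 - r ^ 2) ^ α := by
              gcongr
              exact pow_le_one₀ hr0.le hr1.le
          _ ≤ _ := by linarith
  rw [weightMeasure, withDensity_apply _ MeasurableSet.univ, Measure.restrict_univ]
  have hm : Measurable fun z : EuclideanSpace ℂ (Fin n) =>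
      ENNReal.ofReal ((1 - ‖z‖ ^ 2) ^ α) := by fun_prop
  have := lintegral_subtype_comap (μ := (volume : Measure (EuclideanSpace ℂ (Fin n)))) hball
    (fun z => ENNReal.ofReal ((1 - ‖z‖ ^ 2) ^ α))
  rw [this]
  exact hint.lintegral_lt_top.ne

instance (n : ℕ) (α : ℝ) : (weightMeasure n α).IsOpenPosMeasure := by
  constructor
  intro V hV hne h0
  have hpos : ∀ z : Ball n, 0 < (1 - ‖(z : EuclideanSpace ℂ (Fin n))‖ ^ 2) ^ α := fun z =>
    Real.rpow_pos_of_pos (by nlinarith [z.norm_lt, norm_nonneg (z : EuclideanSpace ℂ (Fin n))]) _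
  have hm : Measurable fun z : Ball n =>
      ENNReal.ofReal ((1 - ‖(z : EuclideanSpace ℂ (Fin n))‖ ^ 2) ^ α) := by fun_prop
  rw [weightMeasure, withDensity_apply_eq_zero hm] at h0
  have hall : {z : Ball n | ENNReal.ofReal
      ((1 - ‖(z : EuclideanSpace ℂ (Fin n))‖ ^ 2) ^ α) ≠ 0} ∩ V = V := by
    ext z
    simp [hpos z]
  have hball : MeasurableSet (Metric.ball (0 : EuclideanSpace ℂ (Fin n)) 1) :=
    measurableSet_ball
  rw [hall, (MeasurableEmbedding.subtype_coe hball).comap_apply] at h0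
  exact (Metric.isOpen_ball.isOpenMap_subtype_val V hV).measure_ne_zero volume
    (hne.image _) h0

instance (n : ℕ) (α : ℝ) [hα : Fact (-1 < α)] : IsProbabilityMeasure (vMeasure n α) := by
  constructor
  have h0 : weightMeasure n α Set.univ ≠ 0 :=
    isOpen_univ.measure_ne_zero _ ⟨⟨0, by simp⟩, trivial⟩
  simp only [vMeasure, Measure.smul_apply, smul_eq_mul]
  exact ENNReal.inv_mul_cancel h0 (weightMeasure_univ_ne_top n hα.out)

instance (n : ℕ) (α : ℝ) [hα : Fact (-1 < α)] : (vMeasure n α).IsOpenPosMeasure := by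
  constructor
  intro U hU hne
  simp only [vMeasure, Measure.smul_apply, smul_eq_mul]
  exact mul_ne_zero (ENNReal.inv_ne_zero.mpr (weightMeasure_univ_ne_top n hα.out))
    (hU.measure_ne_zero _ hne)

/-! ### The vector valued Bergman space -/

/-- `ℂᵈ` with the `p`-norm. -/
abbrev Vec (d : ℕ) (p : ℝ≥0∞) : Type := PiLp p (fun _ : Fin d => ℂ)

/-- A function on the open unit ball is holomorphic. -/
def IsHolomorphic {n : ℕ} {F : Type*} [NormedAddCommGroup F] [NormedSpace ℂ F]
    (f : Ball n → F) : Prop :=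
  ∃ g : EuclideanSpace ℂ (Fin n) → F,
    DifferentiableOn ℂ g (Metric.ball 0 1) ∧ ∀ z : Ball n, g z = f z

lemma IsHolomorphic.continuous {n : ℕ} {F : Type*} [NormedAddCommGroup F] [NormedSpace ℂ F]
    {f : Ball n → F} (hf : IsHolomorphic f) : Continuous f := by
  obtain ⟨g, hg, hgf⟩ := hf
  have : f = (Metric.ball (0 : EuclideanSpace ℂ (Fin n)) 1).domRestrict g := by
    funext z; exact (hgf z).symm
  rw [this]
  exact continuousOn_iff_continuous_domRestrict.mp hg.continuousOn

/-- The holomorphic functions `f : 𝔹ₙ → ℂᵈ` with `∫ ‖f(z)‖_p^p dv_α(z) < ∞`, as a subspace of the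
space of all functions. -/
def bergmanSubmodule (n d : ℕ) (p : ℝ≥0∞) [Fact (1 ≤ p)] (α : ℝ) :
    Submodule ℂ (Ball n → Vec d p) where
  carrier := {f | IsHolomorphic f ∧ MemLp f p (vMeasure n α)}
  zero_mem' := ⟨⟨0, differentiableOn_const 0, fun _ => rfl⟩, MemLp.zero⟩
  add_mem' := by
    rintro f g ⟨⟨F, hF, hFf⟩, hf⟩ ⟨⟨G, hG, hGg⟩, hg⟩
    exact ⟨⟨F + G, hF.add hG, fun z => by simp [hFf, hGg]⟩, hf.add hg⟩
  smul_mem' := by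
    rintro c f ⟨⟨F, hF, hFf⟩, hf⟩
    exact ⟨⟨c • F, hF.const_smul c, fun z => by simp [hFf]⟩, hf.const_smul c⟩

/-- The Bergman space `A^p_α(𝔹ₙ; ℂᵈ)`. Its norm is defined below as the `L^p_α` norm. -/
def Bergman (n d : ℕ) (p : ℝ≥0∞) [Fact (1 ≤ p)] (α : ℝ) : Type :=
  bergmanSubmodule n d p α

section Bergman

variable {n d : ℕ} {p : ℝ≥0∞} [Fact (1 ≤ p)] {α : ℝ}

instance : AddCommGroup (Bergman n d p α) :=
  inferInstanceAs (AddCommGroup (bergmanSubmodule n d p α))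

instance : Module ℂ (Bergman n d p α) :=
  inferInstanceAs (Module ℂ (bergmanSubmodule n d p α))

instance : FunLike (Bergman n d p α) (Ball n) (Vec d p) where
  coe f := f.1
  coe_injective _ _ h := Subtype.ext h

lemma Bergman.isHolomorphic (f : Bergman n d p α) : IsHolomorphic (f : Ball n → Vec d p) := f.2.1

lemma Bergman.memLp (f : Bergman n d p α) : MemLp (f : Ball n → Vec d p) p (vMeasure n α) := f.2.2

/-- The inclusion of `A^p_α` into `L^p_α`. -/
def Bergman.toLp : Bergman n d p α →ₗ[ℂ] Lp (Vec d p) p (vMeasure n α) where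
  toFun f := f.memLp.toLp f
  map_add' _ _ := rfl
  map_smul' _ _ := rfl

lemma Bergman.toLp_injective [Fact (-1 < α)] :
    Function.Injective (Bergman.toLp : Bergman n d p α →ₗ[ℂ] _) := by
  intro f g h
  have h1 : (f : Ball n → Vec d p) =ᵐ[vMeasure n α] g :=
    (MemLp.toLp_eq_toLp_iff f.memLp g.memLp).mp h
  exact DFunLike.coe_injective
    ((f.isHolomorphic.continuous.ae_eq_iff_eq _ g.isHolomorphic.continuous).mp h1)

instance [Fact (-1 < α)] : NormedAddCommGroup (Bergman n d p α) :=
  NormedAddCommGroup.induced _ _ Bergman.toLp Bergman.toLp_injective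

instance [Fact (-1 < α)] : NormedSpace ℂ (Bergman n d p α) :=
  NormedSpace.induced ℂ _ _ Bergman.toLp

lemma Bergman.norm_def [Fact (-1 < α)] (f : Bergman n d p α) :
    ‖f‖ = (eLpNorm f p (vMeasure n α)).toReal :=
  Lp.norm_toLp _ f.memLp

end Bergman

/-- The pairing `⟨f, g⟩_{A²_α} = ∫ ⟨f(w), g(w)⟩_{ℂᵈ} dv_α(w)`, conjugate linear in `g`, for
`f ∈ A^p_α` and `g ∈ A^q_α`. -/
def pairing {n d : ℕ} {p q : ℝ≥0∞} [Fact (1 ≤ p)] [Fact (1 ≤ q)] {α : ℝ}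
    (f : Bergman n d p α) (g : Bergman n d q α) : ℂ :=
  ∫ w, ∑ i, f w i * (starRingEnd ℂ) (g w i) ∂(vMeasure n α)

/-! ### Toeplitz operators and the Toeplitz algebra -/

/-- Bounded measurable `d × d` matrix valued functions on the ball (up to null sets). -/
def IsBddSymbol {n d : ℕ} (α : ℝ) (φ : Ball n → Matrix (Fin d) (Fin d) ℂ) : Prop :=
  ∀ i j, MemLp (fun z => φ z i j) ∞ (vMeasure n α)

/-- `T` is the Toeplitz operator `T_φ = P_α M_φ` on `A^p_α`, that is,
`(T f)(z) = ∫ φ(w) f(w) / (1 - z w̄)^{n+1+α} dv_α(w)`. -/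
def IsToeplitz {n d : ℕ} {p : ℝ≥0∞} [Fact (1 ≤ p)] {α : ℝ} [Fact (-1 < α)]
    (φ : Ball n → Matrix (Fin d) (Fin d) ℂ)
    (T : Bergman n d p α →L[ℂ] Bergman n d p α) : Prop :=
  ∀ (f : Bergman n d p α) (z : Ball n),
    T f z = ∫ w : Ball n,
      ((1 - inner ℂ (w : EuclideanSpace ℂ (Fin n)) (z : EuclideanSpace ℂ (Fin n))) ^
        ((n + 1 + α : ℝ) : ℂ))⁻¹ • Matrix.toLpLin p p (φ w) (f w) ∂(vMeasure n α)

/-- The Toeplitz algebra `𝒯_{p,α}`: the operator norm closure of the set of finite sums of finite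
products of Toeplitz operators with bounded matrix valued symbols. -/
def toeplitzAlgebra (n d : ℕ) (p : ℝ≥0∞) [Fact (1 ≤ p)] (α : ℝ) [Fact (-1 < α)] :
    Subalgebra ℂ (Bergman n d p α →L[ℂ] Bergman n d p α) :=
  (Algebra.adjoin ℂ {T | ∃ φ, IsBddSymbol α φ ∧ IsToeplitz φ T}).topologicalClosure

/-! ### The operators `U_z`, their adjoints, and `S_z` -/

/-- The function `w ↦ f(φ_z(w)) (1 - |z|²)^{(n+1+α)/p} / (1 - w z̄)^{2(n+1+α)/p}`
(principal branch; `1 - w z̄` has positive real part). -/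
def weightedComp {n d : ℕ} {p : ℝ≥0∞} (α : ℝ) (z : Ball n) (f : Ball n → Vec d p) :
    Ball n → Vec d p := fun w =>
  ((((1 - ‖(z : EuclideanSpace ℂ (Fin n))‖ ^ 2) ^ ((n + 1 + α) / p.toReal) : ℝ) : ℂ) /
    (1 - inner ℂ (z : EuclideanSpace ℂ (Fin n)) (w : EuclideanSpace ℂ (Fin n))) ^
      ((2 * (n + 1 + α) / p.toReal : ℝ) : ℂ)) • f (aut z w)

open Classical in
/-- The bounded operator `U_z^{(p,α)}` on `A^p_α` given by the formula `weightedComp`. -/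
def U {n : ℕ} (d : ℕ) (p : ℝ≥0∞) [Fact (1 ≤ p)] (α : ℝ) [Fact (-1 < α)] (z : Ball n) :
    Bergman n d p α →L[ℂ] Bergman n d p α :=
  if h : ∃ T : Bergman n d p α →L[ℂ] Bergman n d p α,
      ∀ f w, T f w = weightedComp α z f w then h.choose else 0

open Classical in
/-- The adjoint `T^*`, acting on `A^p_α`, of an operator `T` on `A^q_α`, `1/p + 1/q = 1`: the
operator with `⟨T^* f, g⟩ = ⟨f, T g⟩` for all `f ∈ A^p_α` and `g ∈ A^q_α`. -/
def adj {n d : ℕ} (p : ℝ≥0∞) {q : ℝ≥0∞} [Fact (1 ≤ p)] [Fact (1 ≤ q)] {α : ℝ} [Fact (-1 < α)]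
    (T : Bergman n d q α →L[ℂ] Bergman n d q α) : Bergman n d p α →L[ℂ] Bergman n d p α :=
  if h : ∃ V : Bergman n d p α →L[ℂ] Bergman n d p α,
      ∀ f g, pairing (V f) g = pairing f (T g) then h.choose else 0

/-- `S_z = U_z^{(p,α)} S (U_z^{(q,α)})^*`, where `1/p + 1/q = 1`; this is `Ψ_S(z)`. -/
def conj {n d : ℕ} {p : ℝ≥0∞} (q : ℝ≥0∞) [Fact (1 ≤ p)] [Fact (1 ≤ q)] {α : ℝ} [Fact (-1 < α)]
    (S : Bergman n d p α →L[ℂ] Bergman n d p α) (z : Ball n) :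
    Bergman n d p α →L[ℂ] Bergman n d p α :=
  U d p α z ∘L S ∘L adj p (U d q α z)

/-! ### The algebra `𝒜`, its maximal ideal space, and `S_x` -/

/-- The algebra `𝒜` of bounded functions `(𝔹ₙ, ρ) → ℂ` that are uniformly continuous (`ρ` induces
the Euclidean topology on the ball), with the supremum norm. -/
def ucAlgebra (n : ℕ) : Subalgebra ℂ (Ball n →ᵇ ℂ) where
  carrier := {a | ∀ ε > 0, ∃ δ > 0, ∀ z w : Ball n, rho z w < δ → dist (a z) (a w) < ε}
  mul_mem' := by
    intro a b ha hb ε hε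
    have hA : 0 < ‖a‖ + 1 := by positivity
    have hB : 0 < ‖b‖ + 1 := by positivity
    obtain ⟨δ, hδ, h⟩ := ha (ε / (2 * (‖b‖ + 1))) (by positivity)
    obtain ⟨δ', hδ', h'⟩ := hb (ε / (2 * (‖a‖ + 1))) (by positivity)
    refine ⟨min δ δ', lt_min hδ hδ', fun z w hzw => ?_⟩
    have h1 := h z w (hzw.trans_le (min_le_left _ _))
    have h2 := h' z w (hzw.trans_le (min_le_right _ _))
    rw [dist_eq_norm] at h1 h2 ⊢
    have e : (a * b) z - (a * b) w = a z * (b z - b w) + (a z - a w) * b w := by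
      simp only [BoundedContinuousFunction.mul_apply]; ring
    rw [lt_div_iff₀ (by positivity)] at h1 h2
    calc ‖(a * b) z - (a * b) w‖ ≤ ‖a z‖ * ‖b z - b w‖ + ‖a z - a w‖ * ‖b w‖ := by
          rw [e]
          exact (norm_add_le _ _).trans (by rw [norm_mul, norm_mul])
      _ ≤ (‖a‖ + 1) * ‖b z - b w‖ + ‖a z - a w‖ * (‖b‖ + 1) := by
          gcongr
          · linarith [a.norm_coe_le_norm z]
          · linarith [b.norm_coe_le_norm w]
      _ < ε := by linarith
  add_mem' := by
    intro a b ha hb ε hε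
    obtain ⟨δ, hδ, h⟩ := ha (ε / 2) (by positivity)
    obtain ⟨δ', hδ', h'⟩ := hb (ε / 2) (by positivity)
    refine ⟨min δ δ', lt_min hδ hδ', fun z w hzw => ?_⟩
    have h1 := h z w (hzw.trans_le (min_le_left _ _))
    have h2 := h' z w (hzw.trans_le (min_le_right _ _))
    calc dist ((a + b) z) ((a + b) w) ≤ dist (a z) (a w) + dist (b z) (b w) := dist_add_add_le _ _ _ _
      _ < ε := by linarith
  algebraMap_mem' := by
    intro c ε hε
    refine ⟨1, one_pos, fun z w _ => ?_⟩
    simpa [BoundedContinuousFunction.algebraMap_apply] using hε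

/-- The maximal ideal space `M_𝒜`: nonzero multiplicative linear functionals on `𝒜`, with the
weak-* topology. -/
abbrev MaxIdealSpace (n : ℕ) : Type := WeakDual.characterSpace ℂ (ucAlgebra n)

/-- Evaluation at a point of the ball, the embedding `𝔹ₙ ⊂ M_𝒜`. -/
def pointEval {n : ℕ} (z : Ball n) : MaxIdealSpace n :=
  ⟨((BoundedContinuousFunction.evalCLM ℂ z).comp
      (ucAlgebra n).toSubmodule.subtypeL : ucAlgebra n →L[ℂ] ℂ), by
    refine ⟨fun h => ?_, fun a b => rfl⟩
    have h1 : (1 : ℂ) = 0 := congrArg (fun ψ : WeakDual ℂ (ucAlgebra n) => ψ 1) h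
    exact one_ne_zero h1⟩

/-- `S_x` for `x ∈ M_𝒜`: the value at `x` of the extension of `Ψ_S` to `M_𝒜` by continuity in the
weak operator topology, that is, the limit of `S_z` in that topology as `z ∈ 𝔹ₙ` tends to `x`. -/
def conjLim {n d : ℕ} {p : ℝ≥0∞} (q : ℝ≥0∞) [Fact (1 ≤ p)] [Fact (1 ≤ q)] {α : ℝ} [Fact (-1 < α)]
    (S : Bergman n d p α →L[ℂ] Bergman n d p α) (x : MaxIdealSpace n) :
    Bergman n d p α →L[ℂ] Bergman n d p α :=
  (limUnder (comap pointEval (𝓝 x))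
    (fun z : Ball n => ContinuousLinearMapWOT.ofCLM (conj q S z))).toCLM

end BergmanBall

end

/-!
Throughout, `γ = n + 1 + α`, `K_w(z) = (1 - w̄ z)^{-γ}` is the Bergman kernel and `P` is the integral
operator with this kernel.

**The operators exist.** The Bergman kernel satisfies the Schur test with powers of `1 - |w|²` as
weights (`lintegral_kern_weight_le`, `schur_test`), so `P` maps `L^p_α` boundedly onto `A^p_α`
(`bergmanProj`) and Toeplitz operators `T_φ = P M_φ` are bounded. The change of variables `w = φ_z(w')`
shows that `U_z^{(p,α)}` is an isometric involution, and that `(U_z^{(q,α)})^* = T_{b_z} U_z^{(p,α)}`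
for a unimodular function `b_z` (`adj_U`).

**The orbits are relatively compact.** For `S = T_φ` one has
`S_z = T_{b_z}^{-1} T_{b_z (φ ∘ φ_z)} T_{b_z}^{-1}` (`conj_toeplitz`). All symbols occurring here are
bounded by a constant, and `P` is compact on functions that live on a smaller ball
(`exists_finite_rank_approx`), hence `{P F}` is totally bounded when `F` runs through a bounded family
in `L^p_α` without mass escaping to the sphere (`totallyBounded_range_bergmanProj`). This applies to
`T_{b_z (φ ∘ φ_z)} f`, `z ∈ 𝔹ₙ`. It also applies to `T_{b_z}^{-1} f`: for a kernel function `f` the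
function `T_{b_z}^{-1} f` is explicit, because `b_z` is a quotient of a conjugate holomorphic function
and its conjugate (`unimodToeplitz_kernPreimage`), and the mass near the sphere is controlled by a
Forelli-Rudin estimate (`lintegral_weight_rpow_le`). Families of operators with totally bounded orbits
are stable under sums, products and uniform limits, so `{S_z f : z ∈ 𝔹ₙ}` is totally bounded for every
`S` in the Toeplitz algebra (`orbitTotallyBounded_conj`).

**Cluster points are unique.** The operator `(U_z^{(q,α)})^*` maps `K_a v` to a multiple of
`K_{φ_z(a)} v`, and explicit estimates show that this depends uniformly continuously on `z` with
respect to `ρ` (`uniformContinuous_adj_U_kernVec`). Hence the coordinates of `(S_z K_a v)(w)` are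
functions of `z` in the algebra `𝒜` (`exists_ucAlgebra_eq_conj_kernVec`); as such they converge when `z`
tends to a point `x` of the maximal ideal space, in which the ball is dense
(`neBot_comap_pointEval`). A relatively compact orbit with a single cluster point converges, so
`S_z K_a v` converges in norm, and so does `S_z f` for every `f`, by density. The limit is the weak
operator limit `S_x`, and a limit along all traces of neighbourhoods is continuous in `x`
(`continuous_of_tendsto_comap`).
-/

noncomputable section

namespace BergmanBall

/-! ### Algebra of the automorphisms -/

variable {n d : ℕ}

local notation "𝔼" => EuclideanSpace ℂ (Fin n)

/-- The number `(1 - |z|²)^{1/2}`. -/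
def defect {n : ℕ} (z : EuclideanSpace ℂ (Fin n)) : ℝ := Real.sqrt (1 - ‖z‖ ^ 2)

lemma defect_nonneg (z : 𝔼) : 0 ≤ defect z := Real.sqrt_nonneg _

lemma one_sub_norm_sq_pos {z : 𝔼} (hz : ‖z‖ < 1) : 0 < 1 - ‖z‖ ^ 2 := by
  nlinarith [norm_nonneg z]

lemma Ball.one_sub_norm_sq_pos (z : Ball n) : 0 < 1 - ‖(z : 𝔼)‖ ^ 2 :=
  BergmanBall.one_sub_norm_sq_pos z.norm_lt

lemma defect_sq {z : 𝔼} (hz : ‖z‖ < 1) : defect z ^ 2 = 1 - ‖z‖ ^ 2 :=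
  Real.sq_sqrt (one_sub_norm_sq_pos hz).le

lemma defect_pos {z : 𝔼} (hz : ‖z‖ < 1) : 0 < defect z :=
  Real.sqrt_pos.mpr (one_sub_norm_sq_pos hz)

lemma defect_le_one (z : 𝔼) : defect z ≤ 1 := by
  rw [defect, Real.sqrt_le_left (by norm_num)]
  nlinarith [norm_nonneg z]

/-- The positive operator `B_z = s + (1 + s)⁻¹ z z*`, `s = (1 - |z|²)^{1/2}`. It equals
`P_z + s (1 - P_z)`, so that `φ_z(w) = (z - B_z w) / (1 - z̄ w)`, and unlike the latter expression
it has no singularity at `z = 0`. -/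
def shear {n : ℕ} (z : EuclideanSpace ℂ (Fin n)) :
    EuclideanSpace ℂ (Fin n) →L[ℂ] EuclideanSpace ℂ (Fin n) :=
  (defect z : ℂ) • ContinuousLinearMap.id ℂ _ +
    (((1 + defect z)⁻¹ : ℝ) : ℂ) • (innerSL ℂ z).smulRight z

lemma shear_apply (z w : 𝔼) :
    shear z w = (defect z : ℂ) • w + ((((1 + defect z)⁻¹ : ℝ) : ℂ) * inner ℂ z w) • z := by
  simp [shear, smul_smul]

lemma inner_self_eq_of_norm_lt {z : 𝔼} (hz : ‖z‖ < 1) :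
    inner ℂ z z = 1 - (defect z : ℂ) ^ 2 := by
  rw [inner_self_eq_norm_sq_to_K]
  have := congrArg (fun x : ℝ => (x : ℂ)) (defect_sq hz)
  push_cast at this
  rw [this]
  simp

lemma one_add_defect_ne_zero (z : 𝔼) : (1 : ℂ) + defect z ≠ 0 := by
  have h : (0 : ℝ) < 1 + defect z := by linarith [defect_nonneg z]
  exact_mod_cast h.ne'

lemma shear_self {z : 𝔼} (hz : ‖z‖ < 1) : shear z z = z := by
  rw [shear_apply, inner_self_eq_of_norm_lt hz, ← add_smul]
  have := one_add_defect_ne_zero z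
  convert one_smul ℂ z
  push_cast
  field_simp
  ring

lemma inner_shear_left (z a b : 𝔼) : inner ℂ (shear z a) b = inner ℂ a (shear z b) := by
  rw [shear_apply, shear_apply, inner_add_left, inner_add_right, inner_smul_left, inner_smul_left,
    inner_smul_right, inner_smul_right, map_mul, Complex.conj_ofReal, Complex.conj_ofReal,
    inner_conj_symm]
  ring

lemma shear_shear {z : 𝔼} (hz : ‖z‖ < 1) (w : 𝔼) :
    shear z (shear z w) = ((defect z : ℂ) ^ 2) • w + (inner ℂ z w) • z := by
  rw [shear_apply z w, map_add, map_smul, map_smul, shear_self hz, shear_apply z w, smul_add,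
    smul_smul, smul_smul, add_assoc, ← add_smul]
  have := one_add_defect_ne_zero z
  congr 2
  · ring
  · push_cast
    field_simp
    ring

lemma one_sub_inner_ne_zero' {z w : 𝔼} (hz : ‖z‖ < 1) (hw : ‖w‖ < 1) : 1 - inner ℂ z w ≠ 0 :=
  one_sub_inner_ne_zero ⟨z, mem_ball_zero_iff.mpr hz⟩ ⟨w, mem_ball_zero_iff.mpr hw⟩

lemma autFun_eq {z : 𝔼} (hz : ‖z‖ < 1) (w : 𝔼) :
    autFun z w = (1 - inner ℂ z w)⁻¹ • (z - shear z w) := by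
  rw [autFun]
  congr 1
  rw [shear_apply, projLine]
  rcases eq_or_ne z 0 with rfl | h0
  · simp [defect]
  have h1 := one_add_defect_ne_zero z
  have h2 : ((‖z‖ ^ 2 : ℝ) : ℂ) = (1 - defect z) * (1 + defect z) := by
    have := defect_sq hz
    have h3 : ‖z‖ ^ 2 = (1 - defect z) * (1 + defect z) := by linarith
    rw [h3]; push_cast; ring
  have h4 : (1 : ℂ) - defect z ≠ 0 := by
    intro h
    rw [h, zero_mul] at h2
    simp [h0] at h2
  rw [h2, show Real.sqrt (1 - ‖z‖ ^ 2) = defect z from rfl]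
  rw [smul_sub, smul_smul, sub_sub, sub_right_inj, add_sub, add_comm, add_sub_assoc, ← sub_smul]
  congr 2
  push_cast
  field_simp

lemma one_sub_inner_autFun {z a b : 𝔼} (hz : ‖z‖ < 1) (ha : ‖a‖ < 1) (hb : ‖b‖ < 1) :
    1 - inner ℂ (autFun z a) (autFun z b) =
      (defect z : ℂ) ^ 2 * (1 - inner ℂ a b) / ((1 - inner ℂ a z) * (1 - inner ℂ z b)) := by
  have h1 := one_sub_inner_ne_zero' hz hb
  have h2 := one_sub_inner_ne_zero' ha hz
  rw [autFun_eq hz, autFun_eq hz, inner_smul_left, inner_smul_right, map_inv₀, map_sub, map_one,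
    inner_conj_symm, inner_sub_left, inner_sub_right, inner_sub_right, inner_shear_left,
    inner_shear_left, shear_shear hz, ← inner_shear_left, shear_self hz, inner_add_right,
    inner_smul_right, inner_smul_right, inner_self_eq_of_norm_lt hz]
  field_simp
  ring

lemma inner_autFun_left {z b : 𝔼} (hz : ‖z‖ < 1) (hb : ‖b‖ < 1) :
    1 - inner ℂ z (autFun z b) = (defect z : ℂ) ^ 2 / (1 - inner ℂ z b) := by
  have h1 := one_sub_inner_ne_zero' hz hb
  rw [autFun_eq hz, inner_smul_right, inner_sub_right, ← inner_shear_left, shear_self hz,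
    inner_self_eq_of_norm_lt hz]
  field_simp
  ring

/-- The numerator identity `z - B_z φ_z(w) = (1 - z̄ φ_z(w)) w`. -/
lemma sub_shear_autFun {z w : 𝔼} (hz : ‖z‖ < 1) (hw : ‖w‖ < 1) :
    z - shear z (autFun z w) = (1 - inner ℂ z (autFun z w)) • w := by
  have h1 := one_sub_inner_ne_zero' hz hw
  rw [inner_autFun_left hz hw, autFun_eq hz, map_smul, map_sub, shear_self hz, shear_shear hz]
  have h2 : z = (1 - inner ℂ z w)⁻¹ • ((1 - inner ℂ z w) • z) := by
    rw [smul_smul, inv_mul_cancel₀ h1, one_smul]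
  nth_rw 1 [h2]
  rw [← smul_sub, div_eq_inv_mul, mul_smul]
  congr 1
  rw [sub_smul, one_smul]
  abel

lemma norm_autFun_lt' {z w : 𝔼} (hz : ‖z‖ < 1) (hw : ‖w‖ < 1) : ‖autFun z w‖ < 1 :=
  norm_autFun_lt ⟨z, mem_ball_zero_iff.mpr hz⟩ ⟨w, mem_ball_zero_iff.mpr hw⟩

lemma autFun_autFun {z w : 𝔼} (hz : ‖z‖ < 1) (hw : ‖w‖ < 1) : autFun z (autFun z w) = w := by
  have h1 := one_sub_inner_ne_zero' hz (norm_autFun_lt' hz hw)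
  rw [autFun_eq hz (autFun z w), sub_shear_autFun hz hw, smul_smul, inv_mul_cancel₀ h1, one_smul]

lemma autFun_zero (z : 𝔼) : autFun z 0 = z := by
  simp [autFun, projLine]

lemma autFun_self {z : 𝔼} (hz : ‖z‖ < 1) : autFun z z = 0 := by
  rw [autFun_eq hz, shear_self hz, sub_self, smul_zero]

@[simp] lemma coe_aut (z w : Ball n) : (aut z w : 𝔼) = autFun (z : 𝔼) w := rfl

lemma aut_aut (z w : Ball n) : aut z (aut z w) = w :=
  Subtype.ext (autFun_autFun z.norm_lt w.norm_lt)

/-- The origin of the ball. -/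
def Ball.zero (n : ℕ) : Ball n := ⟨0, by simp⟩

@[simp] lemma Ball.coe_zero : (Ball.zero n : 𝔼) = 0 := rfl

lemma aut_zero (z : Ball n) : aut z (Ball.zero n) = z := Subtype.ext (autFun_zero _)

lemma rho_self (z : Ball n) : rho z z = 0 := by
  simp [rho, autFun_self z.norm_lt]

lemma rho_nonneg (z w : Ball n) : 0 ≤ rho z w := norm_nonneg _

lemma rho_lt_one (z w : Ball n) : rho z w < 1 := (aut z w).norm_lt

lemma norm_one_sub_inner_comm (z w : 𝔼) : ‖1 - inner ℂ z w‖ = ‖1 - inner ℂ w z‖ := by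
  rw [← Complex.norm_conj, map_sub, map_one, inner_conj_symm]

lemma continuous_autFun (z : Ball n) : Continuous fun w : Ball n => autFun (z : 𝔼) w := by
  have : (fun w : Ball n => autFun (z : 𝔼) w) =
      fun w : Ball n => (1 - inner ℂ (z : 𝔼) (w : 𝔼))⁻¹ • ((z : 𝔼) - shear (z : 𝔼) w) := by
    funext w; exact autFun_eq z.norm_lt _
  rw [this]
  refine Continuous.smul (Continuous.inv₀ (by fun_prop) fun w => one_sub_inner_ne_zero z w)
    (by fun_prop)

lemma continuous_aut (z : Ball n) : Continuous (aut z) :=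
  (continuous_autFun z).subtype_mk _

/-- The derivative of `φ_z` at `w`. -/
lemma hasFDerivAt_autFun {z w : 𝔼} (hz : ‖z‖ < 1) (hw : ‖w‖ < 1) :
    HasFDerivAt (autFun z)
      ((1 - inner ℂ z w)⁻¹ • ((innerSL ℂ z).smulRight (autFun z w) - shear z)) w := by
  have h1 := one_sub_inner_ne_zero' hz hw
  have : autFun z = fun w => (1 - inner ℂ z w)⁻¹ • (z - shear z w) := by
    funext w; exact autFun_eq hz _
  rw [this]
  have hD : HasFDerivAt (fun w : 𝔼 => 1 - inner ℂ z w) (-(innerSL ℂ z)) w := by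
    have := (innerSL ℂ z).hasFDerivAt (x := w)
    simpa using this.const_sub (1 : ℂ)
  have hinv := (hasFDerivAt_inv h1).comp w hD
  have hN : HasFDerivAt (fun w : 𝔼 => z - shear z w) (-(shear z)) w :=
    (shear z).hasFDerivAt.const_sub z
  refine (hinv.smul hN).congr_fderiv ?_
  ext1 v
  simp only [add_apply, smul_apply, neg_apply, ContinuousLinearMap.smulRight_apply,
    sub_apply, innerSL_apply_apply, ContinuousLinearMap.comp_apply,
    Function.comp_apply, ContinuousLinearMap.toSpanSingleton_apply]
  rw [smul_neg, ← sub_eq_neg_add, smul_sub (1 - inner ℂ z w)⁻¹]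
  simp only [smul_smul]
  congr 2
  rw [smul_eq_mul]
  field_simp

end BergmanBall
end

noncomputable section

namespace BergmanBall

/-! ### The change of variables `w ↦ φ_z(w)` -/

variable {n d : ℕ}

local notation "𝔼" => EuclideanSpace ℂ (Fin n)

lemma det_smul_transvection (a : ℂ) (x y : 𝔼) :
    (a • (ContinuousLinearMap.id ℂ 𝔼 + (innerSL ℂ x).smulRight y)).det =
      a ^ n * (1 + inner ℂ x y) := by
  have h : ((a • (ContinuousLinearMap.id ℂ 𝔼 + (innerSL ℂ x).smulRight y) : 𝔼 →L[ℂ] 𝔼) :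
      𝔼 →ₗ[ℂ] 𝔼) = a • LinearMap.transvection ((innerSL ℂ x : 𝔼 →L[ℂ] ℂ) : 𝔼 →ₗ[ℂ] ℂ) y := by
    ext v
    simp [LinearMap.transvection]
  rw [ContinuousLinearMap.det, h, LinearMap.det_smul, LinearMap.transvection.det]
  simp

lemma det_shear {z : 𝔼} (hz : ‖z‖ < 1) :
    (shear z).det = (defect z : ℂ) ^ n * (defect z : ℂ)⁻¹ := by
  have h0 : (defect z : ℂ) ≠ 0 := by exact_mod_cast (defect_pos hz).ne'
  have h1 := one_add_defect_ne_zero z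
  have h : shear z = (defect z : ℂ) • (ContinuousLinearMap.id ℂ 𝔼 +
      (innerSL ℂ z).smulRight (((defect z : ℂ)⁻¹ * (1 + (defect z : ℂ))⁻¹) • z)) := by
    ext1 v
    rw [shear_apply]
    simp only [smul_apply, add_apply, ContinuousLinearMap.id_apply,
      ContinuousLinearMap.smulRight_apply, innerSL_apply_apply, smul_add, smul_smul]
    congr 2
    push_cast
    field_simp
  rw [h, det_smul_transvection, inner_smul_right, inner_self_eq_of_norm_lt hz]
  congr 1
  field_simp
  ring

/-- The complex derivative of `φ_z` at `w`. -/
def autDeriv {n : ℕ} (z w : EuclideanSpace ℂ (Fin n)) :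
    EuclideanSpace ℂ (Fin n) →L[ℂ] EuclideanSpace ℂ (Fin n) :=
  (1 - inner ℂ z w)⁻¹ • ((innerSL ℂ z).smulRight (autFun z w) - shear z)

lemma det_autDeriv {z w : 𝔼} (hz : ‖z‖ < 1) (hw : ‖w‖ < 1) :
    (autDeriv z w).det = (-1) ^ n * (defect z : ℂ) ^ (n + 1) / (1 - inner ℂ z w) ^ (n + 1) := by
  have hD := one_sub_inner_ne_zero' hz hw
  have h0 : (defect z : ℂ) ≠ 0 := by exact_mod_cast (defect_pos hz).ne'
  -- The derivative is a shear composed with a multiple of a rank-one perturbation of the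
  -- identity.
  have h : autDeriv z w = (shear z).comp ((-(1 - inner ℂ z w)⁻¹) •
      (ContinuousLinearMap.id ℂ 𝔼 +
        (innerSL ℂ z).smulRight (-(1 - inner ℂ z w)⁻¹ • (z - w)))) := by
    ext1 v
    simp only [autDeriv, smul_apply, add_apply, sub_apply, ContinuousLinearMap.id_apply,
      ContinuousLinearMap.smulRight_apply, innerSL_apply_apply, ContinuousLinearMap.comp_apply,
      map_add, map_smul, map_sub, shear_self hz, autFun_eq hz]
    rw [neg_smul, neg_smul, ← smul_neg]
    congr 1
    rw [smul_neg]
    abel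
  rw [h]
  have hcomp : ∀ A B : 𝔼 →L[ℂ] 𝔼, (A.comp B).det = A.det * B.det := fun A B => by
    simp [ContinuousLinearMap.det, LinearMap.det_comp]
  rw [hcomp, det_shear hz, det_smul_transvection, inner_smul_right, inner_sub_right,
    inner_self_eq_of_norm_lt hz, neg_pow, inv_pow]
  field_simp
  ring

/-- The real Jacobian of `φ_z`. -/
lemma abs_det_autDeriv {z w : 𝔼} (hz : ‖z‖ < 1) (hw : ‖w‖ < 1) :
    |((autDeriv z w).restrictScalars ℝ).det| =
      ((1 - ‖z‖ ^ 2) / ‖1 - inner ℂ z w‖ ^ 2) ^ (n + 1) := by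
  have h : ((autDeriv z w).restrictScalars ℝ).det = Complex.normSq (autDeriv z w).det := by
    have := LinearMap.det_restrictScalars (R := ℝ) (S := ℂ)
      (f := ((autDeriv z w : 𝔼 →L[ℂ] 𝔼) : 𝔼 →ₗ[ℂ] 𝔼))
    rw [Algebra.norm_complex_apply] at this
    exact this
  rw [h, det_autDeriv hz hw, abs_of_nonneg (Complex.normSq_nonneg _), Complex.normSq_eq_norm_sq]
  rw [norm_div, norm_mul, norm_pow, norm_pow, norm_pow, norm_neg, norm_one, one_pow, one_mul,
    Complex.norm_real, Real.norm_of_nonneg (defect_nonneg z), ← div_pow, ← pow_mul, mul_comm,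
    pow_mul, div_pow, defect_sq hz]

lemma image_autFun {z : 𝔼} (hz : ‖z‖ < 1) :
    autFun z '' Metric.ball 0 1 = Metric.ball 0 1 := by
  ext w
  constructor
  · rintro ⟨v, hv, rfl⟩
    exact mem_ball_zero_iff.mpr (norm_autFun_lt' hz (mem_ball_zero_iff.mp hv))
  · intro hw
    have hw' := mem_ball_zero_iff.mp hw
    exact ⟨_, mem_ball_zero_iff.mpr (norm_autFun_lt' hz hw'), autFun_autFun hz hw'⟩

/-- The density `((1 - |z|²) / |1 - z̄ w|²)^{n+1+α}` of the image of `dv_α` under `φ_z`. -/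
def autDensity {n : ℕ} (α : ℝ) (z w : Ball n) : ℝ :=
  ((1 - ‖(z : EuclideanSpace ℂ (Fin n))‖ ^ 2) /
    ‖1 - inner ℂ (z : EuclideanSpace ℂ (Fin n)) (w : EuclideanSpace ℂ (Fin n))‖ ^ 2) ^
      ((n : ℝ) + 1 + α)

lemma norm_one_sub_inner_pos (z w : Ball n) : 0 < ‖1 - inner ℂ (z : 𝔼) (w : 𝔼)‖ :=
  norm_pos_iff.mpr (one_sub_inner_ne_zero z w)

lemma autDensity_pos (α : ℝ) (z w : Ball n) : 0 < autDensity α z w :=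
  Real.rpow_pos_of_pos (div_pos z.one_sub_norm_sq_pos (pow_pos (norm_one_sub_inner_pos z w) 2)) _

lemma continuous_autDensity (α : ℝ) (z : Ball n) : Continuous (autDensity α z) := by
  unfold autDensity
  refine Continuous.rpow_const ?_ fun w => Or.inl
    (div_pos z.one_sub_norm_sq_pos (pow_pos (norm_one_sub_inner_pos z w) 2)).ne'
  refine Continuous.div (by fun_prop) (by fun_prop) fun w => ?_
  exact (pow_pos (norm_one_sub_inner_pos z w) 2).ne'

lemma lintegral_weightMeasure (α : ℝ) {g : Ball n → ℝ≥0∞} (hg : Measurable g) :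
    ∫⁻ w, g w ∂(weightMeasure n α) = ∫⁻ w : Ball n,
      ENNReal.ofReal ((1 - ‖(w : 𝔼)‖ ^ 2) ^ α) * g w
        ∂((volume : Measure 𝔼).comap Subtype.val) := by
  rw [weightMeasure, lintegral_withDensity_eq_lintegral_mul _ (by fun_prop) hg]
  rfl

/-- Change of variables by `φ_z`: the Jacobian contributes the power `n + 1` of
`(1 - |z|²) / |1 - z̄ w|²`, and the weight `(1 - |φ_z(w)|²)^α` contributes the power `α`. -/
lemma lintegral_autDensity_mul_aut (α : ℝ) (z : Ball n) {g : Ball n → ℝ≥0∞} (hg : Measurable g) :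
    ∫⁻ w, ENNReal.ofReal (autDensity α z w) * g (aut z w) ∂(vMeasure n α) =
      ∫⁻ w, g w ∂(vMeasure n α) := by
  have hball : MeasurableSet (Metric.ball (0 : 𝔼) 1) := measurableSet_ball
  rw [vMeasure, lintegral_smul_measure, lintegral_smul_measure]
  congr 1
  have hm1 : Measurable fun w => ENNReal.ofReal (autDensity α z w) * g (aut z w) :=
    (ENNReal.measurable_ofReal.comp (continuous_autDensity α z).measurable).mul
      (hg.comp (continuous_aut z).measurable)
  rw [lintegral_weightMeasure α hg, lintegral_weightMeasure α hm1]
  set G : 𝔼 → ℝ≥0∞ := Function.extend Subtype.val g 0 with hG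
  have hGg : ∀ w : Ball n, G w = g w := fun w => Subtype.val_injective.extend_apply _ _ _
  have e1 := lintegral_subtype_comap (μ := (volume : Measure 𝔼)) hball
    (fun w => ENNReal.ofReal ((1 - ‖w‖ ^ 2) ^ α) * G w)
  have e2 := lintegral_subtype_comap (μ := (volume : Measure 𝔼)) hball
    (fun w => ENNReal.ofReal |((autDeriv (z : 𝔼) w).restrictScalars ℝ).det| *
      (ENNReal.ofReal ((1 - ‖autFun (z : 𝔼) w‖ ^ 2) ^ α) * G (autFun (z : 𝔼) w)))
  have e3 := lintegral_image_eq_lintegral_abs_det_fderiv_mul (volume : Measure 𝔼) hball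
    (f := autFun (z : 𝔼)) (f' := fun w => (autDeriv (z : 𝔼) w).restrictScalars ℝ)
    (fun w hw => ((hasFDerivAt_autFun z.norm_lt
      (mem_ball_zero_iff.mp hw)).restrictScalars ℝ).hasFDerivWithinAt)
    (fun a ha b hb hab => by
      rw [← autFun_autFun z.norm_lt (mem_ball_zero_iff.mp ha), hab,
        autFun_autFun z.norm_lt (mem_ball_zero_iff.mp hb)])
    (fun w => ENNReal.ofReal ((1 - ‖w‖ ^ 2) ^ α) * G w)
  rw [image_autFun z.norm_lt] at e3
  simp only [hGg] at e1
  rw [e1, e3, ← e2]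
  refine lintegral_congr fun (w : Ball n) => ?_
  rw [← coe_aut, hGg, abs_det_autDeriv z.norm_lt w.norm_lt, ← mul_assoc, ← mul_assoc]
  congr 1
  have hz := z.one_sub_norm_sq_pos
  have hw := w.one_sub_norm_sq_pos
  have hD := norm_one_sub_inner_pos z w
  rw [← ENNReal.ofReal_mul (by positivity), ← ENNReal.ofReal_mul (by positivity)]
  congr 1
  rw [coe_aut, one_sub_norm_autFun_sq, autDensity, Real.rpow_add (by positivity), mul_div_right_comm,
    Real.mul_rpow (div_pos hz (by positivity)).le hw.le]
  have : ((n : ℝ) + 1) = ((n + 1 : ℕ) : ℝ) := by push_cast; ring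
  rw [this, Real.rpow_natCast]
  ring

lemma measure_aut_preimage_eq_zero (α : ℝ) (z : Ball n) {s : Set (Ball n)}
    (hs : vMeasure n α s = 0) : vMeasure n α (aut z ⁻¹' s) = 0 := by
  set t := toMeasurable (vMeasure n α) s
  have ht : MeasurableSet t := measurableSet_toMeasurable _ _
  refine measure_mono_null (Set.preimage_mono (subset_toMeasurable (vMeasure n α) s)) ?_
  have h := lintegral_autDensity_mul_aut α z (g := t.indicator 1) (measurable_one.indicator ht)
  rw [lintegral_indicator_one ht, measure_toMeasurable, hs, lintegral_eq_zero_iff] at h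
  · have h2 : vMeasure n α {w | ¬ (ENNReal.ofReal (autDensity α z w) *
        t.indicator 1 (aut z w) = 0)} = 0 := h
    convert h2 using 2
    ext w
    have := autDensity_pos α z w
    simp [this, t]
  · exact (ENNReal.measurable_ofReal.comp (continuous_autDensity α z).measurable).mul
      ((measurable_one.indicator ht).comp (continuous_aut z).measurable)

lemma quasiMeasurePreserving_aut (α : ℝ) (z : Ball n) :
    Measure.QuasiMeasurePreserving (aut z) (vMeasure n α) (vMeasure n α) :=
  ⟨(continuous_aut z).measurable, Measure.AbsolutelyContinuous.mk fun s hs h => by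
    rw [Measure.map_apply (continuous_aut z).measurable hs]
    exact measure_aut_preimage_eq_zero α z h⟩

lemma map_aut_withDensity (α : ℝ) (z : Ball n) :
    ((vMeasure n α).withDensity (fun w => ENNReal.ofReal (autDensity α z w))).map (aut z) =
      vMeasure n α := by
  have hm : Measurable fun w => ENNReal.ofReal (autDensity α z w) :=
    ENNReal.measurable_ofReal.comp (continuous_autDensity α z).measurable
  ext s hs
  rw [Measure.map_apply (continuous_aut z).measurable hs,
    withDensity_apply _ ((continuous_aut z).measurable hs),
    ← lintegral_indicator_one hs, ← lintegral_autDensity_mul_aut α z (measurable_one.indicator hs),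
    ← lintegral_indicator ((continuous_aut z).measurable hs)]
  refine lintegral_congr fun w => ?_
  by_cases h : aut z w ∈ s
  · simp [h]
  · simp [h]

/-- The homeomorphism of the ball given by `φ_z`. -/
def autEquiv {n : ℕ} (z : Ball n) : Ball n ≃ₜ Ball n where
  toFun := aut z
  invFun := aut z
  left_inv := aut_aut z
  right_inv := aut_aut z
  continuous_toFun := continuous_aut z
  continuous_invFun := continuous_aut z

variable {F : Type*} [NormedAddCommGroup F] [NormedSpace ℝ F]

lemma integral_autDensity_smul_aut (α : ℝ) (z : Ball n) (g : Ball n → F) :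
    ∫ w, autDensity α z w • g (aut z w) ∂(vMeasure n α) = ∫ w, g w ∂(vMeasure n α) := by
  have hm : Measurable fun w => (autDensity α z w).toNNReal :=
    (continuous_autDensity α z).measurable.real_toNNReal
  conv_rhs => rw [← map_aut_withDensity α z]
  have he : MeasurableEmbedding (aut z) := (autEquiv z).measurableEmbedding
  rw [he.integral_map]
  have := integral_withDensity_eq_integral_smul (μ := vMeasure n α) hm (fun w => g (aut z w))
  refine Eq.trans ?_ this.symm
  refine integral_congr_ae (ae_of_all _ fun w => ?_)
  simp only [NNReal.smul_def]
  rw [Real.coe_toNNReal _ (autDensity_pos α z w).le]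

lemma integrable_autDensity_smul_aut_iff (α : ℝ) (z : Ball n) (g : Ball n → F) :
    Integrable (fun w => autDensity α z w • g (aut z w)) (vMeasure n α) ↔
      Integrable g (vMeasure n α) := by
  have hm : Measurable fun w => (autDensity α z w).toNNReal :=
    (continuous_autDensity α z).measurable.real_toNNReal
  conv_rhs => rw [← map_aut_withDensity α z]
  have he : MeasurableEmbedding (aut z) := (autEquiv z).measurableEmbedding
  rw [he.integrable_map_iff]
  have := integrable_withDensity_iff_integrable_smul (μ := vMeasure n α) hm
    (g := fun w => g (aut z w))
  refine Iff.trans ?_ this.symm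
  refine integrable_congr (ae_of_all _ fun w => ?_)
  simp only [NNReal.smul_def]
  rw [Real.coe_toNNReal _ (autDensity_pos α z w).le]

end BergmanBall
end

noncomputable section

namespace BergmanBall

/-! ### The mean value property and the reproducing formula -/

variable {n d : ℕ}

local notation "𝔼" => EuclideanSpace ℂ (Fin n)

/-- Multiplication by a complex number of modulus one, as a map of the ball. -/
def rot {n : ℕ} (θ : ℝ) (w : Ball n) : Ball n :=
  ⟨circleMap 0 1 θ • (w : EuclideanSpace ℂ (Fin n)), by
    rw [mem_ball_zero_iff, norm_smul]
    simpa using w.norm_lt⟩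

lemma continuous_rot_uncurry : Continuous fun x : ℝ × Ball n => rot x.1 x.2 := by
  refine Continuous.subtype_mk ?_ _
  exact ((continuous_circleMap 0 1).comp continuous_fst).smul
    (continuous_subtype_val.comp continuous_snd)

lemma continuous_rot (θ : ℝ) : Continuous (rot θ : Ball n → Ball n) := by
  have h : ∀ c : ℂ, Continuous fun w : Ball n => c • (w : 𝔼) := fun c => by fun_prop
  exact (h _).subtype_mk _

/-- Multiplication by a complex number of modulus one, as a linear isometry. -/
def rotIsometry (n : ℕ) (θ : ℝ) :
    EuclideanSpace ℂ (Fin n) ≃ₗᵢ[ℝ] EuclideanSpace ℂ (Fin n) where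
  toLinearEquiv := (LinearEquiv.smulOfNeZero ℂ (EuclideanSpace ℂ (Fin n)) (circleMap 0 1 θ)
    (circleMap_ne_center one_ne_zero)).restrictScalars ℝ
  norm_map' w := by
    change ‖circleMap 0 1 θ • w‖ = ‖w‖
    simp [norm_smul]

lemma lintegral_rot (α θ : ℝ) {g : Ball n → ℝ≥0∞} (hg : Measurable g) :
    ∫⁻ w, g (rot θ w) ∂(vMeasure n α) = ∫⁻ w, g w ∂(vMeasure n α) := by
  have hball : MeasurableSet (Metric.ball (0 : 𝔼) 1) := measurableSet_ball
  rw [vMeasure, lintegral_smul_measure, lintegral_smul_measure]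
  congr 1
  rw [lintegral_weightMeasure α hg,
    lintegral_weightMeasure α (g := fun w => g (rot θ w))
      (hg.comp (continuous_rot θ).measurable)]
  set G : 𝔼 → ℝ≥0∞ := Function.extend Subtype.val g 0 with hG
  have hGg : ∀ w : Ball n, G w = g w := fun w => Subtype.val_injective.extend_apply _ _ _
  have e1 := lintegral_subtype_comap (μ := (volume : Measure 𝔼)) hball
    (fun w => ENNReal.ofReal ((1 - ‖w‖ ^ 2) ^ α) * G w)
  have e2 := lintegral_subtype_comap (μ := (volume : Measure 𝔼)) hball
    (fun w => ENNReal.ofReal ((1 - ‖w‖ ^ 2) ^ α) * G (rotIsometry n θ w))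
  have e3 := (rotIsometry n θ).measurePreserving.setLIntegral_comp_preimage_emb
    (rotIsometry n θ).toHomeomorph.measurableEmbedding
    (fun w => ENNReal.ofReal ((1 - ‖w‖ ^ 2) ^ α) * G w) (Metric.ball 0 1)
  have hpre : rotIsometry n θ ⁻¹' Metric.ball 0 1 = Metric.ball 0 1 := by
    ext w; simp
  rw [hpre] at e3
  simp only [LinearIsometryEquiv.norm_map] at e3
  simp only [hGg] at e1
  rw [e1, ← e3, ← e2]
  refine lintegral_congr fun (w : Ball n) => ?_
  rw [← hGg]
  rfl

lemma measurePreserving_rot (α θ : ℝ) :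
    MeasurePreserving (rot θ) (vMeasure n α) (vMeasure n α) := by
  refine ⟨(continuous_rot θ).measurable, ?_⟩
  ext s hs
  rw [Measure.map_apply (continuous_rot θ).measurable hs, ← lintegral_indicator_one hs,
    ← lintegral_rot α θ (measurable_one.indicator hs),
    ← lintegral_indicator_one ((continuous_rot θ).measurable hs)]
  rfl

lemma measurableEmbedding_rot (θ : ℝ) : MeasurableEmbedding (rot θ : Ball n → Ball n) := by
  have h : ∀ (a b : ℝ) (w : Ball n), a + b = 0 → rot a (rot b w) = w := fun a b w hab =>
    Subtype.ext (by simp [rot, circleMap, smul_smul, ← Complex.exp_add, ← add_mul,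
      ← Complex.ofReal_add, hab])
  exact (Homeomorph.mk ⟨rot θ, rot (-θ), fun w => h _ _ w (by simp), fun w => h _ _ w (by simp)⟩
    (continuous_rot θ) (continuous_rot (-θ))).measurableEmbedding

section Holomorphic

variable {F : Type*} [NormedAddCommGroup F] [NormedSpace ℂ F]

lemma IsHolomorphic.smul {c : Ball n → ℂ} {f : Ball n → F} (hc : IsHolomorphic c)
    (hf : IsHolomorphic f) : IsHolomorphic fun w => c w • f w := by
  obtain ⟨C, hC, hCc⟩ := hc
  obtain ⟨G, hG, hGf⟩ := hf
  exact ⟨fun w => C w • G w, hC.smul hG, fun z => by simp only [hCc, hGf]⟩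

lemma IsHolomorphic.comp_aut {f : Ball n → F} (hf : IsHolomorphic f) (z : Ball n) :
    IsHolomorphic fun w => f (aut z w) := by
  obtain ⟨G, hG, hGf⟩ := hf
  refine ⟨fun w => G (autFun (z : 𝔼) w), ?_, fun w => hGf (aut z w)⟩
  refine hG.comp (fun w hw => (hasFDerivAt_autFun z.norm_lt
    (mem_ball_zero_iff.mp hw)).differentiableAt.differentiableWithinAt) fun w hw => ?_
  exact mem_ball_zero_iff.mpr (norm_autFun_lt' z.norm_lt (mem_ball_zero_iff.mp hw))

lemma isHolomorphic_const (c : F) : IsHolomorphic fun _ : Ball n => c :=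
  ⟨fun _ => c, differentiableOn_const c, fun _ => rfl⟩

end Holomorphic

lemma one_sub_inner_re_pos {z w : 𝔼} (hz : ‖z‖ ≤ 1) (hw : ‖w‖ < 1) :
    0 < (1 - inner ℂ z w).re := by
  have h1 := Complex.re_le_norm (inner ℂ z w)
  have h2 := norm_inner_le_norm (𝕜 := ℂ) z w
  have h3 : ‖z‖ * ‖w‖ ≤ ‖w‖ := mul_le_of_le_one_left (norm_nonneg w) hz
  rw [Complex.sub_re, Complex.one_re]
  linarith

lemma one_sub_inner_mem_slitPlane {z w : 𝔼} (hz : ‖z‖ ≤ 1) (hw : ‖w‖ < 1) :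
    1 - inner ℂ z w ∈ Complex.slitPlane := Or.inl (one_sub_inner_re_pos hz hw)

lemma one_sub_norm_le_norm_one_sub_inner {z w : 𝔼} (hz : ‖z‖ ≤ 1) :
    1 - ‖w‖ ≤ ‖1 - inner ℂ z w‖ := by
  have h1 := norm_sub_norm_le (1 : ℂ) (inner ℂ z w)
  have h2 := norm_inner_le_norm (𝕜 := ℂ) z w
  have h3 : ‖z‖ * ‖w‖ ≤ ‖w‖ := mul_le_of_le_one_left (norm_nonneg w) hz
  rw [norm_one] at h1
  linarith

lemma norm_one_sub_inner_lt_two {z w : 𝔼} (hz : ‖z‖ ≤ 1) (hw : ‖w‖ < 1) :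
    ‖1 - inner ℂ z w‖ < 2 := by
  have h1 := norm_sub_le (1 : ℂ) (inner ℂ z w)
  have h2 := norm_inner_le_norm (𝕜 := ℂ) z w
  have h3 : ‖z‖ * ‖w‖ ≤ ‖w‖ := mul_le_of_le_one_left (norm_nonneg w) hz
  rw [norm_one] at h1
  linarith

lemma isHolomorphic_cpow {z : 𝔼} (hz : ‖z‖ ≤ 1) (a : ℂ) :
    IsHolomorphic fun w : Ball n => (1 - inner ℂ z (w : 𝔼)) ^ a := by
  refine ⟨fun w => (1 - inner ℂ z w) ^ a, fun w hw => ?_, fun _ => rfl⟩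
  refine DifferentiableAt.differentiableWithinAt ?_
  have h : DifferentiableAt ℂ (fun w : 𝔼 => 1 - inner ℂ z w) w :=
    ((innerSL ℂ z).differentiableAt).const_sub 1
  exact h.cpow_const (one_sub_inner_mem_slitPlane hz (mem_ball_zero_iff.mp hw))

/-- The Bergman kernel `K_w(z) = (1 - w̄ z)^{-(n+1+α)}`. -/
def kern {n : ℕ} (α : ℝ) (w z : EuclideanSpace ℂ (Fin n)) : ℂ :=
  ((1 - inner ℂ w z) ^ (((n : ℝ) + 1 + α : ℝ) : ℂ))⁻¹

lemma norm_kern (α : ℝ) (w z : 𝔼) :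
    ‖kern α w z‖ = (‖1 - inner ℂ w z‖ ^ ((n : ℝ) + 1 + α))⁻¹ := by
  rw [kern, norm_inv, Complex.norm_cpow_real]

lemma conj_cpow_real {x : ℂ} (hx : x ∈ Complex.slitPlane) (a : ℝ) :
    (starRingEnd ℂ) (x ^ (a : ℂ)) = ((starRingEnd ℂ) x) ^ (a : ℂ) := by
  rw [Complex.conj_cpow _ _ (Complex.slitPlane_arg_ne_pi hx), Complex.conj_ofReal]

lemma conj_one_sub_inner_cpow {z w : 𝔼} (hz : ‖z‖ ≤ 1) (hw : ‖w‖ < 1) (a : ℝ) :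
    (starRingEnd ℂ) ((1 - inner ℂ z w) ^ (a : ℂ)) = (1 - inner ℂ w z) ^ (a : ℂ) := by
  rw [conj_cpow_real (one_sub_inner_mem_slitPlane hz hw), map_sub, map_one, inner_conj_symm]

lemma conj_kern (α : ℝ) {w z : 𝔼} (hw : ‖w‖ ≤ 1) (hz : ‖z‖ < 1) :
    (starRingEnd ℂ) (kern α w z) = kern α z w := by
  rw [kern, map_inv₀, conj_one_sub_inner_cpow hw hz, kern]

lemma exponent_pos (n : ℕ) {α : ℝ} (hα : -1 < α) : 0 < (n : ℝ) + 1 + α := by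
  have : (0 : ℝ) ≤ n := Nat.cast_nonneg n
  linarith

lemma norm_kern_le {α : ℝ} (hα : -1 < α) {w z : 𝔼} (hw : ‖w‖ ≤ 1) (hz : ‖z‖ < 1) :
    ‖kern α w z‖ ≤ ((1 - ‖z‖) ^ ((n : ℝ) + 1 + α))⁻¹ := by
  rw [norm_kern]
  have h : 0 < 1 - ‖z‖ := by linarith
  exact inv_anti₀ (Real.rpow_pos_of_pos h _) (Real.rpow_le_rpow h.le
    (one_sub_norm_le_norm_one_sub_inner hw) (exponent_pos n hα).le)

lemma continuous_kern_left (α : ℝ) (z : Ball n) :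
    Continuous fun w : Ball n => kern α (w : 𝔼) z := by
  unfold kern
  refine Continuous.inv₀ (Continuous.cpow (by fun_prop) continuous_const fun w =>
    one_sub_inner_mem_slitPlane w.norm_lt.le z.norm_lt) fun w => ?_
  exact fun h => one_sub_inner_ne_zero w z (Complex.cpow_eq_zero_iff _ _ |>.mp h).1

lemma isHolomorphic_kern (α : ℝ) {z : 𝔼} (hz : ‖z‖ ≤ 1) :
    IsHolomorphic fun w : Ball n => kern α z (w : 𝔼) := by
  have := isHolomorphic_cpow (n := n) hz (-(((n : ℝ) + 1 + α : ℝ) : ℂ))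
  simpa only [kern, Complex.cpow_neg] using this

variable {F : Type*} [NormedAddCommGroup F] [NormedSpace ℂ F] [CompleteSpace F]

/-- The mean value property. -/
lemma IsHolomorphic.integral_eq {α : ℝ} [hα : Fact (-1 < α)] {f : Ball n → F}
    (hf : IsHolomorphic f) (hi : Integrable f (vMeasure n α)) :
    ∫ w, f w ∂(vMeasure n α) = f (Ball.zero n) := by
  have hc := hf.continuous
  obtain ⟨g, hg, hgf⟩ := hf
  have h2π : (0 : ℝ) ≤ 2 * Real.pi := by positivity
  -- On the disc `{x • w : |x| ≤ 1}` this is the mean value property in one variable. Since `v_α`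
  -- is invariant under rotations, averaging it over the ball gives the claim by Fubini.
  have havg : ∀ w : Ball n,
      (2 * Real.pi)⁻¹ • ∫ θ in (0 : ℝ)..2 * Real.pi, f (rot θ w) = f (Ball.zero n) := by
    intro w
    have hdiff : ∀ x ∈ Metric.closedBall (0 : ℂ) 1,
        DifferentiableAt ℂ (fun x : ℂ => g (x • (w : 𝔼))) x := by
      intro x hx
      have hx' : ‖x • (w : 𝔼)‖ < 1 := by
        rw [norm_smul]
        exact (mul_le_of_le_one_left (norm_nonneg _) (mem_closedBall_zero_iff.mp hx)).trans_lt
          w.norm_lt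
      have hg' := hg.differentiableAt (Metric.isOpen_ball.mem_nhds (mem_ball_zero_iff.mpr hx'))
      have hl : DifferentiableAt ℂ (fun x : ℂ => x • (w : 𝔼)) x := by fun_prop
      exact DifferentiableAt.comp x hg' hl
    have hdc : DiffContOnCl ℂ (fun x : ℂ => g (x • (w : 𝔼))) (Metric.ball 0 |1|) := by
      rw [abs_one]
      refine DifferentiableOn.diffContOnCl fun x hx => ?_
      rw [closure_ball _ one_ne_zero] at hx
      exact (hdiff x hx).differentiableWithinAt
    have := hdc.circleAverage
    rw [Real.circleAverage, zero_smul] at this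
    rw [← hgf, Ball.coe_zero, ← this]
    congr 1
    refine intervalIntegral.integral_congr fun θ _ => ?_
    rw [← hgf]
    rfl
  have hrot : ∀ θ : ℝ, ∫ w, f (rot θ w) ∂(vMeasure n α) = ∫ w, f w ∂(vMeasure n α) := fun θ =>
    (measurePreserving_rot α θ).integral_comp (measurableEmbedding_rot θ) f
  have hprod : Integrable (Function.uncurry fun (θ : ℝ) (w : Ball n) => f (rot θ w))
      ((volume.restrict (Set.Ioc 0 (2 * Real.pi))).prod (vMeasure n α)) := by
    have hm : AEStronglyMeasurable (Function.uncurry fun (θ : ℝ) (w : Ball n) => f (rot θ w))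
        ((volume.restrict (Set.Ioc 0 (2 * Real.pi))).prod (vMeasure n α)) :=
      (hc.comp continuous_rot_uncurry).aestronglyMeasurable
    rw [integrable_prod_iff hm]
    refine ⟨ae_of_all _ fun θ => (measurePreserving_rot α θ).integrable_comp_of_integrable hi, ?_⟩
    have : ∀ θ : ℝ, ∫ w, ‖f (rot θ w)‖ ∂(vMeasure n α) = ∫ w, ‖f w‖ ∂(vMeasure n α) := fun θ =>
      (measurePreserving_rot α θ).integral_comp (measurableEmbedding_rot θ) fun w => ‖f w‖
    simp only [Function.uncurry_apply_pair, this]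
    exact integrable_const _
  have hswap := integral_integral_swap hprod
  simp only [hrot] at hswap
  have h1 : ∀ w : Ball n, ∫ θ in Set.Ioc 0 (2 * Real.pi), f (rot θ w) =
      (2 * Real.pi) • f (Ball.zero n) := fun w => by
    rw [← intervalIntegral.integral_of_le h2π, ← havg w, smul_smul,
      mul_inv_cancel₀ (by positivity), one_smul]
  simp only [h1] at hswap
  rw [setIntegral_const, integral_const] at hswap
  simp only [Measure.real, Real.volume_Ioc, sub_zero, ENNReal.toReal_ofReal h2π,
    measure_univ, ENNReal.toReal_one, one_smul] at hswap
  have h3 : (2 * Real.pi) ≠ 0 := by positivity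
  exact smul_right_injective F h3 hswap

lemma mul_conj_cpow (x : ℂ) (a : ℝ) :
    x ^ (a : ℂ) * (starRingEnd ℂ) (x ^ (a : ℂ)) = ((‖x‖ ^ 2) ^ a : ℝ) := by
  rw [Complex.mul_conj, Complex.normSq_eq_norm_sq, Complex.norm_cpow_real, ← Real.rpow_natCast,
    ← Real.rpow_mul (norm_nonneg _), mul_comm, Real.rpow_mul (norm_nonneg _)]
  simp

lemma autDensity_mul_cpow (α : ℝ) (z w : Ball n) :
    (autDensity α z w : ℂ) * (1 - inner ℂ (z : 𝔼) (w : 𝔼)) ^ (((n : ℝ) + 1 + α : ℝ) : ℂ) =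
      ((1 - ‖(z : 𝔼)‖ ^ 2) ^ ((n : ℝ) + 1 + α) : ℝ) * kern α (w : 𝔼) z := by
  have hD := norm_one_sub_inner_pos z w
  have h := mul_conj_cpow (1 - inner ℂ (z : 𝔼) (w : 𝔼)) ((n : ℝ) + 1 + α)
  rw [conj_one_sub_inner_cpow z.norm_lt.le w.norm_lt] at h
  have h0 : (1 - inner ℂ (w : 𝔼) (z : 𝔼)) ^ (((n : ℝ) + 1 + α : ℝ) : ℂ) ≠ 0 := fun h =>
    one_sub_inner_ne_zero w z (Complex.cpow_eq_zero_iff _ _ |>.mp h).1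
  rw [kern, ← div_eq_mul_inv, eq_div_iff h0, mul_assoc, h, autDensity, ← Complex.ofReal_mul,
    Real.div_rpow z.one_sub_norm_sq_pos.le (by positivity), div_mul_cancel₀]
  positivity

omit [CompleteSpace F] in
lemma integrable_kern_smul {α : ℝ} [hα : Fact (-1 < α)] {f : Ball n → F}
    (hi : Integrable f (vMeasure n α)) (z : Ball n) :
    Integrable (fun w : Ball n => kern α (w : 𝔼) z • f w) (vMeasure n α) :=
  hi.bdd_smul ((1 - ‖(z : 𝔼)‖) ^ ((n : ℝ) + 1 + α))⁻¹
    (continuous_kern_left α z).aestronglyMeasurable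
    (ae_of_all _ fun w => norm_kern_le hα.out w.norm_lt.le z.norm_lt)

/-- The reproducing formula `f(z) = ∫ K_w(z) f(w) dv_α(w)`. -/
lemma IsHolomorphic.reproducing {α : ℝ} [hα : Fact (-1 < α)] {f : Ball n → F}
    (hf : IsHolomorphic f) (hi : Integrable f (vMeasure n α)) (z : Ball n) :
    ∫ w : Ball n, kern α (w : 𝔼) z • f w ∂(vMeasure n α) = f z := by
  set γ : ℝ := (n : ℝ) + 1 + α with hγ
  -- The mean value property applied to `h ∘ φ_z`; the change of variables by `φ_z` turns the
  -- factor in `h` into the kernel.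
  set h : Ball n → F := fun w => (1 - inner ℂ (z : 𝔼) (w : 𝔼)) ^ (γ : ℂ) • f w with hh
  have hhol : IsHolomorphic h := (isHolomorphic_cpow z.norm_lt.le _).smul hf
  have key : ∀ w : Ball n, autDensity α z w • h w =
      (((1 - ‖(z : 𝔼)‖ ^ 2) ^ γ : ℝ) : ℂ) • (kern α (w : 𝔼) z • f w) := by
    intro w
    have := autDensity_mul_cpow α z w
    rw [smul_smul, ← this, mul_smul, Complex.coe_smul]
  have hint : Integrable (fun w => h (aut z w)) (vMeasure n α) := by
    rw [← integrable_autDensity_smul_aut_iff α z]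
    simp only [aut_aut, key]
    exact (integrable_kern_smul hi z).smul _
  have h1 := (hhol.comp_aut z).integral_eq hint
  rw [aut_zero, ← integral_autDensity_smul_aut α z] at h1
  simp only [aut_aut, key] at h1
  rw [integral_smul, hh] at h1
  have h2 : (1 - inner ℂ (z : 𝔼) (z : 𝔼)) ^ (γ : ℂ) =
      (((1 - ‖(z : 𝔼)‖ ^ 2) ^ γ : ℝ) : ℂ) := by
    rw [inner_self_eq_norm_sq_to_K, Complex.ofReal_cpow z.one_sub_norm_sq_pos.le]
    push_cast
    rfl
  simp only [h2] at h1
  have h3 : (((1 - ‖(z : 𝔼)‖ ^ 2) ^ γ : ℝ) : ℂ) ≠ 0 := by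
    exact_mod_cast (Real.rpow_pos_of_pos z.one_sub_norm_sq_pos γ).ne'
  exact smul_right_injective F h3 h1

end BergmanBall
end

noncomputable section

namespace BergmanBall

/-! ### Integral estimates and the boundedness of the Bergman projection -/

variable {n d : ℕ}

local notation "𝔼" => EuclideanSpace ℂ (Fin n)

lemma lintegral_weight_mul_vMeasure {α ε : ℝ} (hε : -1 < α - ε) :
    ∃ c : ℝ≥0∞, c ≠ ∞ ∧ ∀ g : Ball n → ℝ≥0∞, Measurable g →
      ∫⁻ w : Ball n, ENNReal.ofReal ((1 - ‖(w : 𝔼)‖ ^ 2) ^ (-ε)) * g w ∂(vMeasure n α) =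
        c * ∫⁻ w, g w ∂(vMeasure n (α - ε)) := by
  have h0 : ∀ β : ℝ, weightMeasure n β Set.univ ≠ 0 := fun β =>
    isOpen_univ.measure_ne_zero _ ⟨Ball.zero n, trivial⟩
  refine ⟨(weightMeasure n α Set.univ)⁻¹ * weightMeasure n (α - ε) Set.univ,
    ENNReal.mul_ne_top (ENNReal.inv_ne_top.mpr (h0 α)) (weightMeasure_univ_ne_top n hε),
    fun g hg => ?_⟩
  have hm : Measurable fun w : Ball n =>
      ENNReal.ofReal ((1 - ‖(w : 𝔼)‖ ^ 2) ^ (-ε)) * g w := by fun_prop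
  rw [vMeasure, vMeasure, lintegral_smul_measure, lintegral_smul_measure, smul_eq_mul, smul_eq_mul,
    lintegral_weightMeasure α hm, lintegral_weightMeasure _ hg, mul_assoc, ← mul_assoc (_ : ℝ≥0∞)
    (_)⁻¹, ENNReal.mul_inv_cancel (h0 _) (weightMeasure_univ_ne_top n hε), one_mul]
  congr 1
  refine lintegral_congr fun (w : Ball n) => ?_
  have hw := w.one_sub_norm_sq_pos
  rw [← mul_assoc, ← ENNReal.ofReal_mul (by positivity), ← Real.rpow_add hw, ← sub_eq_add_neg α ε]

lemma lintegral_autDensity {α : ℝ} [Fact (-1 < α)] (z : Ball n) :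
    ∫⁻ w, ENNReal.ofReal (autDensity α z w) ∂(vMeasure n α) = 1 := by
  have := lintegral_autDensity_mul_aut α z (g := fun _ => 1) measurable_const
  simpa using this

/-- The dilate `(1 - t) z`. -/
def dilate {n : ℕ} (t : ℝ) (ht : 0 < t) (ht1 : t ≤ 1) (z : Ball n) : Ball n :=
  ⟨((1 - t : ℝ) : ℂ) • (z : EuclideanSpace ℂ (Fin n)), by
    rw [mem_ball_zero_iff, norm_smul, Complex.norm_real, Real.norm_of_nonneg (by linarith)]
    nlinarith [z.norm_lt, norm_nonneg (z : EuclideanSpace ℂ (Fin n))]⟩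

/-- The set where `|1 - z̄ w| ≤ 2t` carries a lower bound for the density of the automorphism with
centre `(1 - t) z`. As densities have integral one, this bounds the measure of the set, whence
the integral estimates below. -/
lemma le_autDensity_dilate {α : ℝ} (hα : -1 < α) {t : ℝ} (ht : 0 < t) (ht1 : t ≤ 1)
    (z w : Ball n) (h : ‖1 - inner ℂ (z : 𝔼) (w : 𝔼)‖ ≤ 2 * t) :
    1 ≤ (9 * t) ^ ((n : ℝ) + 1 + α) * autDensity α (dilate t ht ht1 z) w := by
  have hγ := exponent_pos n hα
  set y := dilate t ht ht1 z with hy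
  have hyw := norm_one_sub_inner_pos y w
  have h1 : ‖1 - inner ℂ (y : 𝔼) (w : 𝔼)‖ ≤ 3 * t := by
    have e : 1 - inner ℂ (y : 𝔼) (w : 𝔼) =
        (1 - inner ℂ (z : 𝔼) (w : 𝔼)) + (t : ℂ) * inner ℂ (z : 𝔼) (w : 𝔼) := by
      simp only [hy, dilate, inner_smul_left, Complex.conj_ofReal]
      push_cast
      ring
    have h2 := norm_inner_le_norm (𝕜 := ℂ) (z : 𝔼) (w : 𝔼)
    have h3 : ‖(z : 𝔼)‖ * ‖(w : 𝔼)‖ ≤ 1 :=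
      mul_le_one₀ z.norm_lt.le (norm_nonneg _) w.norm_lt.le
    have h4 := norm_add_le (1 - inner ℂ (z : 𝔼) (w : 𝔼)) ((t : ℂ) * inner ℂ (z : 𝔼) (w : 𝔼))
    rw [norm_mul, Complex.norm_real, Real.norm_of_nonneg ht.le, ← e] at h4
    have h5 : t * ‖inner ℂ (z : 𝔼) (w : 𝔼)‖ ≤ t * 1 := by gcongr; linarith
    linarith
  have h6 : t ≤ 1 - ‖(y : 𝔼)‖ ^ 2 := by
    have : ‖(y : 𝔼)‖ ≤ 1 - t := by
      simp only [hy, dilate, norm_smul, Complex.norm_real]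
      rw [Real.norm_of_nonneg (by linarith)]
      exact mul_le_of_le_one_right (by linarith) z.norm_lt.le
    nlinarith [norm_nonneg (y : 𝔼)]
  rw [autDensity, ← Real.mul_rpow (by positivity)
    (div_pos y.one_sub_norm_sq_pos (by positivity)).le]
  -- With `|1 - ȳ w| ≤ 3 t` and `1 - |y|² ≥ t` the base is at least `9 t * t / (3 t)² = 1`.
  refine Real.one_le_rpow ?_ hγ.le
  rw [← mul_div_assoc, le_div_iff₀ (by positivity), one_mul]
  calc ‖1 - inner ℂ (y : 𝔼) (w : 𝔼)‖ ^ 2 ≤ (3 * t) ^ 2 := by gcongr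
    _ = 9 * t * t := by ring
    _ ≤ _ := by gcongr

@[fun_prop]
lemma measurable_ofReal_autDensity (α : ℝ) (z : Ball n) :
    Measurable fun w => ENNReal.ofReal (autDensity α z w) :=
  ENNReal.measurable_ofReal.comp (continuous_autDensity α z).measurable

lemma measurable_norm_one_sub_inner (z : Ball n) :
    Measurable fun w : Ball n => ‖1 - inner ℂ (z : 𝔼) (w : 𝔼)‖ :=
  Continuous.measurable (by fun_prop)

/-- If `0 ≤ m < n + 1 + α`, then `∫ |1 - z̄ w|^{-m} dv_α(w)` is bounded in `z`. -/
lemma lintegral_rpow_one_sub_inner_le {α m : ℝ} [hα : Fact (-1 < α)] (hm0 : 0 ≤ m)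
    (hm : m < (n : ℝ) + 1 + α) :
    ∃ C : ℝ≥0∞, C ≠ ∞ ∧ ∀ z : Ball n,
      ∫⁻ w : Ball n, ENNReal.ofReal (‖1 - inner ℂ (z : 𝔼) (w : 𝔼)‖ ^ (-m)) ∂(vMeasure n α) ≤ C := by
  set γ : ℝ := (n : ℝ) + 1 + α with hγ
  have hγ0 : 0 < γ := exponent_pos n hα.out
  have ht : ∀ k : ℕ, (0 : ℝ) < (1 / 2) ^ k := fun k => by positivity
  have ht1 : ∀ k : ℕ, ((1 : ℝ) / 2) ^ k ≤ 1 := fun k => pow_le_one₀ (by norm_num) (by norm_num)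
  -- On the shell `t ≤ |1 - z̄ w| ≤ 2 t` with `t = 2^{-k}` the integrand is at most `t^{-m}`, which is
  -- at most `t^{-m} (9 t)^γ` times a probability density. The coefficients `c k` are these
  -- numbers; they are summable because `m < γ`.
  set c : ℕ → ℝ := fun k => 9 ^ γ * (((1 : ℝ) / 2) ^ (γ - m)) ^ k with hc
  have hc0 : ∀ k, 0 ≤ c k := fun k => by positivity
  have hsum : Summable c :=
    (summable_geometric_of_lt_one (by positivity)
      (Real.rpow_lt_one (by norm_num) (by norm_num) (by linarith))).mul_left _
  refine ⟨∑' k, ENNReal.ofReal (c k), hsum.tsum_ofReal_ne_top, fun z => ?_⟩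
  have hpt : ∀ w : Ball n, ENNReal.ofReal (‖1 - inner ℂ (z : 𝔼) (w : 𝔼)‖ ^ (-m)) ≤
      ∑' k, ENNReal.ofReal (c k) *
        ENNReal.ofReal (autDensity α (dilate _ (ht k) (ht1 k) z) w) := by
    intro w
    set x := ‖1 - inner ℂ (z : 𝔼) (w : 𝔼)‖ with hx
    have hx0 : 0 < x := norm_one_sub_inner_pos z w
    have hx2 : x < 2 := norm_one_sub_inner_lt_two z.norm_lt.le w.norm_lt
    obtain ⟨k, hk1, hk2⟩ := exists_nat_pow_near_of_lt_one (x := x / 2) (y := (1 : ℝ) / 2)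
      (by positivity) (by linarith) (by norm_num) (by norm_num)
    refine le_trans ?_ (ENNReal.le_tsum k)
    rw [← ENNReal.ofReal_mul (hc0 k)]
    refine ENNReal.ofReal_le_ofReal ?_
    set t : ℝ := (1 / 2) ^ k with htk
    have htx : t ≤ x := by rw [pow_succ] at hk1; linarith
    have h1 := le_autDensity_dilate hα.out (ht k) (ht1 k) z w (by linarith)
    rw [← hγ] at h1
    have h2 : x ^ (-m) ≤ t ^ (-m) := Real.rpow_le_rpow_of_nonpos (ht k) htx (by linarith)
    have h3 : c k = t ^ (-m) * (9 * t) ^ γ := by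
      rw [Real.mul_rpow (by norm_num) (ht k).le, mul_left_comm, ← Real.rpow_add (ht k), hc]
      simp only
      rw [← Real.rpow_natCast, ← Real.rpow_natCast, ← Real.rpow_mul (by norm_num),
        ← Real.rpow_mul (by norm_num), mul_comm (k : ℝ), neg_add_eq_sub]
    rw [h3, mul_assoc]
    calc x ^ (-m) ≤ t ^ (-m) * 1 := by rw [mul_one]; exact h2
      _ ≤ _ := by gcongr
  calc _ ≤ ∫⁻ w, ∑' k, ENNReal.ofReal (c k) *
        ENNReal.ofReal (autDensity α (dilate _ (ht k) (ht1 k) z) w) ∂(vMeasure n α) :=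
        lintegral_mono hpt
    _ = ∑' k, ENNReal.ofReal (c k) := by
        rw [lintegral_tsum fun k => ((measurable_ofReal_autDensity α _).const_mul _).aemeasurable]
        congr 1
        funext k
        rw [lintegral_const_mul _ (measurable_ofReal_autDensity α _), lintegral_autDensity, mul_one]
    _ ≤ _ := le_rfl

/-- If `0 ≤ m < n + 1 + α - ε` and `ε < 1 + α`, then
`∫ (1 - |w|²)^{-ε} |1 - z̄ w|^{-m} dv_α(w)` is bounded in `z`. -/
lemma lintegral_weight_rpow_le {α ε m : ℝ} (hε : ε < 1 + α)
    (hm0 : 0 ≤ m) (hm : m < (n : ℝ) + 1 + α - ε) :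
    ∃ C : ℝ≥0∞, C ≠ ∞ ∧ ∀ z : Ball n,
      ∫⁻ w : Ball n, ENNReal.ofReal ((1 - ‖(w : 𝔼)‖ ^ 2) ^ (-ε)) *
        ENNReal.ofReal (‖1 - inner ℂ (z : 𝔼) (w : 𝔼)‖ ^ (-m)) ∂(vMeasure n α) ≤ C := by
  obtain ⟨c, hc, hcg⟩ := lintegral_weight_mul_vMeasure (n := n)
    (by linarith : -1 < α - ε)
  have : Fact (-1 < α - ε) := ⟨by linarith⟩
  obtain ⟨C, hC, hCz⟩ := lintegral_rpow_one_sub_inner_le (n := n) (α := α - ε) hm0 (by linarith)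
  refine ⟨c * C, ENNReal.mul_ne_top hc hC, fun z => ?_⟩
  rw [hcg (fun w => ENNReal.ofReal (‖1 - inner ℂ (z : 𝔼) (w : 𝔼)‖ ^ (-m)))
    (ENNReal.measurable_ofReal.comp ((measurable_norm_one_sub_inner z).pow_const _))]
  gcongr
  exact hCz z

/-- The integral estimate that makes the powers of `1 - |w|²` suitable weights for the Schur test
of the Bergman kernel. -/
lemma lintegral_kern_weight_le {α ε : ℝ} (hε0 : 0 < ε) (hε : 2 * ε ≤ 1 + α) :
    ∃ C : ℝ≥0∞, C ≠ ∞ ∧ ∀ z : Ball n,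
      ∫⁻ w : Ball n, ‖kern α (w : 𝔼) z‖ₑ * ENNReal.ofReal ((1 - ‖(w : 𝔼)‖ ^ 2) ^ (-ε))
        ∂(vMeasure n α) ≤ C * ENNReal.ofReal ((1 - ‖(z : 𝔼)‖ ^ 2) ^ (-ε)) := by
  have hn : (0 : ℝ) ≤ n := Nat.cast_nonneg n
  obtain ⟨C, hC, hCz⟩ := lintegral_weight_rpow_le (n := n) (α := α) (ε := ε)
    (m := (n : ℝ) + 1 + α - 2 * ε) (by linarith) (by linarith) (by linarith)
  refine ⟨C, hC, fun z => ?_⟩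
  have hm : Measurable fun w : Ball n => ‖kern α (w : 𝔼) z‖ₑ *
      ENNReal.ofReal ((1 - ‖(w : 𝔼)‖ ^ 2) ^ (-ε)) :=
    (continuous_kern_left α z).measurable.enorm.mul (by fun_prop)
  -- Substituting `φ_z(w)` for `w` leaves an integral of the previous type, with exponent
  -- `m = n + 1 + α - 2 ε`.
  rw [← lintegral_autDensity_mul_aut α z hm]
  have hpt : ∀ w : Ball n, ENNReal.ofReal (autDensity α z w) *
      (‖kern α (aut z w : 𝔼) z‖ₑ * ENNReal.ofReal ((1 - ‖(aut z w : 𝔼)‖ ^ 2) ^ (-ε))) =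
      ENNReal.ofReal ((1 - ‖(z : 𝔼)‖ ^ 2) ^ (-ε)) *
        (ENNReal.ofReal ((1 - ‖(w : 𝔼)‖ ^ 2) ^ (-ε)) *
          ENNReal.ofReal (‖1 - inner ℂ (z : 𝔼) (w : 𝔼)‖ ^ (-((n : ℝ) + 1 + α - 2 * ε)))) := by
    intro w
    have hz := z.one_sub_norm_sq_pos
    have hw := w.one_sub_norm_sq_pos
    have hD := norm_one_sub_inner_pos z w
    rw [← ofReal_norm, norm_kern, norm_one_sub_inner_comm, coe_aut,
      inner_autFun_left z.norm_lt w.norm_lt, one_sub_norm_autFun_sq, ← Complex.ofReal_pow,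
      defect_sq z.norm_lt, norm_div, Complex.norm_real, Real.norm_of_nonneg hz.le, autDensity,
      ← ENNReal.ofReal_mul (by positivity), ← ENNReal.ofReal_mul (by positivity),
      ← ENNReal.ofReal_mul (by positivity), ← ENNReal.ofReal_mul (by positivity)]
    congr 1
    set x := ‖1 - inner ℂ (z : 𝔼) (w : 𝔼)‖
    set a := 1 - ‖(z : 𝔼)‖ ^ 2
    set b := 1 - ‖(w : 𝔼)‖ ^ 2
    set γ := (n : ℝ) + 1 + α
    rw [Real.div_rpow hz.le (by positivity), Real.div_rpow hz.le hD.le,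
      Real.div_rpow (by positivity) (by positivity), Real.mul_rpow hz.le hw.le, ← Real.rpow_natCast,
      ← Real.rpow_mul hD.le, ← Real.rpow_mul hD.le, neg_sub, Real.rpow_sub hD,
      show ((2 : ℕ) : ℝ) * γ = γ + γ by push_cast; ring, Real.rpow_add hD,
      show ((2 : ℕ) : ℝ) * -ε = -(2 * ε) by push_cast; ring, Real.rpow_neg hD.le (2 * ε)]
    have h1 : a ^ γ ≠ 0 := (Real.rpow_pos_of_pos hz _).ne'
    have h2 : x ^ γ ≠ 0 := (Real.rpow_pos_of_pos hD _).ne'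
    field_simp
  rw [lintegral_congr hpt, lintegral_const_mul _ (by fun_prop), mul_comm]
  gcongr
  exact hCz z

/-- The Schur test. -/
lemma schur_test {X : Type*} [MeasurableSpace X] {μ : Measure X} [SFinite μ] {p q : ℝ}
    (hpq : p.HolderConjugate q) {k : X → X → ℝ≥0∞} (hk : Measurable (Function.uncurry k))
    {h : X → ℝ≥0∞} (hh : Measurable h) (h0 : ∀ x, h x ≠ 0) (htop : ∀ x, h x ≠ ∞) {A B : ℝ≥0∞}
    (hA : ∀ x, ∫⁻ y, k x y * h y ^ q ∂μ ≤ A * h x ^ q)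
    (hB : ∀ y, ∫⁻ x, k x y * h x ^ p ∂μ ≤ B * h y ^ p)
    {f : X → ℝ≥0∞} (hf : Measurable f) :
    ∫⁻ x, (∫⁻ y, k x y * f y ∂μ) ^ p ∂μ ≤ A ^ (p / q) * B * ∫⁻ x, f x ^ p ∂μ := by
  have hp := hpq.pos
  have hq := hpq.symm.pos
  have hkx : ∀ x, Measurable (k x) := fun x => hk.comp measurable_prodMk_left
  have step : ∀ x, (∫⁻ y, k x y * f y ∂μ) ^ p ≤
      A ^ (p / q) * (h x ^ p * ∫⁻ y, k x y * (f y / h y) ^ p ∂μ) := by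
    intro x
    -- Hölder's inequality for the splitting `k f = (k^{1/q} h) (k^{1/p} f / h)`.
    have e : ∀ y, k x y * f y = ((k x y) ^ (1 / q) * h y) * ((k x y) ^ (1 / p) * (f y / h y)) := by
      intro y
      have e1 : (k x y) ^ (1 / q) * (k x y) ^ (1 / p) = k x y := by
        rw [← ENNReal.rpow_add_of_nonneg _ _ (by positivity) (by positivity)]
        have : 1 / q + 1 / p = 1 := by
          rw [add_comm, one_div, one_div]; exact hpq.inv_add_inv_eq_one
        rw [this, ENNReal.rpow_one]
      have e2 : h y * (f y / h y) = f y := ENNReal.mul_div_cancel (h0 y) (htop y)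
      calc k x y * f y = ((k x y) ^ (1 / q) * (k x y) ^ (1 / p)) * (h y * (f y / h y)) := by
            rw [e1, e2]
        _ = _ := by ring
    have hold := ENNReal.lintegral_mul_le_Lp_mul_Lq μ hpq.symm
      (f := fun y => (k x y) ^ (1 / q) * h y) (g := fun y => (k x y) ^ (1 / p) * (f y / h y))
      (((hkx x).pow_const _).mul hh).aemeasurable
      (((hkx x).pow_const _).mul (hf.div hh)).aemeasurable
    have e3 : ∀ y, ((k x y) ^ (1 / q) * h y) ^ q = k x y * h y ^ q := fun y => by
      rw [ENNReal.mul_rpow_of_nonneg _ _ hq.le, ← ENNReal.rpow_mul, one_div_mul_cancel hq.ne',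
        ENNReal.rpow_one]
    have e4 : ∀ y, ((k x y) ^ (1 / p) * (f y / h y)) ^ p = k x y * (f y / h y) ^ p := fun y => by
      rw [ENNReal.mul_rpow_of_nonneg _ _ hp.le, ← ENNReal.rpow_mul, one_div_mul_cancel hp.ne',
        ENNReal.rpow_one]
    simp only [Pi.mul_apply, e3, e4, ← e] at hold
    calc (∫⁻ y, k x y * f y ∂μ) ^ p
        ≤ ((A * h x ^ q) ^ (1 / q) * (∫⁻ y, k x y * (f y / h y) ^ p ∂μ) ^ (1 / p)) ^ p := by
          refine ENNReal.rpow_le_rpow (hold.trans ?_) hp.le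
          gcongr
          exact hA x
      _ = _ := by
          rw [ENNReal.mul_rpow_of_nonneg _ _ hp.le, ENNReal.mul_rpow_of_nonneg _ _ (by positivity),
            ENNReal.mul_rpow_of_nonneg _ _ hp.le, ← ENNReal.rpow_mul, ← ENNReal.rpow_mul,
            ← ENNReal.rpow_mul, ← ENNReal.rpow_mul, one_div_mul_cancel hp.ne', ENNReal.rpow_one,
            one_div_mul_eq_div, mul_div_cancel₀ p hq.ne', mul_assoc]
  have hm2 : Measurable (Function.uncurry fun x y => h x ^ p * (k x y * (f y / h y) ^ p)) :=
    ((hh.comp measurable_fst).pow_const _).mul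
      (hk.mul (((hf.div hh).comp measurable_snd).pow_const _))
  calc ∫⁻ x, (∫⁻ y, k x y * f y ∂μ) ^ p ∂μ
      ≤ ∫⁻ x, A ^ (p / q) * (h x ^ p * ∫⁻ y, k x y * (f y / h y) ^ p ∂μ) ∂μ := lintegral_mono step
    _ = A ^ (p / q) * ∫⁻ x, ∫⁻ y, h x ^ p * (k x y * (f y / h y) ^ p) ∂μ ∂μ := by
        have : ∀ x, h x ^ p * ∫⁻ y, k x y * (f y / h y) ^ p ∂μ =
            ∫⁻ y, h x ^ p * (k x y * (f y / h y) ^ p) ∂μ := fun x =>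
          (lintegral_const_mul _ ((hkx x).mul ((hf.div hh).pow_const _))).symm
        simp only [this]
        exact lintegral_const_mul _ hm2.lintegral_prod_right
    _ = A ^ (p / q) * ∫⁻ y, ∫⁻ x, h x ^ p * (k x y * (f y / h y) ^ p) ∂μ ∂μ := by
        rw [lintegral_lintegral_swap hm2.aemeasurable]
    _ ≤ A ^ (p / q) * ∫⁻ y, B * f y ^ p ∂μ := by
        gcongr with y
        have hky : Measurable fun x => k x y := hk.comp measurable_prodMk_right
        calc ∫⁻ x, h x ^ p * (k x y * (f y / h y) ^ p) ∂μ
            = (f y / h y) ^ p * ∫⁻ x, k x y * h x ^ p ∂μ := by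
              rw [← lintegral_const_mul ((f y / h y) ^ p) (f := fun x => k x y * h x ^ p)
                (hky.mul (hh.pow_const _))]
              exact lintegral_congr fun x => by ring
          _ ≤ (f y / h y) ^ p * (B * h y ^ p) := by gcongr; exact hB y
          _ = B * (f y / h y * h y) ^ p := by
              rw [ENNReal.mul_rpow_of_nonneg _ _ hp.le]; ring
          _ = _ := by rw [ENNReal.div_mul_cancel (h0 y) (htop y)]
    _ = _ := by rw [lintegral_const_mul _ (hf.pow_const _), mul_assoc]

end BergmanBall
end

noncomputable section

namespace BergmanBall

/-! ### The Bergman projection -/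

variable {n d : ℕ}

local notation "𝔼" => EuclideanSpace ℂ (Fin n)

/-- The integral operator with the Bergman kernel, `(P F)(z) = ∫ K_w(z) F(w) dv_α(w)`. -/
def kernInt {n : ℕ} {F : Type*} [NormedAddCommGroup F] [NormedSpace ℂ F] (α : ℝ)
    (f : Ball n → F) (z : EuclideanSpace ℂ (Fin n)) : F :=
  ∫ w : Ball n, kern α (w : EuclideanSpace ℂ (Fin n)) z • f w ∂(vMeasure n α)

section

variable {F : Type*} [NormedAddCommGroup F] [NormedSpace ℂ F] {α : ℝ} [hα : Fact (-1 < α)]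

omit hα in
lemma hasFDerivAt_kern {w z : 𝔼} (hw : ‖w‖ ≤ 1) (hz : ‖z‖ < 1) :
    HasFDerivAt (kern α w)
      (((((n : ℝ) + 1 + α : ℝ) : ℂ) *
        (1 - inner ℂ w z) ^ (-(((n : ℝ) + 1 + α + 1 : ℝ) : ℂ))) • innerSL ℂ w) z := by
  have h : HasFDerivAt (fun z : 𝔼 => 1 - inner ℂ w z) (-(innerSL ℂ w)) z := by
    simpa using ((innerSL ℂ w).hasFDerivAt (x := z)).const_sub (1 : ℂ)
  have h2 := ((hasDerivAt_id (1 - inner ℂ w z)).cpow_const (c := -(((n : ℝ) + 1 + α : ℝ) : ℂ))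
    (one_sub_inner_mem_slitPlane hw hz)).comp_hasFDerivAt z h
  have e : kern α w = fun z => (1 - inner ℂ w z) ^ (-(((n : ℝ) + 1 + α : ℝ) : ℂ)) := by
    funext z
    rw [kern, Complex.cpow_neg]
  rw [e]
  refine h2.congr_fderiv ?_
  ext1 v
  simp only [smul_apply, neg_apply, innerSL_apply_apply, smul_eq_mul, id]
  rw [show -(((n : ℝ) + 1 + α : ℝ) : ℂ) - 1 = -(((n : ℝ) + 1 + α + 1 : ℝ) : ℂ) by
    push_cast; ring]
  ring

lemma isHolomorphic_kernInt {f : Ball n → F} (hf : Integrable f (vMeasure n α)) :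
    IsHolomorphic fun z : Ball n => kernInt α f z := by
  refine ⟨kernInt α f, fun z₀ hz₀ => ?_, fun _ => rfl⟩
  refine DifferentiableAt.differentiableWithinAt ?_
  have hz₀' : ‖z₀‖ < 1 := mem_ball_zero_iff.mp hz₀
  set γ : ℝ := (n : ℝ) + 1 + α with hγ
  have hγ0 : 0 < γ := exponent_pos n hα.out
  -- On the ball of radius `r` about `z₀` the derivative of the kernel is bounded uniformly in
  -- `w`, so differentiation under the integral sign is permitted.
  set r : ℝ := (1 - ‖z₀‖) / 2 with hr
  have hr0 : 0 < r := by rw [hr]; linarith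
  have hs : ∀ z ∈ Metric.ball z₀ r, ‖z‖ ≤ 1 - r := by
    intro z hz
    have h1 : ‖z‖ ≤ ‖z - z₀‖ + ‖z₀‖ := by
      simpa using norm_add_le (z - z₀) z₀
    have h2 := mem_ball_iff_norm.mp hz
    have h3 : ‖z₀‖ = 1 - 2 * r := by rw [hr]; ring
    linarith
  refine (hasFDerivAt_integral_of_dominated_of_fderiv_le (𝕜 := ℂ) (μ := vMeasure n α)
    (F := fun z (w : Ball n) => kern α (w : 𝔼) z • f w)
    (F' := fun z (w : Ball n) => (((γ : ℂ) * (1 - inner ℂ (w : 𝔼) z) ^ (-((γ + 1 : ℝ) : ℂ))) •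
      innerSL ℂ (w : 𝔼)).smulRight (f w))
    (bound := fun w => γ * r ^ (-(γ + 1)) * ‖f w‖) (Metric.ball_mem_nhds z₀ hr0) ?_ ?_ ?_ ?_ ?_
    ?_).differentiableAt
  · filter_upwards [Metric.isOpen_ball.mem_nhds hz₀] with z hz
    exact ((continuous_kern_left α ⟨z, hz⟩).aestronglyMeasurable).smul hf.aestronglyMeasurable
  · exact integrable_kern_smul hf ⟨z₀, hz₀⟩
  · have h1 : Continuous fun w : Ball n => ((γ : ℂ) *
        (1 - inner ℂ (w : 𝔼) z₀) ^ (-((γ + 1 : ℝ) : ℂ))) • innerSL ℂ (w : 𝔼) := by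
      refine Continuous.smul (continuous_const.mul (Continuous.cpow (by fun_prop) continuous_const
        fun w => one_sub_inner_mem_slitPlane w.norm_lt.le hz₀')) ?_
      exact (innerSL ℂ).continuous.comp continuous_subtype_val
    exact (ContinuousLinearMap.smulRightL ℂ 𝔼 F).aestronglyMeasurable_comp₂
      h1.aestronglyMeasurable hf.aestronglyMeasurable
  · refine ae_of_all _ fun w z hz => ?_
    have hz1 := hs z hz
    rw [ContinuousLinearMap.norm_smulRight_apply, norm_smul, norm_mul, Complex.norm_real,
      Real.norm_of_nonneg hγ0.le, innerSL_apply_norm,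
      ← Complex.ofReal_neg, Complex.norm_cpow_real]
    have h2 : r ≤ ‖1 - inner ℂ (w : 𝔼) z‖ :=
      le_trans (by linarith) (one_sub_norm_le_norm_one_sub_inner w.norm_lt.le)
    have h3 : ‖1 - inner ℂ (w : 𝔼) z‖ ^ (-(γ + 1)) ≤ r ^ (-(γ + 1)) :=
      Real.rpow_le_rpow_of_nonpos hr0 h2 (by linarith)
    calc _ ≤ γ * r ^ (-(γ + 1)) * 1 * ‖f w‖ := by
          gcongr
          exact w.norm_lt.le
      _ = _ := by rw [mul_one]
  · exact hf.norm.const_mul _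
  · refine ae_of_all _ fun w z hz => ?_
    have hz1 : ‖z‖ < 1 := by linarith [hs z hz]
    have h := (hasFDerivAt_kern (α := α) (w := (w : 𝔼)) w.norm_lt.le hz1).smul_const (f w)
    exact h

omit hα in
lemma continuous_kern_uncurry : Continuous fun x : Ball n × Ball n =>
    kern α (x.2 : 𝔼) (x.1 : 𝔼) := by
  unfold kern
  refine Continuous.inv₀ (Continuous.cpow (by fun_prop) continuous_const fun x =>
    one_sub_inner_mem_slitPlane x.2.norm_lt.le x.1.norm_lt) fun x => ?_
  exact fun h => one_sub_inner_ne_zero x.2 x.1 (Complex.cpow_eq_zero_iff _ _ |>.mp h).1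

omit hα in
lemma norm_kern_comm (w z : 𝔼) : ‖kern α w z‖ = ‖kern α z w‖ := by
  rw [norm_kern, norm_kern, norm_one_sub_inner_comm]

variable (n α) in
/-- The integral operator with kernel `|K_w(z)|` is bounded on `L^p`, `1 < p < ∞`. -/
lemma lintegral_kern_rpow_le {p : ℝ} (hp : 1 < p) :
    ∃ C : ℝ≥0∞, C ≠ ∞ ∧ ∀ f : Ball n → ℝ≥0∞, AEMeasurable f (vMeasure n α) →
      ∫⁻ z : Ball n, (∫⁻ w : Ball n, ‖kern α (w : 𝔼) z‖ₑ * f w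
        ∂(vMeasure n α)) ^ p ∂(vMeasure n α) ≤ C * ∫⁻ w, f w ^ p ∂(vMeasure n α) := by
  set q := p.conjExponent with hq
  have hpq : p.HolderConjugate q := Real.HolderConjugate.conjExponent hp
  have hp0 := hpq.pos
  have hq0 := hpq.symm.pos
  have hα' := hα.out
  -- The weight is `(1 - |w|²)^{-δ}`, with `δ` small enough that both `ε = δ p` and `ε = δ q`
  -- satisfy `2 ε ≤ 1 + α`.
  set δ : ℝ := (1 + α) / (2 * (p + q)) with hδ
  have hδ0 : 0 < δ := div_pos (by linarith) (by linarith)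
  have hδ1 : 2 * (δ * p + δ * q) = 1 + α := by
    rw [hδ]; field_simp
  have hδp : 0 < δ * p := by positivity
  have hδq : 0 < δ * q := by positivity
  obtain ⟨A, hA, hAz⟩ := lintegral_kern_weight_le (n := n) (α := α) hδq (by linarith)
  obtain ⟨B, hB, hBz⟩ := lintegral_kern_weight_le (n := n) (α := α) hδp (by linarith)
  set h : Ball n → ℝ≥0∞ := fun w =>
    ENNReal.ofReal ((1 - ‖(w : 𝔼)‖ ^ 2) ^ (-δ)) with hh
  have hpow : ∀ (w : Ball n) (s : ℝ), 0 < s → h w ^ s =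
      ENNReal.ofReal ((1 - ‖(w : 𝔼)‖ ^ 2) ^ (-(δ * s))) := by
    intro w s hs
    have hw := w.one_sub_norm_sq_pos
    rw [hh]
    simp only
    rw [ENNReal.ofReal_rpow_of_nonneg (by positivity) hs.le, ← Real.rpow_mul hw.le, neg_mul]
  refine ⟨A ^ (p / q) * B, ENNReal.mul_ne_top (ENNReal.rpow_ne_top_of_nonneg (by positivity) hA) hB,
    fun f hf => ?_⟩
  have hae : f =ᵐ[vMeasure n α] hf.mk f := hf.ae_eq_mk
  have e1 : ∀ z : Ball n, ∫⁻ w : Ball n, ‖kern α (w : 𝔼) z‖ₑ * f w ∂(vMeasure n α) =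
      ∫⁻ w : Ball n, ‖kern α (w : 𝔼) z‖ₑ * hf.mk f w ∂(vMeasure n α) := fun z =>
    lintegral_congr_ae (hae.mono fun w hw => by simp only [hw])
  have e2 : ∫⁻ w, f w ^ p ∂(vMeasure n α) = ∫⁻ w, hf.mk f w ^ p ∂(vMeasure n α) :=
    lintegral_congr_ae (hae.mono fun w hw => by simp only [hw])
  simp only [e1, e2]
  refine schur_test (μ := vMeasure n α) hpq
    (k := fun z w : Ball n => ‖kern α (w : 𝔼) z‖ₑ) (h := h) ?_ (by fun_prop) ?_ ?_ ?_ ?_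
    hf.measurable_mk
  · exact (continuous_kern_uncurry (n := n) (α := α)).measurable.enorm
  · exact fun w => by
      have hw := w.one_sub_norm_sq_pos
      simp only [hh, ne_eq, ENNReal.ofReal_eq_zero, not_le]
      positivity
  · exact fun w => ENNReal.ofReal_ne_top
  · intro z
    simp only [hpow _ _ hq0]
    exact hAz z
  · intro w
    simp only [hpow _ _ hp0]
    refine le_trans (le_of_eq (lintegral_congr fun z => ?_)) (hBz w)
    rw [← ofReal_norm, norm_kern_comm, ofReal_norm]

omit hα in
lemma enorm_kernInt_le (f : Ball n → F) (z : 𝔼) :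
    ‖kernInt α f z‖ₑ ≤ ∫⁻ w : Ball n, ‖kern α (w : 𝔼) z‖ₑ * ‖f w‖ₑ ∂(vMeasure n α) := by
  refine (enorm_integral_le_lintegral_enorm _).trans (le_of_eq (lintegral_congr fun w => ?_))
  rw [enorm_smul]

/-- The Bergman projection is bounded on `L^p`, `1 < p < ∞`. -/
lemma eLpNorm_kernInt_le (n : ℕ) (F : Type*) [NormedAddCommGroup F] [NormedSpace ℂ F] (α : ℝ)
    [hα : Fact (-1 < α)] {p : ℝ≥0∞} (hp : 1 < p) (hp' : p < ∞) :
    ∃ C : ℝ≥0∞, C ≠ ∞ ∧ ∀ f : Ball n → F, AEStronglyMeasurable f (vMeasure n α) →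
      eLpNorm (fun z : Ball n => kernInt α f z) p (vMeasure n α) ≤
        C * eLpNorm f p (vMeasure n α) := by
  have hp0 : p ≠ 0 := (zero_lt_one.trans hp).ne'
  have hp1 : 1 < p.toReal := by
    rw [← ENNReal.toReal_one]
    exact (ENNReal.toReal_lt_toReal ENNReal.one_ne_top hp'.ne).mpr hp
  have hpos : 0 < p.toReal := by linarith
  obtain ⟨C, hC, h⟩ := lintegral_kern_rpow_le n α hp1
  refine ⟨C ^ (1 / p.toReal), ENNReal.rpow_ne_top_of_nonneg (by positivity) hC, fun f hf => ?_⟩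
  rw [eLpNorm_eq_lintegral_rpow_enorm_toReal hp0 hp'.ne,
    eLpNorm_eq_lintegral_rpow_enorm_toReal hp0 hp'.ne,
    ← ENNReal.mul_rpow_of_nonneg _ _ (by positivity)]
  refine ENNReal.rpow_le_rpow ?_ (by positivity)
  refine le_trans (lintegral_mono fun z => ?_) (h _ hf.enorm)
  exact ENNReal.rpow_le_rpow (enorm_kernInt_le f z) hpos.le

end

variable {p : ℝ≥0∞} [Fact (1 ≤ p)] [hp : Fact (1 < p)] [hpt : Fact (p < ∞)]
  {α : ℝ} [hα : Fact (-1 < α)]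

omit hp hpt in
lemma MemLp.integrable_vMeasure {F : Type*} [NormedAddCommGroup F] {f : Ball n → F}
    (hf : MemLp f p (vMeasure n α)) : Integrable f (vMeasure n α) :=
  hf.integrable Fact.out

lemma memLp_kernInt {F : Type*} [NormedAddCommGroup F] [NormedSpace ℂ F] {f : Ball n → F}
    (hf : MemLp f p (vMeasure n α)) :
    MemLp (fun z : Ball n => kernInt α f z) p (vMeasure n α) := by
  obtain ⟨C, hC, h⟩ := eLpNorm_kernInt_le n F α hp.out hpt.out
  refine ⟨(isHolomorphic_kernInt
    (MemLp.integrable_vMeasure hf)).continuous.aestronglyMeasurable, ?_⟩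
  exact (h f hf.1).trans_lt (ENNReal.mul_lt_top hC.lt_top hf.2)

omit hp hpt in
lemma Bergman.norm_toLp (f : Bergman n d p α) : ‖Bergman.toLp f‖ = ‖f‖ := rfl

omit hp hpt hα in
@[ext] lemma Bergman.ext {f g : Bergman n d p α} (h : ∀ z, f z = g z) : f = g :=
  DFunLike.ext _ _ h

omit hp hpt hα in
@[simp] lemma Bergman.add_apply (f g : Bergman n d p α) (z : Ball n) : (f + g) z = f z + g z := rfl

omit hp hpt hα in
@[simp] lemma Bergman.smul_apply (c : ℂ) (f : Bergman n d p α) (z : Ball n) :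
    (c • f) z = c • f z := rfl

omit hp hpt hα in
@[simp] lemma Bergman.sub_apply (f g : Bergman n d p α) (z : Ball n) : (f - g) z = f z - g z := rfl

omit hp hpt hα in
lemma Bergman.coeFn_toLp (f : Bergman n d p α) : Bergman.toLp f =ᵐ[vMeasure n α] f :=
  f.memLp.coeFn_toLp

variable (n d p α) in
/-- The Bergman projection `P : L^p_α → A^p_α`. -/
def bergmanProj : Lp (Vec d p) p (vMeasure n α) →L[ℂ] Bergman n d p α :=
  LinearMap.mkContinuousOfExistsBound
    { toFun := fun f => ⟨fun z => kernInt α f z,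
        isHolomorphic_kernInt (MemLp.integrable_vMeasure (Lp.memLp f)), memLp_kernInt (Lp.memLp f)⟩
      map_add' := fun f g => by
        ext1 z
        change kernInt α (f + g : Lp (Vec d p) p (vMeasure n α)) z = kernInt α f z + kernInt α g z
        rw [kernInt, kernInt, kernInt, ← integral_add
          (integrable_kern_smul (MemLp.integrable_vMeasure (Lp.memLp f)) z)
          (integrable_kern_smul (MemLp.integrable_vMeasure (Lp.memLp g)) z)]
        refine integral_congr_ae ((Lp.coeFn_add f g).mono fun w hw => ?_)
        simp only [hw, Pi.add_apply, smul_add]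
      map_smul' := fun c f => by
        ext1 z
        change kernInt α (c • f : Lp (Vec d p) p (vMeasure n α)) z = c • kernInt α f z
        rw [kernInt, kernInt, ← integral_smul]
        refine integral_congr_ae ((Lp.coeFn_smul c f).mono fun w hw => ?_)
        simp only [hw]
        rw [Pi.smul_apply, smul_comm] }
    (by
      obtain ⟨C, hC, h⟩ := eLpNorm_kernInt_le n (Vec d p) α hp.out hpt.out
      refine ⟨C.toReal, fun f => ?_⟩
      rw [Bergman.norm_def, Lp.norm_def, ← ENNReal.toReal_mul]
      exact ENNReal.toReal_mono (ENNReal.mul_ne_top hC (Lp.memLp f).2.ne) (h f (Lp.memLp f).1))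

lemma bergmanProj_toLp {f : Ball n → Vec d p} (hf : MemLp f p (vMeasure n α)) (z : Ball n) :
    bergmanProj n d p α (hf.toLp f) z = kernInt α f z := by
  change kernInt α (hf.toLp f) z = kernInt α f z
  exact integral_congr_ae (hf.coeFn_toLp.mono fun w hw => by simp only [hw])

omit hp hpt in
lemma Bergman.kernInt_eq (f : Bergman n d p α) (z : Ball n) : kernInt α f z = f z :=
  f.isHolomorphic.reproducing (MemLp.integrable_vMeasure f.memLp) z

lemma bergmanProj_bergmanToLp (f : Bergman n d p α) :
    bergmanProj n d p α (Bergman.toLp f) = f := by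
  ext1 z
  change bergmanProj n d p α (f.memLp.toLp f) z = f z
  rw [bergmanProj_toLp, f.kernInt_eq]

instance : CompleteSpace (Bergman n d p α) := by
  refine Metric.complete_of_cauchySeq_tendsto fun u hu => ?_
  have hiso : Isometry (Bergman.toLp : Bergman n d p α →ₗ[ℂ] _) :=
    AddMonoidHomClass.isometry_of_norm _ fun f => Bergman.norm_toLp f
  obtain ⟨g, hg⟩ := cauchySeq_tendsto_of_complete (hiso.uniformContinuous.comp_cauchySeq hu)
  refine ⟨bergmanProj n d p α g, ?_⟩
  have := ((bergmanProj n d p α).continuous.tendsto g).comp hg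
  simpa only [Function.comp_def, bergmanProj_bergmanToLp] using this

end BergmanBall
end

noncomputable section

namespace BergmanBall

/-! ### The duality pairing -/

set_option linter.unusedSectionVars false

variable {n d : ℕ}

local notation "𝔼" => EuclideanSpace ℂ (Fin n)

/-- The pairing `∑ᵢ uᵢ v̄ᵢ` of `ℂᵈ` with the `p`-norm and `ℂᵈ` with the `q`-norm. -/
def dot {d : ℕ} {p q : ℝ≥0∞} (u : Vec d p) (v : Vec d q) : ℂ := ∑ i, u i * (starRingEnd ℂ) (v i)

section Dot

variable {p q : ℝ≥0∞}

lemma conj_dot (u : Vec d p) (v : Vec d q) : (starRingEnd ℂ) (dot u v) = dot v u := by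
  simp only [dot, map_sum, map_mul, Complex.conj_conj, mul_comm]

lemma dot_smul_left (c : ℂ) (u : Vec d p) (v : Vec d q) : dot (c • u) v = c * dot u v := by
  simp only [dot, PiLp.smul_apply, smul_eq_mul, Finset.mul_sum, mul_assoc]

lemma dot_smul_right (c : ℂ) (u : Vec d p) (v : Vec d q) :
    dot u (c • v) = (starRingEnd ℂ) c * dot u v := by
  rw [← conj_dot, dot_smul_left, map_mul, conj_dot]

lemma dot_sub_right (u : Vec d p) (v v' : Vec d q) : dot u (v - v') = dot u v - dot u v' := by
  simp only [dot, PiLp.sub_apply, mul_sub, map_sub, Finset.sum_sub_distrib]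

lemma dot_single (u : Vec d p) (i : Fin d) : dot u (PiLp.single q i (1 : ℂ) : Vec d q) = u i := by
  rw [dot, Finset.sum_eq_single i]
  · simp
  · intro j _ hj
    rw [PiLp.single_eq_of_ne _ hj, map_zero, mul_zero]
  · simp

lemma norm_dot_le [Fact (1 ≤ p)] [Fact (1 ≤ q)] (u : Vec d p) (v : Vec d q) :
    ‖dot u v‖ ≤ d * (‖u‖ * ‖v‖) := by
  refine (norm_sum_le _ _).trans ?_
  calc ∑ i, ‖u i * (starRingEnd ℂ) (v i)‖ ≤ ∑ _i : Fin d, ‖u‖ * ‖v‖ := by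
        refine Finset.sum_le_sum fun i _ => ?_
        rw [norm_mul, Complex.norm_conj]
        gcongr
        · exact PiLp.norm_apply_le u i
        · exact PiLp.norm_apply_le v i
    _ = _ := by simp

lemma continuous_dot : Continuous fun x : Vec d p × Vec d q => dot x.1 x.2 := by
  unfold dot
  refine continuous_finsetSum _ fun i _ => Continuous.mul ?_ (Complex.continuous_conj.comp ?_)
  · exact (PiLp.continuous_apply p _ i).comp continuous_fst
  · exact (PiLp.continuous_apply q _ i).comp continuous_snd

/-- The functional `u ↦ dot u v`. -/
def dotLeft [Fact (1 ≤ p)] (v : Vec d q) : Vec d p →L[ℂ] ℂ :=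
  ∑ i, (starRingEnd ℂ) (v i) • (PiLp.proj p (fun _ : Fin d => ℂ) i : Vec d p →L[ℂ] ℂ)

lemma dotLeft_apply [Fact (1 ≤ p)] (u : Vec d p) (v : Vec d q) : dotLeft v u = dot u v := by
  simp [dotLeft, dot, mul_comm]

lemma dot_integral_left {X : Type*} [MeasurableSpace X] {μ : Measure X} [Fact (1 ≤ p)]
    {f : X → Vec d p} (hf : Integrable f μ) (v : Vec d q) :
    dot (∫ x, f x ∂μ) v = ∫ x, dot (f x) v ∂μ := by
  simp only [← dotLeft_apply]
  exact ((dotLeft v).integral_comp_comm hf).symm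

lemma dot_integral_right {X : Type*} [MeasurableSpace X] {μ : Measure X} [Fact (1 ≤ q)]
    (u : Vec d p) {g : X → Vec d q} (hg : Integrable g μ) :
    dot u (∫ x, g x ∂μ) = ∫ x, dot u (g x) ∂μ := by
  rw [← conj_dot, dot_integral_left hg, ← integral_conj]
  simp only [conj_dot]

end Dot

variable {p q : ℝ≥0∞} [Fact (1 ≤ p)] [Fact (1 ≤ q)] [hp : Fact (1 < p)] [hpt : Fact (p < ∞)]
  [hq : Fact (1 < q)] [hqt : Fact (q < ∞)] [hpq : p.HolderConjugate q]
  {α : ℝ} [hα : Fact (-1 < α)]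

omit [Fact (1 ≤ p)] [Fact (1 ≤ q)] hp hpt hq hqt hpq in
lemma aestronglyMeasurable_dot {X : Type*} [MeasurableSpace X] {μ : Measure X} {f : X → Vec d p}
    {g : X → Vec d q} (hf : AEStronglyMeasurable f μ) (hg : AEStronglyMeasurable g μ) :
    AEStronglyMeasurable (fun x => dot (f x) (g x)) μ :=
  Continuous.comp_aestronglyMeasurable (g := fun x : Vec d p × Vec d q => dot x.1 x.2)
    (f := fun x => (f x, g x)) continuous_dot (hf.prodMk hg)

lemma integrable_norm_mul_norm {X E F : Type*} [MeasurableSpace X] {μ : Measure X}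
    [NormedAddCommGroup E] [NormedAddCommGroup F] {f : X → E} {g : X → F}
    (hf : MemLp f p μ) (hg : MemLp g q μ) : Integrable (fun x => ‖f x‖ * ‖g x‖) μ :=
  MemLp.integrable_mul (p := p) (q := q) (f := fun x => ‖f x‖) (g := fun x => ‖g x‖)
    hf.norm hg.norm

lemma integrable_dot {X : Type*} [MeasurableSpace X] {μ : Measure X} {f : X → Vec d p}
    {g : X → Vec d q} (hf : MemLp f p μ) (hg : MemLp g q μ) :
    Integrable (fun x => dot (f x) (g x)) μ :=
  ((integrable_norm_mul_norm hf hg).const_mul (d : ℝ)).mono'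
    (aestronglyMeasurable_dot hf.1 hg.1) (ae_of_all _ fun _ => norm_dot_le _ _)

lemma one_lt_toReal : 1 < p.toReal := by
  rw [← ENNReal.toReal_one]
  exact (ENNReal.toReal_lt_toReal ENNReal.one_ne_top hpt.out.ne).mpr hp.out

lemma toReal_pos : 0 < p.toReal := lt_trans one_pos one_lt_toReal

lemma ne_zero_exponent : p ≠ 0 := (zero_lt_one.trans hp.out).ne'

variable (p q) in
lemma toReal_holderConjugate : p.toReal.HolderConjugate q.toReal :=
  ENNReal.HolderConjugate.toReal (p := p) (q := q) one_lt_toReal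

/-- The integral operator with the Bergman kernel is symmetric: this is Fubini's theorem. -/
lemma integral_dot_kernInt {f : Ball n → Vec d p} {g : Ball n → Vec d q}
    (hf : MemLp f p (vMeasure n α)) (hg : MemLp g q (vMeasure n α)) :
    ∫ z : Ball n, dot (kernInt α f z) (g z) ∂(vMeasure n α) =
      ∫ w : Ball n, dot (f w) (kernInt α g w) ∂(vMeasure n α) := by
  set v := vMeasure n α with hv
  set H : Ball n → Ball n → ℂ := fun z w => kern α (w : 𝔼) z * dot (f w) (g z) with hH
  have hL : ∀ z : Ball n, dot (kernInt α f z) (g z) = ∫ w, H z w ∂v := by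
    intro z
    rw [kernInt, dot_integral_left (integrable_kern_smul (MemLp.integrable_vMeasure hf) z)]
    simp only [dot_smul_left, hH, hv]
  have hR : ∀ w : Ball n, dot (f w) (kernInt α g w) = ∫ z, H z w ∂v := by
    intro w
    rw [kernInt, dot_integral_right _ (integrable_kern_smul (MemLp.integrable_vMeasure hg) w)]
    refine integral_congr_ae (ae_of_all _ fun z => ?_)
    simp only [dot_smul_right, hH]
    rw [conj_kern α z.norm_lt.le w.norm_lt]
  simp only [hL, hR]
  -- The double integral converges absolutely: the operator with kernel `|K_w(z)|` is bounded on
  -- `L^p`, and the rest is Hölder's inequality.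
  refine integral_integral_swap ?_
  have hm : AEStronglyMeasurable (Function.uncurry H) (v.prod v) :=
    (continuous_kern_uncurry (n := n) (α := α)).aestronglyMeasurable.mul
      (aestronglyMeasurable_dot (f := fun x : Ball n × Ball n => f x.2)
        (g := fun x : Ball n × Ball n => g x.1) hf.1.comp_snd hg.1.comp_fst)
  refine ⟨hm, ?_⟩
  rw [HasFiniteIntegral, lintegral_prod _ hm.enorm]
  have hb : ∀ z w, ‖H z w‖ₑ ≤ (d : ℝ≥0∞) * (‖kern α (w : 𝔼) z‖ₑ * ‖f w‖ₑ * ‖g z‖ₑ) := by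
    intro z w
    have h1 : ‖H z w‖ ≤ d * (‖kern α (w : 𝔼) z‖ * ‖f w‖ * ‖g z‖) := by
      rw [hH]
      simp only
      rw [norm_mul]
      calc _ ≤ ‖kern α (w : 𝔼) z‖ * (d * (‖f w‖ * ‖g z‖)) := by
            gcongr; exact norm_dot_le _ _
        _ = _ := by ring
    rw [← ofReal_norm, ← ofReal_norm, ← ofReal_norm, ← ofReal_norm, ← ENNReal.ofReal_natCast,
      ← ENNReal.ofReal_mul (by positivity), ← ENNReal.ofReal_mul (by positivity),
      ← ENNReal.ofReal_mul (by positivity)]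
    exact ENNReal.ofReal_le_ofReal h1
  set T : Ball n → ℝ≥0∞ := fun z => ∫⁻ w : Ball n, ‖kern α (w : 𝔼) z‖ₑ * ‖f w‖ₑ ∂v with hT
  have hTm : AEMeasurable T v := by
    have : AEMeasurable (Function.uncurry fun z w : Ball n => ‖kern α (w : 𝔼) z‖ₑ * ‖f w‖ₑ)
        (v.prod v) :=
      (continuous_kern_uncurry (n := n) (α := α)).aestronglyMeasurable.enorm.mul
        hf.1.comp_snd.enorm
    exact this.lintegral_prod_right'
  calc ∫⁻ z, ∫⁻ w, ‖H z w‖ₑ ∂v ∂v ≤ ∫⁻ z, (d : ℝ≥0∞) * (T z * ‖g z‖ₑ) ∂v := by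
        refine lintegral_mono fun z => ?_
        refine (lintegral_mono (hb z)).trans (le_of_eq ?_)
        have hm1 : AEMeasurable (fun w : Ball n => ‖kern α (w : 𝔼) z‖ₑ * ‖f w‖ₑ) v :=
          (continuous_kern_left α z).measurable.enorm.aemeasurable.mul hf.1.enorm
        rw [lintegral_const_mul'' _ (hm1.mul_const _), lintegral_mul_const'' _ hm1]
    _ = (d : ℝ≥0∞) * ∫⁻ z, (T * fun z => ‖g z‖ₑ) z ∂v := by
        exact lintegral_const_mul'' _ (hTm.mul hg.1.enorm)
    _ ≤ (d : ℝ≥0∞) * ((∫⁻ z, T z ^ p.toReal ∂v) ^ (1 / p.toReal) *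
          (∫⁻ z, ‖g z‖ₑ ^ q.toReal ∂v) ^ (1 / q.toReal)) := by
        gcongr
        exact ENNReal.lintegral_mul_le_Lp_mul_Lq v (toReal_holderConjugate p q) hTm hg.1.enorm
    _ < ∞ := by
        have hp0 : 0 ≤ 1 / p.toReal := by positivity
        have hq0 : 0 ≤ 1 / q.toReal := by positivity
        obtain ⟨C, hC, hCf⟩ := lintegral_kern_rpow_le n α (p := p.toReal) one_lt_toReal
        have h1 : ∫⁻ w, ‖f w‖ₑ ^ p.toReal ∂v < ∞ :=
          lintegral_rpow_enorm_lt_top_of_eLpNorm_lt_top ne_zero_exponent hpt.out.ne hf.2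
        have h2 : ∫⁻ w, ‖g w‖ₑ ^ q.toReal ∂v < ∞ :=
          lintegral_rpow_enorm_lt_top_of_eLpNorm_lt_top ne_zero_exponent hqt.out.ne hg.2
        refine ENNReal.mul_lt_top (by simp) (ENNReal.mul_lt_top ?_ ?_)
        · refine ENNReal.rpow_lt_top_of_nonneg hp0 ?_
          exact ((hCf _ hf.1.enorm).trans_lt (ENNReal.mul_lt_top hC.lt_top h1)).ne
        · exact ENNReal.rpow_lt_top_of_nonneg hq0 h2.ne

lemma pairing_eq_integral_dot (f : Bergman n d p α) (g : Bergman n d q α) :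
    pairing f g = ∫ w, dot (f w) (g w) ∂(vMeasure n α) := rfl

/-- The Bergman projection is symmetric, so it can be dropped from a pairing. -/
lemma pairing_bergmanProj {f : Ball n → Vec d p} (hf : MemLp f p (vMeasure n α))
    (g : Bergman n d q α) :
    pairing (bergmanProj n d p α (hf.toLp f)) g = ∫ w, dot (f w) (g w) ∂(vMeasure n α) := by
  rw [pairing_eq_integral_dot]
  simp only [bergmanProj_toLp]
  rw [integral_dot_kernInt hf g.memLp]
  simp only [g.kernInt_eq]

lemma conj_pairing (f : Bergman n d p α) (g : Bergman n d q α) :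
    (starRingEnd ℂ) (pairing f g) = pairing g f := by
  rw [pairing_eq_integral_dot, pairing_eq_integral_dot, ← integral_conj]
  simp only [conj_dot]

lemma norm_pairing_le (f : Bergman n d p α) (g : Bergman n d q α) :
    ‖pairing f g‖ ≤ d * (‖f‖ * ‖g‖) := by
  rw [pairing_eq_integral_dot, Bergman.norm_def, Bergman.norm_def]
  have hpq' := toReal_holderConjugate p q
  have hf := f.memLp
  have hg := g.memLp
  have e1 : (eLpNorm f p (vMeasure n α)).toReal =
      (∫ w, ‖f w‖ ^ p.toReal ∂(vMeasure n α)) ^ (1 / p.toReal) := by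
    rw [hf.eLpNorm_eq_integral_rpow_norm ne_zero_exponent hpt.out.ne,
      ENNReal.toReal_ofReal (by positivity), one_div]
  have e2 : (eLpNorm g q (vMeasure n α)).toReal =
      (∫ w, ‖g w‖ ^ q.toReal ∂(vMeasure n α)) ^ (1 / q.toReal) := by
    rw [hg.eLpNorm_eq_integral_rpow_norm ne_zero_exponent hqt.out.ne,
      ENNReal.toReal_ofReal (by positivity), one_div]
  rw [e1, e2]
  refine (norm_integral_le_integral_norm _).trans ?_
  calc ∫ w, ‖dot (f w) (g w)‖ ∂(vMeasure n α)
      ≤ ∫ w, (d : ℝ) * (‖f w‖ * ‖g w‖) ∂(vMeasure n α) := by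
        refine integral_mono (integrable_dot hf hg).norm ?_ fun w => norm_dot_le _ _
        exact (integrable_norm_mul_norm hf hg).const_mul _
    _ = d * ∫ w, ‖f w‖ * ‖g w‖ ∂(vMeasure n α) := integral_const_mul _ _
    _ ≤ _ := by
        gcongr
        have h := integral_mul_norm_le_Lp_mul_Lq (μ := vMeasure n α) (f := fun w => ‖f w‖)
          (g := fun w => ‖g w‖) hpq' (by rw [ENNReal.ofReal_toReal hpt.out.ne]; exact hf.norm)
          (by rw [ENNReal.ofReal_toReal hqt.out.ne]; exact hg.norm)
        simpa only [norm_norm] using h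

lemma pairing_sub_right (f : Bergman n d p α) (g g' : Bergman n d q α) :
    pairing f (g - g') = pairing f g - pairing f g' := by
  simp only [pairing_eq_integral_dot]
  rw [← integral_sub (integrable_dot f.memLp g.memLp) (integrable_dot f.memLp g'.memLp)]
  refine integral_congr_ae (ae_of_all _ fun w => ?_)
  simp only [Bergman.sub_apply, dot_sub_right]

/-- The vector valued kernel function `K_a v`. -/
def kernVec {n d : ℕ} {p : ℝ≥0∞} [Fact (1 ≤ p)] {α : ℝ} [Fact (-1 < α)] (a : Ball n)
    (v : Vec d p) : Bergman n d p α :=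
  ⟨fun w => kern α (a : EuclideanSpace ℂ (Fin n)) w • v,
    (isHolomorphic_kern α a.norm_lt.le).smul (isHolomorphic_const v), by
      refine MemLp.of_bound ((((isHolomorphic_kern α a.norm_lt.le).smul
        (isHolomorphic_const v)).continuous).aestronglyMeasurable)
        (((1 - ‖(a : EuclideanSpace ℂ (Fin n))‖) ^ ((n : ℝ) + 1 + α))⁻¹ * ‖v‖)
        (ae_of_all _ fun w => ?_)
      rw [norm_smul, norm_kern_comm]
      gcongr
      exact norm_kern_le Fact.out w.norm_lt.le a.norm_lt⟩

lemma kernVec_apply (a : Ball n) (v : Vec d p) (w : Ball n) :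
    (kernVec a v : Bergman n d p α) w = kern α (a : 𝔼) w • v := rfl

lemma pairing_kernVec_right (f : Bergman n d p α) (a : Ball n) (v : Vec d q) :
    pairing f (kernVec a v : Bergman n d q α) = dot (f a) v := by
  have h : ∀ w : Ball n, dot (f w) ((kernVec a v : Bergman n d q α) w) =
      dot (kern α (w : 𝔼) a • f w) v := fun w => by
    rw [kernVec_apply, dot_smul_right, dot_smul_left, conj_kern α a.norm_lt.le w.norm_lt]
  rw [pairing_eq_integral_dot]
  simp only [h]
  rw [← dot_integral_left (integrable_kern_smul (MemLp.integrable_vMeasure f.memLp) a)]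
  congr 1
  exact f.kernInt_eq a

lemma pairing_kernVec_left (g : Bergman n d q α) (a : Ball n) (v : Vec d p) :
    pairing (kernVec a v : Bergman n d p α) g = dot v (g a) := by
  have : q.HolderConjugate p := hpq.symm
  rw [← conj_pairing, pairing_kernVec_right, conj_dot]

variable (q) in
lemma Bergman.apply_eq_pairing (f : Bergman n d p α) (a : Ball n) (i : Fin d) :
    f a i = pairing f (kernVec a (PiLp.single q i (1 : ℂ)) : Bergman n d q α) := by
  rw [pairing_kernVec_right, dot_single]

lemma Bergman.ext_pairing {f f' : Bergman n d p α}
    (h : ∀ g : Bergman n d q α, pairing f g = pairing f' g) : f = f' := by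
  ext a i
  rw [f.apply_eq_pairing q, f'.apply_eq_pairing q, h]

lemma adj_apply_of_exists {T : Bergman n d q α →L[ℂ] Bergman n d q α}
    {V : Bergman n d p α →L[ℂ] Bergman n d p α}
    (h : ∀ f g, pairing (V f) g = pairing f (T g)) : adj p T = V := by
  have hex : ∃ V : Bergman n d p α →L[ℂ] Bergman n d p α,
      ∀ f g, pairing (V f) g = pairing f (T g) := ⟨V, h⟩
  rw [adj, dif_pos hex]
  ext1 f
  exact Bergman.ext_pairing fun g => by rw [hex.choose_spec, h]

end BergmanBall
end

noncomputable section

namespace BergmanBall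

/-! ### Toeplitz operators -/

set_option linter.unusedSectionVars false

variable {n d : ℕ}

local notation "𝔼" => EuclideanSpace ℂ (Fin n)

section Symbol

variable {p : ℝ≥0∞} [Fact (1 ≤ p)] {α : ℝ}

/-- The operator on `ℂᵈ` given by a matrix unit. -/
def unitMap {d : ℕ} (p : ℝ≥0∞) [Fact (1 ≤ p)] (i j : Fin d) : Vec d p →L[ℂ] Vec d p :=
  LinearMap.toContinuousLinearMap (Matrix.toLpLin p p (Matrix.single i j (1 : ℂ)))

lemma toLpLin_eq_sum (A : Matrix (Fin d) (Fin d) ℂ) (v : Vec d p) :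
    Matrix.toLpLin p p A v = ∑ i, ∑ j, A i j • unitMap p i j v := by
  conv_lhs => rw [Matrix.matrix_eq_sum_single A]
  rw [map_sum, LinearMap.sum_apply]
  refine Finset.sum_congr rfl fun i _ => ?_
  rw [map_sum, LinearMap.sum_apply]
  refine Finset.sum_congr rfl fun j _ => ?_
  have : Matrix.single i j (A i j) = A i j • Matrix.single i j (1 : ℂ) := by
    rw [Matrix.smul_single, smul_eq_mul, mul_one]
  rw [this, map_smul]
  rfl

/-- `φ` is essentially bounded by `M` as an operator valued function on `ℂᵈ` with the `p`-norm. -/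
def SymbolBound {n d : ℕ} (α : ℝ) (p : ℝ≥0∞) (φ : Ball n → Matrix (Fin d) (Fin d) ℂ)
    (M : ℝ) : Prop :=
  ∀ᵐ w ∂(vMeasure n α), ∀ v : Vec d p, ‖Matrix.toLpLin p p (φ w) v‖ ≤ M * ‖v‖

lemma IsBddSymbol.exists_bound {φ : Ball n → Matrix (Fin d) (Fin d) ℂ} (hφ : IsBddSymbol α φ) :
    ∃ M, 0 ≤ M ∧ SymbolBound α p φ M := by
  refine ⟨∑ i, ∑ j, (eLpNormEssSup (fun z => φ z i j) (vMeasure n α)).toReal *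
    ‖unitMap (d := d) p i j‖, by positivity, ?_⟩
  have h : ∀ᵐ w ∂(vMeasure n α), ∀ i j, ‖φ w i j‖ ≤
      (eLpNormEssSup (fun z => φ z i j) (vMeasure n α)).toReal := by
    rw [ae_all_iff]; intro i
    rw [ae_all_iff]; intro j
    have hfin : eLpNormEssSup (fun z => φ z i j) (vMeasure n α) ≠ ∞ := by
      have := (hφ i j).2
      rw [eLpNorm_exponent_top] at this
      exact this.ne
    filter_upwards [enorm_ae_le_eLpNormEssSup (fun z => φ z i j) (vMeasure n α)] with w hw
    rw [← toReal_enorm]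
    exact ENNReal.toReal_mono hfin hw
  filter_upwards [h] with w hw v
  rw [toLpLin_eq_sum, Finset.sum_mul]
  refine (norm_sum_le _ _).trans (Finset.sum_le_sum fun i _ => ?_)
  rw [Finset.sum_mul]
  refine (norm_sum_le _ _).trans (Finset.sum_le_sum fun j _ => ?_)
  rw [norm_smul, mul_assoc]
  gcongr
  · exact hw i j
  · exact ContinuousLinearMap.le_opNorm _ _

lemma IsBddSymbol.aestronglyMeasurable {φ : Ball n → Matrix (Fin d) (Fin d) ℂ}
    (hφ : IsBddSymbol α φ) {f : Ball n → Vec d p} (hf : AEStronglyMeasurable f (vMeasure n α)) :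
    AEStronglyMeasurable (fun w => Matrix.toLpLin p p (φ w) (f w)) (vMeasure n α) := by
  simp only [toLpLin_eq_sum]
  refine Finset.aestronglyMeasurable_fun_sum _ fun i _ =>
    Finset.aestronglyMeasurable_fun_sum _ fun j _ => ?_
  exact (hφ i j).1.smul ((unitMap p i j).continuous.comp_aestronglyMeasurable hf)

lemma IsBddSymbol.memLp {φ : Ball n → Matrix (Fin d) (Fin d) ℂ} (hφ : IsBddSymbol α φ)
    {f : Ball n → Vec d p} (hf : MemLp f p (vMeasure n α)) :
    MemLp (fun w => Matrix.toLpLin p p (φ w) (f w)) p (vMeasure n α) := by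
  obtain ⟨M, -, h⟩ := hφ.exists_bound (p := p)
  exact hf.of_le_mul (hφ.aestronglyMeasurable hf.1) (h.mono fun w hw => hw (f w))

end Symbol

variable {p q : ℝ≥0∞} [Fact (1 ≤ p)] [Fact (1 ≤ q)] [hp : Fact (1 < p)] [hpt : Fact (p < ∞)]
  [hq : Fact (1 < q)] [hqt : Fact (q < ∞)] [hpq : p.HolderConjugate q]
  {α : ℝ} [hα : Fact (-1 < α)]

lemma norm_bergmanProj_toLp_le {f : Ball n → Vec d p} (hf : MemLp f p (vMeasure n α))
    {g : Bergman n d p α} {M : ℝ} (h : ∀ᵐ w ∂(vMeasure n α), ‖f w‖ ≤ M * ‖g w‖) :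
    ‖bergmanProj n d p α (hf.toLp f)‖ ≤ ‖bergmanProj n d p α‖ * (M * ‖g‖) := by
  refine ((bergmanProj n d p α).le_opNorm _).trans ?_
  gcongr
  rw [← Bergman.norm_toLp g]
  refine Lp.norm_le_mul_norm_of_ae_le_mul ?_
  filter_upwards [h, hf.coeFn_toLp, g.coeFn_toLp] with w h1 h2 h3
  rw [h2, h3]
  exact h1

/-- The Toeplitz operator with symbol `φ`. -/
def toeplitz {φ : Ball n → Matrix (Fin d) (Fin d) ℂ} (hφ : IsBddSymbol α φ) :
    Bergman n d p α →L[ℂ] Bergman n d p α :=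
  LinearMap.mkContinuousOfExistsBound
    { toFun := fun f => bergmanProj n d p α ((hφ.memLp f.memLp).toLp _)
      map_add' := fun f g => by
        rw [← map_add, ← MemLp.toLp_add]
        congr 2
        funext w
        simp only [Bergman.add_apply, map_add, Pi.add_apply]
      map_smul' := fun c f => by
        rw [RingHom.id_apply, ← map_smul, ← MemLp.toLp_const_smul]
        congr 2
        funext w
        simp only [Bergman.smul_apply, map_smul, Pi.smul_apply] }
    (by
      obtain ⟨M, hM, h⟩ := hφ.exists_bound (p := p)
      refine ⟨‖bergmanProj n d p α‖ * M, fun f => ?_⟩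
      rw [mul_assoc]
      exact norm_bergmanProj_toLp_le _ (h.mono fun w hw => hw (f w)))

lemma toeplitz_def {φ : Ball n → Matrix (Fin d) (Fin d) ℂ} (hφ : IsBddSymbol α φ)
    (f : Bergman n d p α) :
    toeplitz hφ f = bergmanProj n d p α ((hφ.memLp f.memLp).toLp _) := rfl

lemma toeplitz_apply {φ : Ball n → Matrix (Fin d) (Fin d) ℂ} (hφ : IsBddSymbol α φ)
    (f : Bergman n d p α) (z : Ball n) :
    toeplitz hφ f z = kernInt α (fun w => Matrix.toLpLin p p (φ w) (f w)) z := by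
  rw [toeplitz_def, bergmanProj_toLp]

lemma isToeplitz_toeplitz {φ : Ball n → Matrix (Fin d) (Fin d) ℂ} (hφ : IsBddSymbol α φ) :
    IsToeplitz φ (toeplitz hφ : Bergman n d p α →L[ℂ] Bergman n d p α) := fun f z =>
  toeplitz_apply hφ f z

lemma IsToeplitz.eq_toeplitz {φ : Ball n → Matrix (Fin d) (Fin d) ℂ} (hφ : IsBddSymbol α φ)
    {T : Bergman n d p α →L[ℂ] Bergman n d p α} (hT : IsToeplitz φ T) : T = toeplitz hφ := by
  ext1 f
  ext1 z
  rw [hT f z, isToeplitz_toeplitz hφ f z]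

lemma pairing_toeplitz {φ : Ball n → Matrix (Fin d) (Fin d) ℂ} (hφ : IsBddSymbol α φ)
    (f : Bergman n d p α) (g : Bergman n d q α) :
    pairing (toeplitz hφ f) g =
      ∫ w, dot (Matrix.toLpLin p p (φ w) (f w)) (g w) ∂(vMeasure n α) := by
  rw [toeplitz_def, pairing_bergmanProj]

lemma norm_toeplitz_apply_le {φ : Ball n → Matrix (Fin d) (Fin d) ℂ} (hφ : IsBddSymbol α φ)
    {M : ℝ} (h : SymbolBound α p φ M) (f : Bergman n d p α) :
    ‖toeplitz hφ f‖ ≤ ‖bergmanProj n d p α‖ * M * ‖f‖ := by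
  rw [mul_assoc]
  exact norm_bergmanProj_toLp_le _ (h.mono fun w hw => hw (f w))

/-! ### The operators `U_z` and their adjoints -/

/-- The factor in the definition of `U_z^{(p,α)}`. -/
def wt {n : ℕ} (p : ℝ≥0∞) (α : ℝ) (z w : Ball n) : ℂ :=
  (((1 - ‖(z : EuclideanSpace ℂ (Fin n))‖ ^ 2) ^ ((n + 1 + α) / p.toReal) : ℝ) : ℂ) /
    (1 - inner ℂ (z : EuclideanSpace ℂ (Fin n)) (w : EuclideanSpace ℂ (Fin n))) ^
      ((2 * (n + 1 + α) / p.toReal : ℝ) : ℂ)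

lemma weightedComp_apply (z : Ball n) (f : Ball n → Vec d p) (w : Ball n) :
    weightedComp α z f w = wt p α z w • f (aut z w) := rfl

lemma one_sub_inner_cpow_ne_zero (z w : Ball n) (a : ℂ) :
    (1 - inner ℂ (z : 𝔼) (w : 𝔼)) ^ a ≠ 0 := fun h =>
  one_sub_inner_ne_zero z w (Complex.cpow_eq_zero_iff _ _ |>.mp h).1

lemma wt_ne_zero (z w : Ball n) : wt p α z w ≠ 0 := by
  refine div_ne_zero ?_ (one_sub_inner_cpow_ne_zero z w _)
  exact_mod_cast (Real.rpow_pos_of_pos z.one_sub_norm_sq_pos _).ne'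

lemma norm_wt (z w : Ball n) : ‖wt p α z w‖ = autDensity α z w ^ (1 / p.toReal) := by
  have hz := z.one_sub_norm_sq_pos
  have hD := norm_one_sub_inner_pos z w
  rw [wt, norm_div, Complex.norm_real, Real.norm_of_nonneg (Real.rpow_nonneg hz.le _),
    Complex.norm_cpow_real, autDensity, ← Real.rpow_mul (div_pos hz (by positivity)).le,
    Real.div_rpow hz.le (by positivity), ← Real.rpow_natCast ‖1 - inner ℂ (z : 𝔼) (w : 𝔼)‖,
    ← Real.rpow_mul hD.le]
  congr 2
  · ring
  · push_cast; ring

lemma IsHolomorphic.congr {F : Type*} [NormedAddCommGroup F] [NormedSpace ℂ F]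
    {f g : Ball n → F} (hf : IsHolomorphic f) (h : ∀ w, f w = g w) : IsHolomorphic g :=
  funext h ▸ hf

lemma isHolomorphic_wt (z : Ball n) : IsHolomorphic (wt p α z) := by
  have := (isHolomorphic_const (n := n)
    (((1 - ‖(z : 𝔼)‖ ^ 2) ^ ((n + 1 + α) / p.toReal) : ℝ) : ℂ)).smul
    (isHolomorphic_cpow z.norm_lt.le (-((2 * (n + 1 + α) / p.toReal : ℝ) : ℂ)))
  refine this.congr fun w => ?_
  rw [wt, Complex.cpow_neg, smul_eq_mul]
  exact (div_eq_mul_inv _ _).symm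

lemma ofReal_mul_cpow {r : ℝ} (hr : 0 < r) {x : ℂ} (hx : x ≠ 0) (c : ℂ) :
    ((r : ℂ) * x) ^ c = (r : ℂ) ^ c * x ^ c := by
  have hr' : (r : ℂ) ≠ 0 := by exact_mod_cast hr.ne'
  rw [Complex.cpow_def_of_ne_zero (mul_ne_zero hr' hx), Complex.cpow_def_of_ne_zero hr',
    Complex.cpow_def_of_ne_zero hx, Complex.log_ofReal_mul hr hx, ← Complex.exp_add,
    Complex.ofReal_log hr.le, add_mul]

lemma wt_aut_mul (z w : Ball n) : wt p α z (aut z w) * wt p α z w = 1 := by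
  have hz := z.one_sub_norm_sq_pos
  have hne := one_sub_inner_ne_zero z w
  have hs := one_sub_inner_mem_slitPlane z.norm_lt.le w.norm_lt
  set a : ℝ := (n + 1 + α) / p.toReal with ha
  have hx : (1 : ℂ) - inner ℂ (z : 𝔼) (aut z w : 𝔼) =
      ((1 - ‖(z : 𝔼)‖ ^ 2 : ℝ) : ℂ) * (1 - inner ℂ (z : 𝔼) (w : 𝔼))⁻¹ := by
    rw [coe_aut, inner_autFun_left z.norm_lt w.norm_lt, ← Complex.ofReal_pow, defect_sq z.norm_lt,
      div_eq_mul_inv]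
  have h2 : (2 * (n + 1 + α) / p.toReal : ℝ) = a + a := by rw [ha]; ring
  have hc := one_sub_inner_cpow_ne_zero z w ((a + a : ℝ) : ℂ)
  have hr : (((1 - ‖(z : 𝔼)‖ ^ 2) ^ a : ℝ) : ℂ) ≠ 0 := by
    exact_mod_cast (Real.rpow_pos_of_pos hz _).ne'
  rw [wt, wt, hx, ← ha, h2, ofReal_mul_cpow hz (inv_ne_zero hne),
    Complex.inv_cpow _ _ (Complex.slitPlane_arg_ne_pi hs), ← Complex.ofReal_cpow hz.le,
    Real.rpow_add hz, Complex.ofReal_mul]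
  generalize (1 - inner ℂ (z : 𝔼) (w : 𝔼)) ^ ((a + a : ℝ) : ℂ) = x at hc ⊢
  field_simp

lemma eLpNorm_weightedComp (z : Ball n) (f : Bergman n d p α) :
    eLpNorm (weightedComp α z f) p (vMeasure n α) = eLpNorm f p (vMeasure n α) := by
  have hpos : 0 < p.toReal := toReal_pos
  rw [eLpNorm_eq_lintegral_rpow_enorm_toReal ne_zero_exponent hpt.out.ne,
    eLpNorm_eq_lintegral_rpow_enorm_toReal ne_zero_exponent hpt.out.ne,
    ← lintegral_autDensity_mul_aut α z (g := fun w => ‖f w‖ₑ ^ p.toReal)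
      (f.isHolomorphic.continuous.measurable.enorm.pow_const _)]
  congr 1
  refine lintegral_congr fun w => ?_
  have hd := autDensity_pos α z w
  rw [weightedComp_apply, enorm_smul, ENNReal.mul_rpow_of_nonneg _ _ hpos.le]
  congr 1
  rw [← ofReal_norm, norm_wt, ENNReal.ofReal_rpow_of_nonneg (by positivity) hpos.le,
    ← Real.rpow_mul hd.le, one_div_mul_cancel hpos.ne', Real.rpow_one]

lemma exists_weightedComp_operator (z : Ball n) :
    ∃ T : Bergman n d p α →L[ℂ] Bergman n d p α, ∀ f w, T f w = weightedComp α z f w := by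
  have hhol : ∀ f : Bergman n d p α, IsHolomorphic (weightedComp α z f) := fun f =>
    (isHolomorphic_wt z).smul (f.isHolomorphic.comp_aut z)
  have hmem : ∀ f : Bergman n d p α, MemLp (weightedComp α z f) p (vMeasure n α) := fun f =>
    ⟨(hhol f).continuous.aestronglyMeasurable, by
      rw [eLpNorm_weightedComp]; exact f.memLp.2⟩
  refine ⟨LinearMap.mkContinuous
    { toFun := fun f => ⟨weightedComp α z f, hhol f, hmem f⟩
      map_add' := fun f g => by
        ext1 w
        exact smul_add (wt p α z w) (f (aut z w)) (g (aut z w))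
      map_smul' := fun c f => by
        ext1 w
        exact smul_comm (wt p α z w) c (f (aut z w)) } 1 fun f => ?_, fun f w => rfl⟩
  rw [one_mul, Bergman.norm_def, Bergman.norm_def, ← eLpNorm_weightedComp z f]
  rfl

lemma U_apply (z : Ball n) (f : Bergman n d p α) (w : Ball n) :
    U d p α z f w = weightedComp α z f w := by
  have h := exists_weightedComp_operator (d := d) (p := p) (α := α) z
  rw [U, dif_pos h]
  exact h.choose_spec f w

lemma U_apply' (z : Ball n) (f : Bergman n d p α) (w : Ball n) :
    U d p α z f w = wt p α z w • f (aut z w) := U_apply z f w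

lemma norm_U_apply (z : Ball n) (f : Bergman n d p α) : ‖U d p α z f‖ = ‖f‖ := by
  have h : ((U d p α z f : Bergman n d p α) : Ball n → Vec d p) = weightedComp α z f :=
    funext fun w => U_apply z f w
  rw [Bergman.norm_def, Bergman.norm_def, ← eLpNorm_weightedComp z f, h]

lemma U_U (z : Ball n) (f : Bergman n d p α) : U d p α z (U d p α z f) = f := by
  ext1 w
  rw [U_apply', U_apply', smul_smul, aut_aut, mul_comm, wt_aut_mul, one_smul]

/-- The unimodular function `b_z` such that `(U_z^{(q,α)})^* = T_{b_z} U_z^{(p,α)}`. -/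
def unimod {n : ℕ} (p q : ℝ≥0∞) (α : ℝ) (z w : Ball n) : ℂ :=
  (autDensity α z w : ℂ) / (wt p α z w * (starRingEnd ℂ) (wt q α z w))

lemma norm_unimod (z w : Ball n) : ‖unimod p q α z w‖ = 1 := by
  have hd := autDensity_pos α z w
  have hpq' := toReal_holderConjugate p q
  rw [unimod, norm_div, norm_mul, Complex.norm_conj, norm_wt, norm_wt, ← Real.rpow_add hd,
    one_div, one_div, hpq'.inv_add_inv_eq_one, Real.rpow_one, Complex.norm_real,
    Real.norm_of_nonneg hd.le, div_self hd.ne']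

lemma continuous_unimod (z : Ball n) : Continuous (unimod p q α z) := by
  unfold unimod
  refine Continuous.div (Complex.continuous_ofReal.comp (continuous_autDensity α z))
    ((isHolomorphic_wt z).continuous.mul
      (Complex.continuous_conj.comp (isHolomorphic_wt z).continuous)) fun w => ?_
  exact mul_ne_zero (wt_ne_zero z w) (by simpa using wt_ne_zero z w)

/-- The symbol `b_z · (φ ∘ φ_z)`. -/
def conjSymbol {n d : ℕ} (p q : ℝ≥0∞) (α : ℝ) (φ : Ball n → Matrix (Fin d) (Fin d) ℂ)
    (z w : Ball n) : Matrix (Fin d) (Fin d) ℂ := unimod p q α z w • φ (aut z w)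

lemma isBddSymbol_conjSymbol {φ : Ball n → Matrix (Fin d) (Fin d) ℂ} (hφ : IsBddSymbol α φ)
    (z : Ball n) : IsBddSymbol α (conjSymbol p q α φ z) := by
  intro i j
  have hqmp := quasiMeasurePreserving_aut α z
  have hm : AEStronglyMeasurable (fun w => conjSymbol p q α φ z w i j) (vMeasure n α) :=
    (continuous_unimod z).aestronglyMeasurable.mul ((hφ i j).1.comp_quasiMeasurePreserving hqmp)
  have hfin : eLpNormEssSup (fun z => φ z i j) (vMeasure n α) ≠ ∞ := by
    have := (hφ i j).2
    rw [eLpNorm_exponent_top] at this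
    exact this.ne
  refine MemLp.of_bound hm (eLpNormEssSup (fun z => φ z i j) (vMeasure n α)).toReal ?_
  filter_upwards [hqmp.ae (enorm_ae_le_eLpNormEssSup (fun z => φ z i j) (vMeasure n α))] with w hw
  have : conjSymbol p q α φ z w i j = unimod p q α z w * φ (aut z w) i j := rfl
  rw [this, norm_mul, norm_unimod, one_mul, ← toReal_enorm]
  exact ENNReal.toReal_mono hfin hw

lemma SymbolBound.conjSymbol {φ : Ball n → Matrix (Fin d) (Fin d) ℂ} {M : ℝ}
    (h : SymbolBound α p φ M) (z : Ball n) : SymbolBound α p (conjSymbol p q α φ z) M := by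
  filter_upwards [(quasiMeasurePreserving_aut α z).ae h] with w hw v
  rw [BergmanBall.conjSymbol, map_smul, LinearMap.smul_apply, norm_smul, norm_unimod, one_mul]
  exact hw v

lemma isBddSymbol_one : IsBddSymbol α (fun _ : Ball n => (1 : Matrix (Fin d) (Fin d) ℂ)) :=
  fun i j => MemLp.of_bound aestronglyMeasurable_const ‖(1 : Matrix (Fin d) (Fin d) ℂ) i j‖
    (ae_of_all _ fun _ => le_rfl)

lemma symbolBound_one : SymbolBound α p (fun _ : Ball n => (1 : Matrix (Fin d) (Fin d) ℂ)) 1 :=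
  ae_of_all _ fun w v => by rw [Matrix.toLpLin_one]; simp

lemma unimod_mul (z w : Ball n) :
    (autDensity α z w : ℂ) * (wt p α z (aut z w) * (starRingEnd ℂ) (wt q α z (aut z w))) =
      unimod p q α z w := by
  have h1 := wt_aut_mul (p := p) (α := α) z w
  have h2 := wt_aut_mul (p := q) (α := α) z w
  rw [eq_inv_of_mul_eq_one_left h1, eq_inv_of_mul_eq_one_left h2, map_inv₀, unimod, div_eq_mul_inv,
    mul_inv]

/-- The operator `T_{b_z}`. -/
def unimodToeplitz {n : ℕ} (d : ℕ) (p q : ℝ≥0∞) [Fact (1 ≤ p)] [Fact (1 ≤ q)] [Fact (1 < p)]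
    [Fact (p < ∞)] [Fact (1 < q)] [Fact (q < ∞)] [p.HolderConjugate q] (α : ℝ) [Fact (-1 < α)]
    (z : Ball n) : Bergman n d p α →L[ℂ] Bergman n d p α :=
  toeplitz (isBddSymbol_conjSymbol (p := p) (q := q) isBddSymbol_one z)

lemma pairing_unimodToeplitz (z : Ball n) (f : Bergman n d p α) (g : Bergman n d q α) :
    pairing (unimodToeplitz d p q α z f) g =
      ∫ w, unimod p q α z w * dot (f w) (g w) ∂(vMeasure n α) := by
  rw [unimodToeplitz, pairing_toeplitz]
  refine integral_congr_ae (ae_of_all _ fun w => ?_)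
  simp only [conjSymbol, map_smul, LinearMap.smul_apply, Matrix.toLpLin_one, LinearMap.id_apply,
    dot_smul_left]

lemma norm_unimodToeplitz_apply_le (z : Ball n) (f : Bergman n d p α) :
    ‖unimodToeplitz d p q α z f‖ ≤ ‖bergmanProj n d p α‖ * ‖f‖ := by
  have := norm_toeplitz_apply_le (isBddSymbol_conjSymbol (p := p) (q := q) isBddSymbol_one z)
    ((symbolBound_one (n := n) (d := d) (α := α) (p := p)).conjSymbol (q := q) z) f
  rwa [mul_one] at this

lemma pairing_adj_U_aux (z : Ball n) (f : Bergman n d p α) (g : Bergman n d q α) :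
    pairing ((unimodToeplitz d p q α z ∘L U d p α z) f) g = pairing f (U d q α z g) := by
  rw [ContinuousLinearMap.comp_apply, pairing_unimodToeplitz, pairing_eq_integral_dot,
    ← integral_autDensity_smul_aut α z fun w => dot (f w) (U d q α z g w)]
  refine integral_congr_ae (ae_of_all _ fun w => ?_)
  have h1 := wt_aut_mul (p := p) (α := α) z w
  simp only [U_apply', aut_aut, dot_smul_left, dot_smul_right, ← unimod_mul]
  rw [Complex.real_smul]
  linear_combination (autDensity α z w : ℂ) * (starRingEnd ℂ) (wt q α z (aut z w)) *
    dot (f (aut z w)) (g w) * h1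

lemma adj_U (z : Ball n) : adj p (U d q α z) = unimodToeplitz d p q α z ∘L U d p α z :=
  adj_apply_of_exists fun f g => pairing_adj_U_aux z f g

lemma pairing_adj_U (z : Ball n) (f : Bergman n d p α) (g : Bergman n d q α) :
    pairing (adj p (U d q α z) f) g = pairing f (U d q α z g) := by
  rw [adj_U, pairing_adj_U_aux]

variable (q) in
lemma norm_adj_U_apply_le (z : Ball n) (f : Bergman n d p α) :
    ‖adj p (U d q α z) f‖ ≤ ‖bergmanProj n d p α‖ * ‖f‖ := by
  rw [adj_U, ContinuousLinearMap.comp_apply, ← norm_U_apply z f]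
  exact norm_unimodToeplitz_apply_le z _

lemma adj_U_adj_U (z : Ball n) (f : Bergman n d p α) :
    adj p (U d q α z) (adj p (U d q α z) f) = f :=
  Bergman.ext_pairing (q := q) fun g => by rw [pairing_adj_U, pairing_adj_U, U_U]

/-- `(U_z^{(q,α)})^* T_φ U_z^{(p,α)}` is the Toeplitz operator with symbol `b_z · (φ ∘ φ_z)`. -/
lemma adj_U_toeplitz_U {φ : Ball n → Matrix (Fin d) (Fin d) ℂ} (hφ : IsBddSymbol α φ)
    (z : Ball n) (f : Bergman n d p α) :
    adj p (U d q α z) (toeplitz hφ (U d p α z f)) =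
      toeplitz (isBddSymbol_conjSymbol (p := p) (q := q) hφ z) f := by
  refine Bergman.ext_pairing (q := q) fun g => ?_
  rw [pairing_adj_U, pairing_toeplitz, pairing_toeplitz, ← integral_autDensity_smul_aut α z]
  refine integral_congr_ae (ae_of_all _ fun w => ?_)
  simp only [U_apply', aut_aut, conjSymbol, map_smul, LinearMap.smul_apply, dot_smul_left,
    dot_smul_right, ← unimod_mul]
  rw [Complex.real_smul]
  ring

/-- `T_{b_z}` is invertible with inverse `U_z^{(p,α)} (U_z^{(q,α)})^*`. -/
lemma U_adj_U_unimodToeplitz (z : Ball n) (f : Bergman n d p α) :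
    U d p α z (adj p (U d q α z) (unimodToeplitz d p q α z f)) = f := by
  have h : unimodToeplitz d p q α z f = adj p (U d q α z) (U d p α z f) := by
    rw [adj_U, ContinuousLinearMap.comp_apply, U_U]
  rw [h, adj_U_adj_U, U_U]

end BergmanBall
end

noncomputable section

namespace BergmanBall

/-! ### Families of operators with totally bounded orbits -/

section Families

lemma totallyBounded_of_approx {E : Type*} [PseudoMetricSpace E] {s : Set E}
    (h : ∀ ε > 0, ∃ t : Set E, TotallyBounded t ∧ ∀ x ∈ s, ∃ y ∈ t, dist x y ≤ ε) :
    TotallyBounded s := by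
  refine Metric.totallyBounded_iff.mpr fun ε hε => ?_
  obtain ⟨t, ht, hst⟩ := h (ε / 2) (by positivity)
  obtain ⟨u, hu, htu⟩ := Metric.totallyBounded_iff.mp ht (ε / 2) (by positivity)
  refine ⟨u, hu, fun x hx => ?_⟩
  obtain ⟨y, hy, hxy⟩ := hst x hx
  obtain ⟨c, hc, hyc⟩ := Set.mem_iUnion₂.mp (htu hy)
  refine Set.mem_iUnion₂.mpr ⟨c, hc, ?_⟩
  rw [Metric.mem_ball] at hyc ⊢
  linarith [dist_triangle x y c]

variable {ι E : Type*} [NormedAddCommGroup E] [NormedSpace ℂ E]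

omit [NormedSpace ℂ E] in
lemma totallyBounded_range_add {f g : ι → E} (hf : TotallyBounded (Set.range f))
    (hg : TotallyBounded (Set.range g)) : TotallyBounded (Set.range fun i => f i + g i) := by
  refine totallyBounded_of_approx fun ε hε => ?_
  obtain ⟨u, hu, hgu⟩ := Metric.totallyBounded_iff.mp hg ε hε
  refine ⟨⋃ y ∈ u, (fun x => x + y) '' Set.range f, ?_, ?_⟩
  · exact (totallyBounded_biUnion hu).mpr fun y _ =>
      hf.image (uniformContinuous_id.add uniformContinuous_const)
  · rintro _ ⟨i, rfl⟩
    obtain ⟨y, hy, hiy⟩ := Set.mem_iUnion₂.mp (hgu ⟨i, rfl⟩)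
    refine ⟨f i + y, Set.mem_iUnion₂.mpr ⟨y, hy, f i, ⟨i, rfl⟩, rfl⟩, ?_⟩
    rw [dist_add_left]
    exact (Metric.mem_ball.mp hiy).le

/-- A uniformly bounded family of operators all of whose orbits are totally bounded, that is,
a family which is relatively compact in the strong operator topology. -/
def OrbitTotallyBounded (T : ι → E →L[ℂ] E) : Prop :=
  (∃ C, 0 ≤ C ∧ ∀ i f, ‖T i f‖ ≤ C * ‖f‖) ∧ ∀ f, TotallyBounded (Set.range fun i => T i f)

lemma orbitTotallyBounded_const (S : E →L[ℂ] E) : OrbitTotallyBounded fun _ : ι => S :=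
  ⟨⟨‖S‖, norm_nonneg _, fun _ f => S.le_opNorm f⟩, fun f =>
    ((Set.finite_singleton (S f)).subset Set.range_const_subset).totallyBounded⟩

lemma OrbitTotallyBounded.add {S T : ι → E →L[ℂ] E} (hS : OrbitTotallyBounded S)
    (hT : OrbitTotallyBounded T) : OrbitTotallyBounded fun i => S i + T i := by
  obtain ⟨⟨C, hC, hSC⟩, hS⟩ := hS
  obtain ⟨⟨D, hD, hTD⟩, hT⟩ := hT
  refine ⟨⟨C + D, by positivity, fun i f => ?_⟩, fun f => ?_⟩
  · rw [add_mul]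
    exact (norm_add_le _ _).trans (add_le_add (hSC i f) (hTD i f))
  · exact totallyBounded_range_add (hS f) (hT f)

lemma OrbitTotallyBounded.comp {S T : ι → E →L[ℂ] E} (hS : OrbitTotallyBounded S)
    (hT : OrbitTotallyBounded T) : OrbitTotallyBounded fun i => S i ∘L T i := by
  obtain ⟨⟨C, hC, hSC⟩, hS⟩ := hS
  obtain ⟨⟨D, hD, hTD⟩, hT⟩ := hT
  refine ⟨⟨C * D, by positivity, fun i f => ?_⟩, fun f => ?_⟩
  · rw [mul_assoc]
    exact (hSC i _).trans (mul_le_mul_of_nonneg_left (hTD i f) hC)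
  · refine totallyBounded_of_approx fun ε hε => ?_
    obtain ⟨u, hu, htu⟩ := Metric.totallyBounded_iff.mp (hT f) (ε / (C + 1)) (by positivity)
    refine ⟨⋃ y ∈ u, Set.range fun i => S i y, ?_, ?_⟩
    · exact (totallyBounded_biUnion hu).mpr fun y _ => hS y
    · rintro _ ⟨i, rfl⟩
      obtain ⟨y, hy, hiy⟩ := Set.mem_iUnion₂.mp (htu ⟨i, rfl⟩)
      refine ⟨S i y, Set.mem_iUnion₂.mpr ⟨y, hy, i, rfl⟩, ?_⟩
      rw [Metric.mem_ball, dist_eq_norm, lt_div_iff₀ (by positivity)] at hiy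
      rw [dist_eq_norm]
      change ‖S i (T i f) - S i y‖ ≤ ε
      rw [← map_sub]
      refine (hSC i _).trans ?_
      nlinarith [norm_nonneg (T i f - y)]

lemma OrbitTotallyBounded.of_approx {T : ι → E →L[ℂ] E}
    (h : ∀ ε > 0, ∃ S : ι → E →L[ℂ] E, OrbitTotallyBounded S ∧
      ∀ i f, ‖T i f - S i f‖ ≤ ε * ‖f‖) : OrbitTotallyBounded T := by
  constructor
  · obtain ⟨S, ⟨⟨C, hC, hSC⟩, -⟩, hST⟩ := h 1 one_pos
    refine ⟨1 + C, by positivity, fun i f => ?_⟩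
    have := norm_add_le (T i f - S i f) (S i f)
    rw [sub_add_cancel] at this
    linarith [hST i f, hSC i f]
  · intro f
    refine totallyBounded_of_approx fun ε hε => ?_
    obtain ⟨S, ⟨-, hS⟩, hST⟩ := h (ε / (‖f‖ + 1)) (by positivity)
    refine ⟨_, hS f, ?_⟩
    rintro _ ⟨i, rfl⟩
    refine ⟨S i f, ⟨i, rfl⟩, ?_⟩
    rw [dist_eq_norm]
    refine (hST i f).trans ?_
    rw [div_mul_eq_mul_div, div_le_iff₀ (by positivity)]
    nlinarith

/-- It is enough to check the orbits of a set with dense span. -/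
lemma OrbitTotallyBounded.of_span_dense {T : ι → E →L[ℂ] E} {D : Set E}
    (hD : Dense (Submodule.span ℂ D : Set E)) (hb : ∃ C, 0 ≤ C ∧ ∀ i f, ‖T i f‖ ≤ C * ‖f‖)
    (h : ∀ f ∈ D, TotallyBounded (Set.range fun i => T i f)) : OrbitTotallyBounded T := by
  refine ⟨hb, ?_⟩
  obtain ⟨C, hC, hTC⟩ := hb
  have hspan : ∀ f ∈ Submodule.span ℂ D, TotallyBounded (Set.range fun i => T i f) := by
    intro f hf
    induction hf using Submodule.span_induction with
    | mem f hf => exact h f hf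
    | zero =>
      simp only [map_zero]
      exact ((Set.finite_singleton (0 : E)).subset Set.range_const_subset).totallyBounded
    | add f g _ _ hf hg =>
      simpa only [map_add] using totallyBounded_range_add hf hg
    | smul c f _ hf =>
      refine TotallyBounded.subset ?_ (hf.image (f := fun x : E => c • x)
        (uniformContinuous_const_smul c))
      rintro _ ⟨i, rfl⟩
      exact ⟨T i f, ⟨i, rfl⟩, (map_smul _ _ _).symm⟩
  intro f
  refine totallyBounded_of_approx fun ε hε => ?_
  obtain ⟨g, hg, hfg⟩ := Metric.dense_iff.mp hD f (ε / (C + 1)) (by positivity)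
  refine ⟨_, hspan g hfg, ?_⟩
  rintro _ ⟨i, rfl⟩
  refine ⟨T i g, ⟨i, rfl⟩, ?_⟩
  rw [Metric.mem_ball', dist_eq_norm, lt_div_iff₀ (by positivity)] at hg
  rw [dist_eq_norm, ← map_sub]
  refine (hTC i _).trans ?_
  nlinarith [norm_nonneg (f - g)]

end Families

/-! ### Compactness of the Bergman projection away from the sphere -/

variable {n d : ℕ}

local notation "𝔼" => EuclideanSpace ℂ (Fin n)

variable {p : ℝ≥0∞} [Fact (1 ≤ p)] {α : ℝ} [hα : Fact (-1 < α)]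

omit hα in
lemma norm_toLp_def {f : Ball n → Vec d p} (hf : MemLp f p (vMeasure n α)) :
    ‖hf.toLp f‖ = (eLpNorm f p (vMeasure n α)).toReal := Lp.norm_toLp _ _

lemma Bergman.norm_le_of_bound (f : Bergman n d p α) {C : ℝ} (hC : 0 ≤ C)
    (h : ∀ z, ‖f z‖ ≤ C) : ‖f‖ ≤ C := by
  rw [Bergman.norm_def]
  refine ENNReal.toReal_le_of_le_ofReal hC ?_
  have := eLpNorm_le_of_ae_bound (p := p) (μ := vMeasure n α) (ae_of_all _ h)
  simpa using this

lemma integral_norm_le_norm_toLp {f : Ball n → Vec d p} (hf : MemLp f p (vMeasure n α)) :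
    ∫ w, ‖f w‖ ∂(vMeasure n α) ≤ ‖hf.toLp f‖ := by
  rw [norm_toLp_def, integral_norm_eq_lintegral_enorm hf.1, ← eLpNorm_one_eq_lintegral_enorm]
  exact ENNReal.toReal_mono hf.2.ne (eLpNorm_le_eLpNorm_of_exponent_le Fact.out hf.1)

/-- The map `v ↦ K_a v`. -/
def kernCLM {n d : ℕ} (p : ℝ≥0∞) [Fact (1 ≤ p)] [Fact (1 < p)] [Fact (p < ∞)] (α : ℝ)
    [Fact (-1 < α)] (a : Ball n) :
    Vec d p →L[ℂ] Bergman n d p α :=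
  LinearMap.toContinuousLinearMap
    { toFun := fun v => kernVec a v
      map_add' := fun v v' => by
        ext1 w; simp only [kernVec_apply, Bergman.add_apply, smul_add]
      map_smul' := fun c v => by
        ext1 w
        rw [kernVec_apply, Bergman.smul_apply, RingHom.id_apply, kernVec_apply, smul_comm] }

/-- The kernel `K_w(z)` depends uniformly continuously on `w` for `|w| ≤ r < 1`, `|z| ≤ 1`. -/
lemma exists_kern_close (n : ℕ) (α : ℝ) {r ε : ℝ} (hr : r < 1) (hε : 0 < ε) :
    ∃ δ > 0, ∀ w w' z : Ball n, ‖(w : EuclideanSpace ℂ (Fin n))‖ ≤ r → dist w w' < δ →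
      ‖kern α (w : EuclideanSpace ℂ (Fin n)) z - kern α (w' : EuclideanSpace ℂ (Fin n)) z‖ ≤ ε := by
  set r' : ℝ := (1 + r) / 2 with hr'
  have hcont : ContinuousOn (fun x : EuclideanSpace ℂ (Fin n) × EuclideanSpace ℂ (Fin n) =>
      kern α x.1 x.2) (Metric.closedBall 0 r' ×ˢ Metric.closedBall 0 1) := by
    unfold kern
    have hs : ∀ x ∈ Metric.closedBall (0 : EuclideanSpace ℂ (Fin n)) r' ×ˢ
        Metric.closedBall (0 : EuclideanSpace ℂ (Fin n)) 1,
        1 - inner ℂ x.1 x.2 ∈ Complex.slitPlane := by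
      rintro ⟨w, z⟩ ⟨hw, hz⟩
      rw [mem_closedBall_zero_iff] at hw hz
      have hw1 : ‖w‖ < 1 := by simp only at hw; linarith
      have h2 := one_sub_inner_re_pos (z := z) (w := w) hz hw1
      left
      rw [← inner_conj_symm]
      simpa only [Complex.sub_re, Complex.conj_re] using h2
    refine ContinuousOn.inv₀ (ContinuousOn.cpow (by fun_prop) continuousOn_const hs) ?_
    intro x hx h
    exact Complex.slitPlane_ne_zero (hs x hx) (Complex.cpow_eq_zero_iff _ _ |>.mp h).1
  have huc := ((isCompact_closedBall _ _).prod
    (isCompact_closedBall _ _)).uniformContinuousOn_of_continuous hcont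
  obtain ⟨δ, hδ, h⟩ := Metric.uniformContinuousOn_iff.mp huc ε hε
  refine ⟨min δ ((1 - r) / 2), lt_min hδ (by linarith), fun w w' z hw hd => ?_⟩
  have hw' : ‖(w' : EuclideanSpace ℂ (Fin n))‖ ≤ r' := by
    have h1 : dist (w : EuclideanSpace ℂ (Fin n)) w' < (1 - r) / 2 :=
      hd.trans_le (min_le_right _ _)
    rw [dist_eq_norm, norm_sub_rev] at h1
    have h2 := norm_sub_norm_le (w' : EuclideanSpace ℂ (Fin n)) w
    linarith
  have hz : (z : EuclideanSpace ℂ (Fin n)) ∈ Metric.closedBall 0 1 :=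
    mem_closedBall_zero_iff.mpr z.norm_lt.le
  have := h (w, z) ⟨mem_closedBall_zero_iff.mpr (by simp only; linarith), hz⟩ (w', z)
    ⟨mem_closedBall_zero_iff.mpr hw', hz⟩ (by
    rw [Prod.dist_eq, dist_self, max_eq_left dist_nonneg]
    exact hd.trans_le (min_le_left _ _))
  rw [← dist_eq_norm]
  exact this.le

lemma isCompact_norm_le (n : ℕ) {r : ℝ} (hr : r < 1) :
    IsCompact {w : Ball n | ‖(w : EuclideanSpace ℂ (Fin n))‖ ≤ r} := by
  rw [Topology.IsInducing.subtypeVal.isCompact_iff]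
  have : Subtype.val '' {w : Ball n | ‖(w : EuclideanSpace ℂ (Fin n))‖ ≤ r} =
      Metric.closedBall 0 r := by
    ext x
    constructor
    · rintro ⟨w, hw, rfl⟩
      exact mem_closedBall_zero_iff.mpr hw
    · intro hx
      rw [mem_closedBall_zero_iff] at hx
      exact ⟨⟨x, mem_ball_zero_iff.mpr (hx.trans_lt hr)⟩, hx, rfl⟩
  rw [this]
  exact isCompact_closedBall _ _

/-- A measurable map with finite range which moves the points of a compact ball very little. -/
lemma exists_simpleFunc_dist_lt (n : ℕ) {r δ : ℝ} (hr : r < 1) (hδ : 0 < δ) :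
    ∃ π : SimpleFunc (Ball n) (Ball n),
      ∀ w : Ball n, ‖(w : EuclideanSpace ℂ (Fin n))‖ ≤ r → dist w (π w) < δ := by
  have : Nonempty (Ball n) := ⟨Ball.zero n⟩
  set e := TopologicalSpace.denseSeq (Ball n)
  obtain ⟨N, hN⟩ := (isCompact_norm_le n hr).elim_directed_cover
    (fun N : ℕ => ⋃ k ≤ N, Metric.ball (e k) δ)
    (fun N => isOpen_biUnion fun k _ => Metric.isOpen_ball) (by
      intro w _
      obtain ⟨k, hx⟩ := (TopologicalSpace.denseRange_denseSeq
        (Ball n)).exists_mem_open (Metric.isOpen_ball (x := w) (ε := δ))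
          ⟨w, Metric.mem_ball_self hδ⟩
      exact Set.mem_iUnion.mpr ⟨_, Set.mem_iUnion₂.mpr ⟨_, le_rfl, Metric.mem_ball_comm.mp hx⟩⟩)
    (Monotone.directed_le fun a b hab =>
      Set.biUnion_subset_biUnion_left fun k hk => le_trans hk hab)
  refine ⟨SimpleFunc.nearestPt e N, fun w hw => ?_⟩
  obtain ⟨k, hk, hwk⟩ := Set.mem_iUnion₂.mp (hN hw)
  have := SimpleFunc.edist_nearestPt_le e w hk
  rw [edist_dist, edist_dist, ENNReal.ofReal_le_ofReal_iff dist_nonneg] at this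
  rw [dist_comm]
  exact this.trans_lt (by rw [dist_comm]; exact hwk)

lemma exists_finite_rank_approx [hp : Fact (1 < p)] [hpt : Fact (p < ∞)] {r ε : ℝ} (hr : r < 1)
    (hε : 0 < ε) :
    ∃ s : Finset (Ball n), ∀ (f : Ball n → Vec d p) (hf : MemLp f p (vMeasure n α)),
      (∀ w : Ball n, r < ‖(w : 𝔼)‖ → f w = 0) →
      ∃ c : Ball n → Vec d p, (∀ a, ‖c a‖ ≤ ‖hf.toLp f‖) ∧
        ‖bergmanProj n d p α (hf.toLp f) - ∑ a ∈ s, kernVec a (c a)‖ ≤ ε * ‖hf.toLp f‖ := by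
  obtain ⟨δ, hδ, hk⟩ := exists_kern_close n α hr hε
  obtain ⟨π, hπ⟩ := exists_simpleFunc_dist_lt n hr hδ
  refine ⟨π.range, fun f hf h0 => ?_⟩
  have hfi : Integrable f (vMeasure n α) := MemLp.integrable_vMeasure hf
  refine ⟨fun a => ∫ w in π ⁻¹' {a}, f w ∂(vMeasure n α), fun a => ?_, ?_⟩
  · refine (norm_integral_le_integral_norm _).trans ((setIntegral_le_integral hfi.norm
      (ae_of_all _ fun w => norm_nonneg _)).trans (integral_norm_le_norm_toLp hf))
  · refine Bergman.norm_le_of_bound _ (by positivity) fun z => ?_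
    have hsum : (∑ a ∈ π.range, kernVec a (∫ w in π ⁻¹' {a}, f w ∂(vMeasure n α)) :
        Bergman n d p α) z = ∫ w, kern α (π w : 𝔼) z • f w ∂(vMeasure n α) := by
      have hev : ∀ (s : Finset (Ball n)) (g : Ball n → Bergman n d p α),
          (∑ a ∈ s, g a) z = ∑ a ∈ s, g a z := by
        intro s g
        classical
        induction s using Finset.induction_on with
        | empty => rfl
        | insert a s ha ih => rw [Finset.sum_insert ha, Finset.sum_insert ha, Bergman.add_apply, ih]
      rw [hev]
      have hpt : ∀ w, kern α (π w : 𝔼) z • f w =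
          ∑ a ∈ π.range, (π ⁻¹' {a}).indicator (fun w => kern α (a : 𝔼) z • f w) w := by
        intro w
        rw [Finset.sum_eq_single (π w)]
        · exact (Set.indicator_of_mem (s := π ⁻¹' {π w}) rfl
            (fun w' => kern α (π w : 𝔼) z • f w')).symm
        · intro a _ ha
          exact Set.indicator_of_notMem (s := π ⁻¹' {a})
            (fun h => ha (Set.mem_singleton_iff.mp h).symm) (fun w' => kern α (a : 𝔼) z • f w')
        · intro h
          exact absurd (π.mem_range_self w) h
      simp only [hpt]
      have hint : ∀ a ∈ π.range, Integrable
          ((π ⁻¹' {a}).indicator fun w => kern α (a : 𝔼) z • f w) (vMeasure n α) := fun a _ =>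
        Integrable.indicator (hfi.smul (kern α (a : 𝔼) z)) (π.measurableSet_fiber a)
      rw [integral_finsetSum _ hint]
      refine Finset.sum_congr rfl fun a _ => ?_
      rw [integral_indicator (π.measurableSet_fiber a), integral_smul, kernVec_apply]
    have hπi : Integrable (fun w => kern α (π w : 𝔼) z • f w) (vMeasure n α) := by
      have hb : ∀ w, ‖kern α (π w : 𝔼) z‖ ≤ ((1 - ‖(z : 𝔼)‖) ^ ((n : ℝ) + 1 + α))⁻¹ := fun w =>
        norm_kern_le hα.out (π w).norm_lt.le z.norm_lt
      have hm : Measurable fun w => kern α (π w : 𝔼) z :=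
        (continuous_kern_left α z).measurable.comp π.measurable
      refine (hfi.norm.const_mul ((1 - ‖(z : 𝔼)‖) ^ ((n : ℝ) + 1 + α))⁻¹).mono'
        (hm.aestronglyMeasurable.smul hfi.1) (ae_of_all _ fun w => ?_)
      rw [norm_smul]
      exact mul_le_mul_of_nonneg_right (hb w) (norm_nonneg _)
    rw [Bergman.sub_apply, hsum, bergmanProj_toLp, kernInt,
      ← integral_sub (integrable_kern_smul hfi z) hπi]
    refine (norm_integral_le_integral_norm _).trans ?_
    calc _ ≤ ∫ w, ε * ‖f w‖ ∂(vMeasure n α) := by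
          refine integral_mono_of_nonneg (ae_of_all _ fun w => norm_nonneg _)
            (hfi.norm.const_mul ε) (ae_of_all _ fun w => ?_)
          simp only
          rw [← sub_smul, norm_smul]
          rcases lt_or_ge r ‖(w : 𝔼)‖ with h | h
          · rw [h0 w h, norm_zero, mul_zero, mul_zero]
          · gcongr
            exact hk w (π w) z h (hπ w h)
      _ ≤ _ := by
          rw [integral_const_mul]
          gcongr
          exact integral_norm_le_norm_toLp hf

/-- The complement of a ball of radius `r` in the unit ball. -/
def collar (n : ℕ) (r : ℝ) : Set (Ball n) := {w | r < ‖(w : EuclideanSpace ℂ (Fin n))‖}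

lemma mem_collar {n : ℕ} {r : ℝ} {w : Ball n} :
    w ∈ collar n r ↔ r < ‖(w : EuclideanSpace ℂ (Fin n))‖ := Iff.rfl

lemma measurableSet_collar (n : ℕ) (r : ℝ) : MeasurableSet (collar n r) :=
  (isOpen_lt continuous_const (continuous_norm.comp continuous_subtype_val)).measurableSet

lemma tendsto_measure_collar (n : ℕ) (α : ℝ) [Fact (-1 < α)] :
    Tendsto (fun k : ℕ => vMeasure n α (collar n (1 - 1 / (k + 1)))) atTop (𝓝 0) := by
  have hanti : Antitone fun k : ℕ => collar n (1 - 1 / (k + 1)) := by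
    intro a b hab w hw
    rw [mem_collar] at hw ⊢
    refine lt_of_le_of_lt ?_ hw
    have : (1 : ℝ) / (b + 1) ≤ 1 / (a + 1) := by gcongr
    linarith
  have h := tendsto_measure_iInter_atTop (μ := vMeasure n α)
    (fun k : ℕ => (measurableSet_collar n (1 - 1 / ((k : ℝ) + 1))).nullMeasurableSet) hanti
    ⟨0, measure_ne_top _ _⟩
  have he : ⋂ k : ℕ, collar n (1 - 1 / ((k : ℝ) + 1)) = ∅ := by
    ext w
    simp only [Set.mem_iInter, Set.mem_empty_iff_false, iff_false, not_forall]
    obtain ⟨k, hk⟩ := exists_nat_one_div_lt (sub_pos.mpr w.norm_lt)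
    exact ⟨k, fun h => by rw [mem_collar] at h; linarith⟩
  rwa [he, measure_empty] at h

/-- The `L^p` mass of a function near the sphere is small. -/
lemma MemLp.exists_collar_le [hpt : Fact (p < ∞)] {f : Ball n → Vec d p}
    (hf : MemLp f p (vMeasure n α)) {ε : ℝ} (hε : 0 < ε) :
    ∃ r < 1, eLpNorm ((collar n r).indicator f) p (vMeasure n α) ≤ ENNReal.ofReal ε := by
  obtain ⟨δ, hδ, h⟩ := MeasureTheory.MemLp.eLpNorm_indicator_le Fact.out hpt.out.ne hf hε
  have hev := (tendsto_measure_collar n α).eventually_lt_const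
    (ENNReal.ofReal_pos.mpr hδ)
  obtain ⟨k, hk⟩ := hev.exists
  exact ⟨1 - 1 / ((k : ℝ) + 1), by have : (0 : ℝ) < 1 / (k + 1) := by positivity
                                   linarith,
    h _ (measurableSet_collar n _) hk.le⟩

variable [hp : Fact (1 < p)] [hpt : Fact (p < ∞)]

lemma norm_bergmanProj_sub_indicator_le {f : Ball n → Vec d p} (hf : MemLp f p (vMeasure n α))
    {r ε : ℝ} (hε : 0 ≤ ε)
    (h : eLpNorm ((collar n r).indicator f) p (vMeasure n α) ≤ ENNReal.ofReal ε) :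
    ‖bergmanProj n d p α (hf.toLp f) - bergmanProj n d p α
      ((hf.indicator (measurableSet_collar n r).compl).toLp _)‖ ≤ ‖bergmanProj n d p α‖ * ε := by
  rw [← map_sub, ← MemLp.toLp_sub]
  refine ((bergmanProj n d p α).le_opNorm _).trans ?_
  gcongr
  rw [norm_toLp_def]
  refine ENNReal.toReal_le_of_le_ofReal hε (le_trans (le_of_eq ?_) h)
  congr 1
  rw [sub_eq_iff_eq_add, Set.indicator_self_add_compl]

/-- The projections of a bounded family in `L^p` whose members have uniformly small mass near the
sphere form a totally bounded set. -/
lemma totallyBounded_range_bergmanProj {ι : Type*} {f : ι → Ball n → Vec d p}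
    (hf : ∀ i, MemLp (f i) p (vMeasure n α)) {M : ℝ} (hM : ∀ i, ‖(hf i).toLp (f i)‖ ≤ M)
    (h : ∀ ε > 0, ∃ r < 1, ∀ i, eLpNorm ((collar n r).indicator (f i)) p (vMeasure n α) ≤
      ENNReal.ofReal ε) :
    TotallyBounded (Set.range fun i => bergmanProj n d p α ((hf i).toLp (f i))) := by
  refine totallyBounded_of_approx fun ε hε => ?_
  set A := ‖bergmanProj n d p α‖ with hA
  have hA0 : 0 ≤ A := norm_nonneg _
  obtain ⟨r, hr, htail⟩ := h (ε / (2 * (A + 1))) (by positivity)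
  obtain ⟨s, hs⟩ := exists_finite_rank_approx (n := n) (d := d) (p := p) (α := α) hr
    (ε := ε / (2 * (|M| + 1))) (by positivity)
  refine ⟨(fun c : Ball n → Vec d p => ∑ a ∈ s, kernCLM p α a (c a)) ''
    (Set.univ.pi fun _ => Metric.closedBall 0 M), ?_, ?_⟩
  · refine IsCompact.totallyBounded (IsCompact.image (isCompact_univ_pi fun _ =>
      isCompact_closedBall _ _) ?_)
    fun_prop
  · rintro _ ⟨i, rfl⟩
    have hfi := (hf i).indicator (measurableSet_collar n r).compl
    obtain ⟨c, hc, hcs⟩ := hs _ hfi fun w hw =>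
      Set.indicator_of_notMem (Set.notMem_compl_iff.mpr (mem_collar.mpr hw)) _
    have hle : ‖hfi.toLp _‖ ≤ M := by
      refine le_trans ?_ (hM i)
      rw [norm_toLp_def, norm_toLp_def]
      exact ENNReal.toReal_mono (hf i).2.ne (eLpNorm_indicator_le _)
    refine ⟨_, ⟨c, fun a _ => mem_closedBall_zero_iff.mpr ((hc a).trans hle), rfl⟩, ?_⟩
    have h1 := norm_bergmanProj_sub_indicator_le (hf i) (by positivity) (htail i)
    rw [dist_eq_norm]
    have h2 := norm_add_le (bergmanProj n d p α ((hf i).toLp (f i)) -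
      bergmanProj n d p α (hfi.toLp _)) (bergmanProj n d p α (hfi.toLp _) -
        ∑ a ∈ s, kernVec a (c a))
    rw [sub_add_sub_cancel] at h2
    have h3 : A * (ε / (2 * (A + 1))) ≤ ε / 2 := by
      rw [mul_div_assoc', div_le_iff₀ (by positivity)]; nlinarith
    have h4 : ε / (2 * (|M| + 1)) * ‖hfi.toLp _‖ ≤ ε / 2 := by
      rw [div_mul_eq_mul_div, div_le_iff₀ (by positivity)]
      nlinarith [le_abs_self M]
    refine h2.trans ?_
    linarith

lemma dense_span_kernVec :
    Dense (Submodule.span ℂ {f : Bergman n d p α | ∃ a v, f = kernVec a v} :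
      Set (Bergman n d p α)) := by
  intro f
  refine Metric.mem_closure_iff.mpr fun ε hε => ?_
  set A := ‖bergmanProj n d p α‖ with hA
  have hA0 : 0 ≤ A := norm_nonneg _
  obtain ⟨r, hr, htail⟩ := MemLp.exists_collar_le f.memLp (ε := ε / (2 * (A + 1)) / 2)
    (by positivity)
  obtain ⟨s, hs⟩ := exists_finite_rank_approx (n := n) (d := d) (p := p) (α := α) hr
    (ε := ε / (2 * (‖f‖ + 1))) (by positivity)
  have hfi := f.memLp.indicator (measurableSet_collar n r).compl
  obtain ⟨c, hc, hcs⟩ := hs _ hfi fun w hw =>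
    Set.indicator_of_notMem (Set.notMem_compl_iff.mpr (mem_collar.mpr hw)) _
  refine ⟨∑ a ∈ s, kernVec a (c a), Submodule.sum_mem _ fun a _ =>
    Submodule.subset_span ⟨a, c a, rfl⟩, ?_⟩
  have hle : ‖hfi.toLp _‖ ≤ ‖f‖ := by
    rw [norm_toLp_def, Bergman.norm_def]
    exact ENNReal.toReal_mono f.memLp.2.ne (eLpNorm_indicator_le _)
  have h1 := norm_bergmanProj_sub_indicator_le f.memLp (by positivity) htail
  have h0 : bergmanProj n d p α (f.memLp.toLp f) = f := bergmanProj_bergmanToLp f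
  rw [h0] at h1
  have h2 := norm_add_le (f - bergmanProj n d p α (hfi.toLp _)) (bergmanProj n d p α (hfi.toLp _) -
        ∑ a ∈ s, kernVec a (c a))
  rw [sub_add_sub_cancel] at h2
  have h3 : A * (ε / (2 * (A + 1)) / 2) ≤ ε / 2 / 2 := by
    rw [div_div, mul_div_assoc', div_div, div_le_div_iff₀ (by positivity) (by positivity)]; nlinarith
  have h4 : ε / (2 * (‖f‖ + 1)) * ‖hfi.toLp _‖ ≤ ε / 2 := by
    rw [div_mul_eq_mul_div, div_le_iff₀ (by positivity)]
    nlinarith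
  rw [dist_eq_norm]
  refine h2.trans_lt ?_
  linarith

end BergmanBall
end

noncomputable section

namespace BergmanBall

/-! ### The orbits `z ↦ S_z f` are totally bounded -/

set_option linter.unusedSectionVars false

variable {n d : ℕ}

local notation "𝔼" => EuclideanSpace ℂ (Fin n)

/-- The mass of `|1 - z̄ w|^{-m}` near the sphere is small, uniformly in `z`, for `m < n + 1 + α`. -/
lemma lintegral_collar_rpow_le (n : ℕ) {α : ℝ} [hα : Fact (-1 < α)] {m : ℝ}
    (hm : m < (n : ℝ) + 1 + α) :
    ∃ C : ℝ≥0∞, C ≠ ∞ ∧ ∃ θ : ℝ, 0 < θ ∧ ∀ z : Ball n,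
      ∫⁻ w : Ball n, ENNReal.ofReal (‖1 - inner ℂ (z : EuclideanSpace ℂ (Fin n))
        (w : EuclideanSpace ℂ (Fin n))‖ ^ (-m)) ∂(vMeasure n α) ≤ C ∧
      ∀ r, 0 ≤ r → r < 1 → ∫⁻ w in collar n r, ENNReal.ofReal
        (‖1 - inner ℂ (z : EuclideanSpace ℂ (Fin n)) (w : EuclideanSpace ℂ (Fin n))‖ ^ (-m))
          ∂(vMeasure n α) ≤ ENNReal.ofReal ((1 - r ^ 2) ^ θ) * C := by
  have hα' := hα.out
  have hγ := exponent_pos n hα'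
  set m' := max m 0 with hm'
  have hm'γ : m' < (n : ℝ) + 1 + α := max_lt hm hγ
  have hmm : m ≤ m' := le_max_left _ _
  -- A positive `θ` with `m' + θ < n + 1 + α` leaves room for the weight `(1 - |w|²)^{-θ}`, and
  -- `1 ≤ ((1 - r²) / (1 - |w|²))^θ` on the collar.
  obtain ⟨θ, hθ, hθ2⟩ := exists_between (lt_min (sub_pos.mpr hm'γ) (by linarith : 0 < 1 + α))
  obtain ⟨C, hC, h⟩ := lintegral_weight_rpow_le (n := n) (α := α) (ε := θ) (m := m')
    (hθ2.trans_le (min_le_right _ _)) (le_max_right _ _)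
    (by linarith [hθ2.trans_le (min_le_left _ _)])
  set A : ℝ := 2 ^ (m' - m) with hA
  have hA0 : 0 < A := by positivity
  have hb : ∀ z w : Ball n, ‖1 - inner ℂ (z : EuclideanSpace ℂ (Fin n))
      (w : EuclideanSpace ℂ (Fin n))‖ ^ (-m) ≤ A * ‖1 - inner ℂ (z : EuclideanSpace ℂ (Fin n))
      (w : EuclideanSpace ℂ (Fin n))‖ ^ (-m') := by
    intro z w
    have hD := norm_one_sub_inner_pos z w
    have h2 := norm_one_sub_inner_lt_two z.norm_lt.le w.norm_lt
    rw [show -m = (m' - m) + -m' by ring, Real.rpow_add hD]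
    gcongr
    exact Real.rpow_le_rpow hD.le h2.le (sub_nonneg.mpr hmm)
  have hmeas : ∀ z : Ball n, Measurable fun w : Ball n =>
      ENNReal.ofReal ((1 - ‖(w : EuclideanSpace ℂ (Fin n))‖ ^ 2) ^ (-θ)) *
        ENNReal.ofReal (‖1 - inner ℂ (z : EuclideanSpace ℂ (Fin n))
          (w : EuclideanSpace ℂ (Fin n))‖ ^ (-m')) := fun z => by fun_prop
  refine ⟨ENNReal.ofReal A * C, ENNReal.mul_ne_top ENNReal.ofReal_ne_top hC, θ, hθ, fun z =>
    ⟨?_, fun r hr0 hr => ?_⟩⟩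
  · refine le_trans ?_ (mul_le_mul_right (h z) (ENNReal.ofReal A))
    rw [← lintegral_const_mul _ (hmeas z)]
    refine lintegral_mono fun w => ?_
    have hw := w.one_sub_norm_sq_pos
    have h1 : 1 ≤ (1 - ‖(w : EuclideanSpace ℂ (Fin n))‖ ^ 2) ^ (-θ) :=
      Real.one_le_rpow_of_pos_of_le_one_of_nonpos hw
        (by linarith [sq_nonneg ‖(w : EuclideanSpace ℂ (Fin n))‖]) (by linarith)
    rw [← ENNReal.ofReal_mul (by positivity), ← ENNReal.ofReal_mul (by positivity)]
    refine ENNReal.ofReal_le_ofReal ((hb z w).trans ?_)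
    gcongr
    exact le_mul_of_one_le_left (by positivity) h1
  · have hr1 : 0 < 1 - r ^ 2 := by nlinarith
    rw [← mul_assoc]
    refine le_trans ?_ (mul_le_mul_right (h z) _)
    rw [← lintegral_const_mul _ (hmeas z)]
    refine le_trans ?_ (setLIntegral_le_lintegral (collar n r) _)
    refine setLIntegral_mono' (measurableSet_collar n r) fun w hw => ?_
    rw [mem_collar] at hw
    have hw1 := w.one_sub_norm_sq_pos
    have h1 : 1 ≤ (1 - r ^ 2) ^ θ * (1 - ‖(w : EuclideanSpace ℂ (Fin n))‖ ^ 2) ^ (-θ) := by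
      rw [Real.rpow_neg hw1.le, ← div_eq_mul_inv, one_le_div (by positivity)]
      exact Real.rpow_le_rpow hw1.le (by nlinarith) hθ.le
    rw [← ENNReal.ofReal_mul (by positivity), ← ENNReal.ofReal_mul (by positivity),
      ← ENNReal.ofReal_mul (by positivity)]
    refine ENNReal.ofReal_le_ofReal ((hb z w).trans ?_)
    have h3 : 0 ≤ A * ‖1 - inner ℂ (z : EuclideanSpace ℂ (Fin n))
      (w : EuclideanSpace ℂ (Fin n))‖ ^ (-m') := by positivity
    calc _ ≤ ((1 - r ^ 2) ^ θ * (1 - ‖(w : EuclideanSpace ℂ (Fin n))‖ ^ 2) ^ (-θ)) *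
          (A * ‖1 - inner ℂ (z : EuclideanSpace ℂ (Fin n))
            (w : EuclideanSpace ℂ (Fin n))‖ ^ (-m')) := le_mul_of_one_le_left h3 h1
      _ = _ := by ring

variable {p q : ℝ≥0∞} [Fact (1 ≤ p)] [Fact (1 ≤ q)] [hp : Fact (1 < p)] [hpt : Fact (p < ∞)]
  [hq : Fact (1 < q)] [hqt : Fact (q < ∞)] [hpq : p.HolderConjugate q]
  {α : ℝ} [hα : Fact (-1 < α)]

lemma eLpNorm_collar_rpow_le (n : ℕ) (α : ℝ) [Fact (-1 < α)] {s : ℝ}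
    (hs : p.toReal * s < (n : ℝ) + 1 + α) :
    (∃ M : ℝ≥0∞, M ≠ ∞ ∧ ∀ z : Ball n, eLpNorm (fun w : Ball n =>
      ‖1 - inner ℂ (z : EuclideanSpace ℂ (Fin n)) (w : EuclideanSpace ℂ (Fin n))‖ ^ (-s)) p
        (vMeasure n α) ≤ M) ∧
    ∀ ε > 0, ∃ r < 1, ∀ z : Ball n, eLpNorm ((collar n r).indicator fun w : Ball n =>
      ‖1 - inner ℂ (z : EuclideanSpace ℂ (Fin n)) (w : EuclideanSpace ℂ (Fin n))‖ ^ (-s)) p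
        (vMeasure n α) ≤ ENNReal.ofReal ε := by
  have hpos : 0 < p.toReal := toReal_pos
  obtain ⟨C, hC, θ, hθ, h⟩ := lintegral_collar_rpow_le n hs
  have hpw : ∀ z w : Ball n, ‖‖1 - inner ℂ (z : EuclideanSpace ℂ (Fin n))
      (w : EuclideanSpace ℂ (Fin n))‖ ^ (-s)‖ₑ ^ p.toReal = ENNReal.ofReal
        (‖1 - inner ℂ (z : EuclideanSpace ℂ (Fin n)) (w : EuclideanSpace ℂ (Fin n))‖ ^
          (-(p.toReal * s))) := by
    intro z w
    have hD := norm_one_sub_inner_pos z w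
    rw [← ofReal_norm, ENNReal.ofReal_rpow_of_nonneg (norm_nonneg _) hpos.le,
      Real.norm_of_nonneg (by positivity), ← Real.rpow_mul hD.le]
    congr 2
    ring
  constructor
  · refine ⟨C ^ (1 / p.toReal), ENNReal.rpow_ne_top_of_nonneg (by positivity) hC, fun z => ?_⟩
    rw [eLpNorm_eq_lintegral_rpow_enorm_toReal ne_zero_exponent hpt.out.ne]
    simp only [hpw]
    exact ENNReal.rpow_le_rpow (h z).1 (by positivity)
  · intro ε hε
    have hlim : Tendsto (fun r : ℝ => ENNReal.ofReal ((1 - r ^ 2) ^ θ) * C) (𝓝[<] 1) (𝓝 0) := by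
      have h1 : Tendsto (fun r : ℝ => (1 - r ^ 2) ^ θ) (𝓝[<] 1) (𝓝 0) := by
        have h2 : ContinuousAt (fun r : ℝ => (1 - r ^ 2) ^ θ) 1 :=
          ContinuousAt.rpow_const (by fun_prop) (Or.inr hθ.le)
        have h3 := h2.tendsto.mono_left (nhdsWithin_le_nhds (s := Set.Iio 1))
        simpa [Real.zero_rpow hθ.ne'] using h3
      have := ENNReal.Tendsto.mul_const (b := C) (ENNReal.tendsto_ofReal h1) (Or.inr hC)
      simpa using this
    have hε' : 0 < ENNReal.ofReal ε ^ p.toReal :=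
      ENNReal.rpow_pos (ENNReal.ofReal_pos.mpr hε) ENNReal.ofReal_ne_top
    obtain ⟨r, hr, hr1, hr0⟩ := ((hlim.eventually_lt_const hε').and
      ((eventually_mem_nhdsWithin (s := Set.Iio (1 : ℝ)) (a := 1)).and
        (mem_nhdsWithin_of_mem_nhds (Ioi_mem_nhds (zero_lt_one' ℝ))))).exists
    refine ⟨r, hr1, fun z => ?_⟩
    rw [eLpNorm_indicator_eq_eLpNorm_restrict (measurableSet_collar n r),
      eLpNorm_eq_lintegral_rpow_enorm_toReal ne_zero_exponent hpt.out.ne]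
    simp only [hpw]
    rw [one_div, ENNReal.rpow_inv_le_iff hpos]
    exact ((h z).2 r (le_of_lt hr0) hr1).trans hr.le

/-- If `f_z` is dominated by a family with uniformly small mass near the sphere, then its
projections form a totally bounded set. -/
lemma totallyBounded_of_dominated {ι : Type*} {f : ι → Ball n → Vec d p}
    (hf : ∀ i, MemLp (f i) p (vMeasure n α)) {g : ι → Ball n → ℝ} {C : ℝ} (hC : 0 ≤ C)
    (hfg : ∀ i, ∀ᵐ w ∂(vMeasure n α), ‖f i w‖ ≤ C * ‖g i w‖)
    (hg : ∃ M : ℝ≥0∞, M ≠ ∞ ∧ ∀ i, eLpNorm (g i) p (vMeasure n α) ≤ M)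
    (hgt : ∀ ε > 0, ∃ r < 1, ∀ i, eLpNorm ((collar n r).indicator (g i)) p (vMeasure n α) ≤
      ENNReal.ofReal ε) :
    TotallyBounded (Set.range fun i => bergmanProj n d p α ((hf i).toLp (f i))) := by
  obtain ⟨M, hM, hgM⟩ := hg
  refine totallyBounded_range_bergmanProj hf (M := (ENNReal.ofReal C * M).toReal) (fun i => ?_)
    fun ε hε => ?_
  · rw [norm_toLp_def]
    refine ENNReal.toReal_mono (ENNReal.mul_ne_top ENNReal.ofReal_ne_top hM) ?_
    exact (eLpNorm_le_mul_eLpNorm_of_ae_le_mul (hfg i) p).trans (mul_le_mul_right (hgM i) _)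
  · obtain ⟨r, hr, h⟩ := hgt (ε / (C + 1)) (by positivity)
    refine ⟨r, hr, fun i => ?_⟩
    have hle : ∀ᵐ w ∂(vMeasure n α), ‖(collar n r).indicator (f i) w‖ ≤
        C * ‖(collar n r).indicator (g i) w‖ := by
      filter_upwards [hfg i] with w hw
      by_cases h : w ∈ collar n r
      · rwa [Set.indicator_of_mem h, Set.indicator_of_mem h]
      · rw [Set.indicator_of_notMem h, Set.indicator_of_notMem h, norm_zero, norm_zero, mul_zero]
    refine (eLpNorm_le_mul_eLpNorm_of_ae_le_mul hle p).trans ((mul_le_mul_right (h i) _).trans ?_)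
    rw [← ENNReal.ofReal_mul hC]
    refine ENNReal.ofReal_le_ofReal ?_
    rw [mul_div_assoc', div_le_iff₀ (by positivity)]
    nlinarith

lemma orbitTotallyBounded_toeplitz {φ : Ball n → Matrix (Fin d) (Fin d) ℂ}
    (hφ : IsBddSymbol α φ) : OrbitTotallyBounded fun z : Ball n =>
      (toeplitz (isBddSymbol_conjSymbol (p := p) (q := q) hφ z) :
        Bergman n d p α →L[ℂ] Bergman n d p α) := by
  obtain ⟨M, hM, h⟩ := hφ.exists_bound (p := p)
  refine ⟨⟨‖bergmanProj n d p α‖ * M, by positivity, fun z f =>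
    norm_toeplitz_apply_le _ (h.conjSymbol z) f⟩, fun f => ?_⟩
  have hfm : MemLp (fun w => ‖f w‖) p (vMeasure n α) := f.memLp.norm
  refine totallyBounded_of_dominated (g := fun _ w => ‖f w‖) (fun z =>
    (isBddSymbol_conjSymbol hφ z).memLp f.memLp) hM (fun z => ?_)
    ⟨_, hfm.2.ne, fun _ => le_rfl⟩ fun ε hε => ?_
  · filter_upwards [h.conjSymbol (q := q) z] with w hw
    rw [norm_norm]
    exact hw (f w)
  · obtain ⟨r, hr, h⟩ := MemLp.exists_collar_le f.memLp hε
    refine ⟨r, hr, fun _ => ?_⟩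
    refine le_trans (le_of_eq ?_) h
    rw [← eLpNorm_norm ((collar n r).indicator f)]
    congr 1
    funext w
    exact (norm_indicator_eq_indicator_norm f w).symm

/-- The function `w ↦ (1 - z̄ w)^s f(w)`. -/
def powMul {n d : ℕ} {p : ℝ≥0∞} [Fact (1 ≤ p)] {α : ℝ} (z : Ball n) (s : ℝ)
    (f : Bergman n d p α) : Bergman n d p α :=
  ⟨fun w => (1 - inner ℂ (z : EuclideanSpace ℂ (Fin n))
      (w : EuclideanSpace ℂ (Fin n))) ^ (s : ℂ) • f w,
    (isHolomorphic_cpow z.norm_lt.le _).smul f.isHolomorphic, by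
      have hz := z.norm_lt
      obtain ⟨C, hC⟩ : ∃ C : ℝ, ∀ w : Ball n, ‖1 - inner ℂ (z : EuclideanSpace ℂ (Fin n))
          (w : EuclideanSpace ℂ (Fin n))‖ ^ s ≤ C := by
        rcases le_total 0 s with hs | hs
        · exact ⟨2 ^ s, fun w => Real.rpow_le_rpow (norm_nonneg _)
            (norm_one_sub_inner_lt_two z.norm_lt.le w.norm_lt).le hs⟩
        · refine ⟨(1 - ‖(z : EuclideanSpace ℂ (Fin n))‖) ^ s, fun w => ?_⟩
          refine Real.rpow_le_rpow_of_nonpos (by linarith) ?_ hs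
          rw [norm_one_sub_inner_comm]
          exact one_sub_norm_le_norm_one_sub_inner w.norm_lt.le
      refine f.memLp.of_le_mul (c := C) ((isHolomorphic_cpow z.norm_lt.le
        _).smul f.isHolomorphic).continuous.aestronglyMeasurable (ae_of_all _ fun w => ?_)
      rw [norm_smul, Complex.norm_cpow_real]
      exact mul_le_mul_of_nonneg_right (hC w) (norm_nonneg _)⟩

lemma powMul_apply (z : Ball n) (s : ℝ) (f : Bergman n d p α) (w : Ball n) :
    powMul z s f w = (1 - inner ℂ (z : 𝔼) (w : 𝔼)) ^ (s : ℂ) • f w := rfl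

/-- The exponent `(n + 1 + α) (1/q - 1/p)`, for which `b_z = (conj D / D)^s` with
`D(w) = 1 - z̄ w`. -/
def phaseExp (n : ℕ) (p q : ℝ≥0∞) (α : ℝ) : ℝ :=
  ((n : ℝ) + 1 + α) / q.toReal - ((n : ℝ) + 1 + α) / p.toReal

lemma unimod_mul_cpow (z w : Ball n) :
    unimod p q α z w * (1 - inner ℂ (z : 𝔼) (w : 𝔼)) ^ (phaseExp n p q α : ℂ) =
      (starRingEnd ℂ) ((1 - inner ℂ (z : 𝔼) (w : 𝔼)) ^ (phaseExp n p q α : ℂ)) := by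
  have hz := z.one_sub_norm_sq_pos
  have hD := norm_one_sub_inner_pos z w
  have hne := one_sub_inner_ne_zero z w
  have hpq' := (toReal_holderConjugate p q).inv_add_inv_eq_one
  have hcs := conj_one_sub_inner_cpow (z := (z : 𝔼)) z.norm_lt.le w.norm_lt
  have hne' := one_sub_inner_ne_zero w z
  set γ : ℝ := (n : ℝ) + 1 + α with hγ
  have e1 : (2 * γ / p.toReal : ℝ) + phaseExp n p q α = γ := by
    rw [phaseExp, ← hγ]; linear_combination γ * hpq'
  have e2 : (2 * γ / q.toReal : ℝ) = phaseExp n p q α + γ := by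
    rw [phaseExp, ← hγ]; linear_combination γ * hpq'
  have e3 : γ / p.toReal + γ / q.toReal = γ := by linear_combination γ * hpq'
  have hmain := mul_conj_cpow (1 - inner ℂ (z : 𝔼) (w : 𝔼)) γ
  rw [hcs] at hmain ⊢
  rw [unimod, wt, wt, map_div₀, Complex.conj_ofReal, hcs, autDensity, ← hγ,
    Real.div_rpow hz.le (by positivity), e2, Complex.ofReal_add, Complex.cpow_add _ _ hne']
  have e1' := congrArg (fun x : ℝ => (1 - inner ℂ (z : 𝔼) (w : 𝔼)) ^ (x : ℂ)) e1
  simp only [Complex.ofReal_add] at e1'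
  rw [Complex.cpow_add _ _ hne] at e1'
  have e3' := Real.rpow_add hz (γ / p.toReal) (γ / q.toReal)
  rw [e3] at e3'
  rw [e3', Complex.ofReal_div, ← hmain, ← e1']
  have h1 : (((1 - ‖(z : 𝔼)‖ ^ 2) ^ (γ / p.toReal) : ℝ) : ℂ) ≠ 0 := by
    exact_mod_cast (Real.rpow_pos_of_pos hz _).ne'
  have h2 : (((1 - ‖(z : 𝔼)‖ ^ 2) ^ (γ / q.toReal) : ℝ) : ℂ) ≠ 0 := by
    exact_mod_cast (Real.rpow_pos_of_pos hz _).ne'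
  have h3 := one_sub_inner_cpow_ne_zero z w ((2 * γ / p.toReal : ℝ) : ℂ)
  have h4 := one_sub_inner_cpow_ne_zero z w (phaseExp n p q α : ℂ)
  have h5 := one_sub_inner_cpow_ne_zero w z (γ : ℂ)
  have h6 := one_sub_inner_cpow_ne_zero w z (phaseExp n p q α : ℂ)
  rw [Complex.ofReal_mul]
  generalize (((1 - ‖(z : 𝔼)‖ ^ 2) ^ (γ / p.toReal) : ℝ) : ℂ) = x1 at *
  generalize (((1 - ‖(z : 𝔼)‖ ^ 2) ^ (γ / q.toReal) : ℝ) : ℂ) = x2 at *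
  generalize (1 - inner ℂ (z : 𝔼) (w : 𝔼)) ^ ((2 * γ / p.toReal : ℝ) : ℂ) = x3 at *
  generalize (1 - inner ℂ (z : 𝔼) (w : 𝔼)) ^ (phaseExp n p q α : ℂ) = x4 at *
  generalize (1 - inner ℂ (w : 𝔼) (z : 𝔼)) ^ (γ : ℂ) = x5 at *
  generalize (1 - inner ℂ (w : 𝔼) (z : 𝔼)) ^ (phaseExp n p q α : ℂ) = x6 at *
  field_simp

/-- The solution `h` of `T_{b_z} h = K_a v`. -/
def kernPreimage {n d : ℕ} {p : ℝ≥0∞} (q : ℝ≥0∞) [Fact (1 ≤ p)] {α : ℝ} [Fact (-1 < α)]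
    (z a : Ball n) (v : Vec d p) : Bergman n d p α :=
  (starRingEnd ℂ) ((1 - inner ℂ (z : EuclideanSpace ℂ (Fin n))
    (a : EuclideanSpace ℂ (Fin n))) ^ ((-phaseExp n p q α : ℝ) : ℂ)) •
      powMul z (phaseExp n p q α) (kernVec a v)

/-- The inverse of `T_{b_z}` on kernel functions can be computed explicitly, because the phase
`b_z` is the quotient of a conjugate holomorphic function and its conjugate. -/
lemma unimodToeplitz_kernPreimage (z a : Ball n) (v : Vec d p) :
    unimodToeplitz d p q α z (kernPreimage q z a v) = kernVec a v := by
  refine Bergman.ext_pairing (q := q) fun g => ?_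
  set s := phaseExp n p q α with hs
  set c : ℂ := (1 - inner ℂ (z : 𝔼) (a : 𝔼)) ^ ((-s : ℝ) : ℂ) with hc
  have h1 : pairing (unimodToeplitz d p q α z (kernPreimage q z a v)) g =
      pairing (kernVec a v : Bergman n d p α) (c • powMul z s g) := by
    rw [pairing_unimodToeplitz, pairing_eq_integral_dot]
    refine integral_congr_ae (ae_of_all _ fun w => ?_)
    have hu := unimod_mul_cpow (p := p) (q := q) (α := α) z w
    rw [← hs] at hu
    simp only [kernPreimage, ← hs, ← hc, Bergman.smul_apply, powMul_apply, dot_smul_left,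
      dot_smul_right]
    rw [← hu]
    ring
  have h2 : (c • powMul z s g : Bergman n d q α) a = g a := by
    rw [Bergman.smul_apply, powMul_apply, smul_smul, hc, Complex.ofReal_neg, Complex.cpow_neg,
      inv_mul_cancel₀ (one_sub_inner_cpow_ne_zero z a _), one_smul]
  rw [h1, pairing_kernVec_left, pairing_kernVec_left, h2]

/-- The family `T_{b_z}^{-1} = U_z^{(p,α)} (U_z^{(q,α)})^*` is totally bounded on orbits. -/
lemma orbitTotallyBounded_U_adj_U : OrbitTotallyBounded fun z : Ball n =>
    U d p α z ∘L adj p (U d q α z) := by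
  refine OrbitTotallyBounded.of_span_dense dense_span_kernVec
    ⟨‖bergmanProj n d p α‖, norm_nonneg _, fun z f => ?_⟩ ?_
  · rw [ContinuousLinearMap.comp_apply, norm_U_apply]
    exact norm_adj_U_apply_le q z f
  · rintro _ ⟨a, v, rfl⟩
    have h : ∀ z : Ball n, (U d p α z ∘L adj p (U d q α z)) (kernVec a v) =
        bergmanProj n d p α ((kernPreimage q z a v : Bergman n d p α).memLp.toLp _) := fun z => by
      rw [ContinuousLinearMap.comp_apply, ← unimodToeplitz_kernPreimage (q := q) z a v,
        U_adj_U_unimodToeplitz]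
      exact (bergmanProj_bergmanToLp _).symm
    simp only [h]
    set s := phaseExp n p q α with hs
    have hγ := exponent_pos n hα.out
    have ha : 0 < 1 - ‖(a : 𝔼)‖ := by linarith [a.norm_lt]
    -- The vectors are dominated by `|1 - z̄ w|^s`, whose `p`-th power is uniformly integrable
    -- because `-p s = (n + 1 + α) (2 - p) < n + 1 + α`; here `p > 1` is used.
    have hps : p.toReal * (-s) < (n : ℝ) + 1 + α := by
      have hpq' := (toReal_holderConjugate p q).inv_add_inv_eq_one
      have hp0 : 0 < p.toReal := toReal_pos
      have hp1 : 1 < p.toReal := one_lt_toReal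
      have : p.toReal * (-s) = ((n : ℝ) + 1 + α) * (2 - p.toReal) := by
        have hqi : q.toReal⁻¹ = 1 - p.toReal⁻¹ := by linarith
        rw [hs, phaseExp, div_eq_mul_inv, div_eq_mul_inv, hqi]
        field_simp
        ring
      rw [this]
      nlinarith
    obtain ⟨hb, ht⟩ := eLpNorm_collar_rpow_le (p := p) n α hps
    refine totallyBounded_of_dominated (C := ((1 - ‖(a : 𝔼)‖) ^ (-|s|) * 2 ^ |s|) *
      (((1 - ‖(a : 𝔼)‖) ^ ((n : ℝ) + 1 + α))⁻¹ * ‖v‖)) _ (by positivity)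
      (fun z => ae_of_all _ fun w => ?_) hb ht
    have hza : ‖1 - inner ℂ (z : 𝔼) (a : 𝔼)‖ ^ (-s) ≤ (1 - ‖(a : 𝔼)‖) ^ (-|s|) * 2 ^ |s| := by
      have hD := one_sub_norm_le_norm_one_sub_inner (z := (z : 𝔼)) (w := (a : 𝔼)) z.norm_lt.le
      have hD2 := (norm_one_sub_inner_lt_two (z := (z : 𝔼)) z.norm_lt.le a.norm_lt).le
      have hD0 := norm_one_sub_inner_pos z a
      rcases le_total 0 s with h0 | h0
      · rw [abs_of_nonneg h0]
        refine (Real.rpow_le_rpow_of_nonpos ha hD (by linarith)).trans ?_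
        exact le_mul_of_one_le_right (by positivity) (Real.one_le_rpow one_le_two h0)
      · rw [abs_of_nonpos h0]
        refine (Real.rpow_le_rpow hD0.le hD2 (by linarith)).trans ?_
        refine le_mul_of_one_le_left (by positivity) ?_
        refine Real.one_le_rpow_of_pos_of_le_one_of_nonpos ha ?_ (by linarith)
        linarith [norm_nonneg (a : 𝔼)]
    have hk : ‖kern α (a : 𝔼) w‖ ≤ ((1 - ‖(a : 𝔼)‖) ^ ((n : ℝ) + 1 + α))⁻¹ := by
      rw [norm_kern_comm]
      exact norm_kern_le hα.out w.norm_lt.le a.norm_lt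
    rw [kernPreimage, ← hs, Bergman.smul_apply, powMul_apply, kernVec_apply, norm_smul, norm_smul,
      norm_smul, Complex.norm_conj, Complex.norm_cpow_real, Complex.norm_cpow_real, neg_neg,
      Real.norm_of_nonneg (Real.rpow_nonneg (norm_nonneg _) _)]
    calc _ ≤ ((1 - ‖(a : 𝔼)‖) ^ (-|s|) * 2 ^ |s|) * (‖1 - inner ℂ (z : 𝔼) (w : 𝔼)‖ ^ s *
          (((1 - ‖(a : 𝔼)‖) ^ ((n : ℝ) + 1 + α))⁻¹ * ‖v‖)) := by gcongr
      _ = _ := by ring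

lemma adj_U_comp_U (z : Ball n) (f : Bergman n d p α) :
    adj p (U d q α z) (U d p α z f) = unimodToeplitz d p q α z f := by
  rw [adj_U, ContinuousLinearMap.comp_apply, U_U]

lemma conj_apply (S : Bergman n d p α →L[ℂ] Bergman n d p α) (z : Ball n)
    (f : Bergman n d p α) : conj q S z f = U d p α z (S (adj p (U d q α z) f)) := rfl

variable (q) in
lemma norm_conj_apply_le (S : Bergman n d p α →L[ℂ] Bergman n d p α) (z : Ball n)
    (f : Bergman n d p α) : ‖conj q S z f‖ ≤ ‖S‖ * ‖bergmanProj n d p α‖ * ‖f‖ := by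
  rw [conj_apply, norm_U_apply, mul_assoc]
  refine (S.le_opNorm _).trans ?_
  gcongr
  exact norm_adj_U_apply_le q z f

/-- The decomposition `(T_φ)_z = T_{b_z}^{-1} T_{b_z (φ ∘ φ_z)} T_{b_z}^{-1}`. -/
lemma conj_toeplitz {φ : Ball n → Matrix (Fin d) (Fin d) ℂ} (hφ : IsBddSymbol α φ) (z : Ball n) :
    conj q (toeplitz hφ : Bergman n d p α →L[ℂ] Bergman n d p α) z =
      (U d p α z ∘L adj p (U d q α z)) ∘L
        (toeplitz (isBddSymbol_conjSymbol (p := p) (q := q) hφ z) ∘L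
          (U d p α z ∘L adj p (U d q α z))) := by
  ext1 f
  simp only [ContinuousLinearMap.comp_apply, conj_apply]
  rw [← adj_U_toeplitz_U, adj_U_adj_U, U_U]

/-- The orbits `{S_z f}` of the operators of the Toeplitz algebra are totally bounded. -/
lemma orbitTotallyBounded_conj {S : Bergman n d p α →L[ℂ] Bergman n d p α}
    (hS : S ∈ toeplitzAlgebra n d p α) : OrbitTotallyBounded fun z => conj q S z := by
  have hadj : ∀ A ∈ Algebra.adjoin ℂ {T : Bergman n d p α →L[ℂ] Bergman n d p α |
      ∃ φ, IsBddSymbol α φ ∧ IsToeplitz φ T}, OrbitTotallyBounded fun z => conj q A z := by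
    intro A hA
    induction hA using Algebra.adjoin_induction with
    | mem T hT =>
      obtain ⟨φ, hφ, hT⟩ := hT
      rw [hT.eq_toeplitz hφ]
      simp only [conj_toeplitz]
      exact orbitTotallyBounded_U_adj_U.comp
        ((orbitTotallyBounded_toeplitz hφ).comp orbitTotallyBounded_U_adj_U)
    | algebraMap c =>
      have : (fun z => conj q (algebraMap ℂ (Bergman n d p α →L[ℂ] Bergman n d p α) c) z) =
          fun z => (c • ContinuousLinearMap.id ℂ (Bergman n d p α)) ∘L
            (U d p α z ∘L adj p (U d q α z)) := by
        funext z
        ext1 f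
        rw [conj_apply, Algebra.algebraMap_eq_smul_one]
        exact map_smul (U d p α z) c (adj p (U d q α z) f)
      rw [this]
      exact (orbitTotallyBounded_const _).comp orbitTotallyBounded_U_adj_U
    | add A B _ _ hA hB =>
      have : (fun z => conj q (A + B) z) = fun z => conj q A z + conj q B z := by
        funext z
        ext1 f
        exact map_add (U d p α z) (A (adj p (U d q α z) f)) (B (adj p (U d q α z) f))
      rw [this]
      exact hA.add hB
    | mul A B _ _ hA hB =>
      have : (fun z => conj q (A * B) z) = fun z => conj q A z ∘L
          (unimodToeplitz d p q α z ∘L conj q B z) := by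
        funext z
        ext1 f
        simp only [ContinuousLinearMap.comp_apply, conj_apply]
        rw [← adj_U_comp_U, U_U, adj_U_adj_U]
        rfl
      rw [this]
      exact hA.comp ((orbitTotallyBounded_toeplitz isBddSymbol_one).comp hB)
  refine OrbitTotallyBounded.of_approx fun ε hε => ?_
  have hcl : S ∈ closure (Algebra.adjoin ℂ {T : Bergman n d p α →L[ℂ] Bergman n d p α |
      ∃ φ, IsBddSymbol α φ ∧ IsToeplitz φ T} : Set _) := hS
  obtain ⟨A, hA, hSA⟩ := Metric.mem_closure_iff.mp hcl (ε / (‖bergmanProj n d p α‖ + 1))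
    (by positivity)
  refine ⟨_, hadj A hA, fun z f => ?_⟩
  have : conj q S z f - conj q A z f = conj q (S - A) z f := by
    rw [conj_apply, conj_apply, conj_apply, ← map_sub]
    rfl
  rw [this]
  refine (norm_conj_apply_le q _ z f).trans ?_
  rw [dist_eq_norm, lt_div_iff₀ (by positivity)] at hSA
  gcongr
  nlinarith [norm_nonneg (S - A)]

end BergmanBall
end

noncomputable section

namespace BergmanBall

/-! ### Uniform continuity with respect to the pseudohyperbolic metric -/

set_option linter.unusedSectionVars false

variable {n d : ℕ}

local notation "𝔼" => EuclideanSpace ℂ (Fin n)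

lemma one_sub_inner_aut (z a y : Ball n) :
    1 - inner ℂ (aut z a : 𝔼) (y : 𝔼) =
      (1 - inner ℂ (a : 𝔼) (aut z y : 𝔼)) * (1 - inner ℂ (z : 𝔼) (y : 𝔼)) /
        (1 - inner ℂ (a : 𝔼) (z : 𝔼)) := by
  have h := one_sub_inner_autFun z.norm_lt a.norm_lt (aut z y).norm_lt
  have h2 := inner_autFun_left z.norm_lt y.norm_lt
  have h3 : autFun (z : 𝔼) (aut z y : 𝔼) = y := congrArg Subtype.val (aut_aut z y)
  have hs : (defect (z : 𝔼) : ℂ) ≠ 0 := by exact_mod_cast (defect_pos z.norm_lt).ne'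
  have hy := one_sub_inner_ne_zero z y
  have ha := one_sub_inner_ne_zero a z
  rw [h3, coe_aut, h2] at h
  rw [coe_aut, coe_aut, h]
  field_simp

lemma norm_one_sub_inner_sub_le {z z' : Ball n} (h : rho z z' ≤ 1 / 2) (y : Ball n) :
    ‖(1 - inner ℂ (z' : 𝔼) (y : 𝔼)) - (1 - inner ℂ (z : 𝔼) (y : 𝔼))‖ ≤
      4 * rho z z' * ‖1 - inner ℂ (z : 𝔼) (y : 𝔼)‖ := by
  -- With `z' = φ_z(v)` and `y = φ_z(ζ)` the quotient of `1 - ⟨z', y⟩` and `1 - ⟨z, y⟩` is close to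
  -- `1`, as `|v| = ρ(z, z')`.
  set v := aut z z' with hv
  set ζ := aut z y with hζ
  have hρ : ‖(v : 𝔼)‖ = rho z z' := rfl
  have h0 := one_sub_inner_aut z v y
  rw [hv, aut_aut, ← hv, ← hζ] at h0
  have hvz := one_sub_inner_ne_zero v z
  have e : (1 - inner ℂ (z' : 𝔼) (y : 𝔼)) - (1 - inner ℂ (z : 𝔼) (y : 𝔼)) =
      (inner ℂ (v : 𝔼) (z : 𝔼) - inner ℂ (v : 𝔼) (ζ : 𝔼)) * (1 - inner ℂ (z : 𝔼) (y : 𝔼)) /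
        (1 - inner ℂ (v : 𝔼) (z : 𝔼)) := by
    rw [h0]
    field_simp
    ring
  have hD : 1 / 2 ≤ ‖1 - inner ℂ (v : 𝔼) (z : 𝔼)‖ := by
    rw [norm_one_sub_inner_comm]
    have := one_sub_norm_le_norm_one_sub_inner (z := (z : 𝔼)) (w := (v : 𝔼)) z.norm_lt.le
    linarith
  have hN : ‖inner ℂ (v : 𝔼) (z : 𝔼) - inner ℂ (v : 𝔼) (ζ : 𝔼)‖ ≤ 2 * rho z z' := by
    rw [← inner_sub_right]
    refine (norm_inner_le_norm _ _).trans ?_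
    rw [hρ]
    have := norm_sub_le (z : 𝔼) (ζ : 𝔼)
    nlinarith [rho_nonneg z z', z.norm_lt, ζ.norm_lt]
  rw [e, norm_div, norm_mul, div_le_iff₀ (by linarith)]
  have hL := norm_nonneg (1 - inner ℂ (z : 𝔼) (y : 𝔼))
  calc _ ≤ 2 * rho z z' * ‖1 - inner ℂ (z : 𝔼) (y : 𝔼)‖ := by gcongr
    _ = 4 * rho z z' * ‖1 - inner ℂ (z : 𝔼) (y : 𝔼)‖ * (1 / 2) := by ring
    _ ≤ _ := by
      have := rho_nonneg z z'
      gcongr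

lemma norm_one_sub_inner_self (z : Ball n) :
    ‖1 - inner ℂ (z : 𝔼) (z : 𝔼)‖ = defect (z : 𝔼) ^ 2 := by
  rw [inner_self_eq_of_norm_lt z.norm_lt, sub_sub_cancel, norm_pow, Complex.norm_real,
    Real.norm_of_nonneg (defect_nonneg _)]

lemma norm_inner_sub_le {z z' : Ball n} (h : rho z z' ≤ 1 / 2) (y : Ball n) :
    ‖inner ℂ ((z : 𝔼) - z') (y : 𝔼)‖ ≤ 4 * rho z z' * ‖1 - inner ℂ (z : 𝔼) (y : 𝔼)‖ := by
  have := norm_one_sub_inner_sub_le h y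
  rwa [sub_sub_sub_cancel_left, ← inner_sub_left] at this

lemma norm_inner_sub_right_le {z z' : Ball n} (h : rho z z' ≤ 1 / 2) :
    ‖inner ℂ ((z : 𝔼) - z') (z' : 𝔼)‖ ≤ 12 * rho z z' * defect (z : 𝔼) ^ 2 := by
  have h1 := norm_inner_sub_le h z'
  have h2 := norm_one_sub_inner_sub_le h z
  have h3 := norm_add_le ((1 - inner ℂ (z' : 𝔼) (z : 𝔼)) - (1 - inner ℂ (z : 𝔼) (z : 𝔼)))
    (1 - inner ℂ (z : 𝔼) (z : 𝔼))
  rw [sub_add_cancel, norm_one_sub_inner_comm] at h3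
  rw [norm_one_sub_inner_self] at h2 h3
  have h4 : ‖1 - inner ℂ (z : 𝔼) (z' : 𝔼)‖ ≤ 3 * defect (z : 𝔼) ^ 2 := by
    nlinarith [sq_nonneg (defect (z : 𝔼))]
  refine h1.trans ?_
  nlinarith [rho_nonneg z z']

lemma norm_sub_le_sqrt_rho {z z' : Ball n} (h : rho z z' ≤ 1 / 2) :
    ‖(z : 𝔼) - z'‖ ≤ 4 * √(rho z z') * defect (z : 𝔼) := by
  have h1 := norm_inner_sub_le h z
  have h2 := norm_inner_sub_right_le h
  rw [norm_one_sub_inner_self] at h1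
  have h3 : ‖(z : 𝔼) - z'‖ ^ 2 ≤ 16 * rho z z' * defect (z : 𝔼) ^ 2 := by
    have e : ‖(z : 𝔼) - z'‖ ^ 2 = ‖inner ℂ ((z : 𝔼) - z') ((z : 𝔼) - z')‖ := by
      rw [inner_self_eq_norm_sq_to_K, norm_pow]
      simp
    rw [e, inner_sub_right]
    refine (norm_sub_le _ _).trans ?_
    linarith
  have hs := defect_nonneg (z : 𝔼)
  refine abs_le_of_sq_le_sq' ?_ (by positivity) |>.2
  rw [mul_pow, mul_pow, Real.sq_sqrt (rho_nonneg z z')]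
  linarith

lemma abs_defect_sub_le {z z' : Ball n} (h : rho z z' ≤ 1 / 2) :
    |defect (z : 𝔼) - defect (z' : 𝔼)| ≤ 16 * rho z z' * defect (z : 𝔼) := by
  have h1 := norm_inner_sub_le h z
  have h2 := norm_inner_sub_right_le h
  rw [norm_one_sub_inner_self] at h1
  have hs := defect_pos z.norm_lt
  have hs' := defect_pos z'.norm_lt
  have e1 := defect_sq z.norm_lt
  have e2 := defect_sq z'.norm_lt
  have e3 : defect (z : 𝔼) ^ 2 - defect (z' : 𝔼) ^ 2 =
      -((inner ℂ ((z : 𝔼) - z') (z : 𝔼)).re + (inner ℂ ((z : 𝔼) - z') (z' : 𝔼)).re) := by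
    have e4 : (inner ℂ (z : 𝔼) (z : 𝔼)).re = ‖(z : 𝔼)‖ ^ 2 := (norm_sq_eq_re_inner (𝕜 := ℂ) _).symm
    have e5 : (inner ℂ (z' : 𝔼) (z' : 𝔼)).re = ‖(z' : 𝔼)‖ ^ 2 :=
      (norm_sq_eq_re_inner (𝕜 := ℂ) _).symm
    have e6 : (inner ℂ (z' : 𝔼) (z : 𝔼)).re = (inner ℂ (z : 𝔼) (z' : 𝔼)).re :=
      inner_re_symm (𝕜 := ℂ) _ _
    rw [e1, e2, inner_sub_left, inner_sub_left, Complex.sub_re, Complex.sub_re, e4, e5, e6]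
    ring
  have h5 : |defect (z : 𝔼) ^ 2 - defect (z' : 𝔼) ^ 2| ≤ 16 * rho z z' * defect (z : 𝔼) ^ 2 := by
    rw [e3, abs_neg]
    refine (abs_add_le _ _).trans ?_
    have h6 := Complex.abs_re_le_norm (inner ℂ ((z : 𝔼) - z') (z : 𝔼))
    have h7 := Complex.abs_re_le_norm (inner ℂ ((z : 𝔼) - z') (z' : 𝔼))
    linarith
  have h6 : |defect (z : 𝔼) - defect (z' : 𝔼)| * defect (z : 𝔼) ≤
      16 * rho z z' * defect (z : 𝔼) * defect (z : 𝔼) := by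
    calc _ ≤ |defect (z : 𝔼) - defect (z' : 𝔼)| * (defect (z : 𝔼) + defect (z' : 𝔼)) := by
          gcongr
          linarith
      _ = |defect (z : 𝔼) ^ 2 - defect (z' : 𝔼) ^ 2| := by
          rw [← abs_of_pos (add_pos hs hs'), ← abs_mul]
          congr 1
          ring
      _ ≤ _ := by linarith
  exact le_of_mul_le_mul_right h6 hs

lemma defect_sq_le (z y : Ball n) :
    defect (z : 𝔼) ^ 2 ≤ 2 * ‖1 - inner ℂ (z : 𝔼) (y : 𝔼)‖ := by
  rw [defect_sq z.norm_lt, norm_one_sub_inner_comm]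
  have h := one_sub_norm_le_norm_one_sub_inner (z := (y : 𝔼)) (w := (z : 𝔼)) y.norm_lt.le
  nlinarith [z.norm_lt, norm_nonneg (z : 𝔼)]

lemma norm_sub_sq_le (z y : Ball n) :
    ‖(y : 𝔼) - z‖ ^ 2 ≤ 2 * ‖1 - inner ℂ (z : 𝔼) (y : 𝔼)‖ := by
  have h := norm_sub_sq (𝕜 := ℂ) (y : 𝔼) (z : 𝔼)
  rw [inner_re_symm] at h
  have h1 := Complex.re_le_norm (1 - inner ℂ (z : 𝔼) (y : 𝔼))
  rw [Complex.sub_re, Complex.one_re] at h1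
  have hz := z.one_sub_norm_sq_pos
  have hy := y.one_sub_norm_sq_pos
  have e : RCLike.re (inner ℂ (z : 𝔼) (y : 𝔼)) = (inner ℂ (z : 𝔼) (y : 𝔼)).re := rfl
  rw [e] at h
  linarith

/-- The numerator of `1 - ⟨φ_z(a), y⟩`, written so that it is visibly comparable with
`1 - z̄ y`. -/
def autNum {n : ℕ} (z a y : EuclideanSpace ℂ (Fin n)) : ℂ :=
  (1 - inner ℂ z y) * (1 - inner ℂ a ((((1 + defect z)⁻¹ : ℝ) : ℂ) • z)) +
    (defect z : ℂ) * inner ℂ a (y - (((1 + defect z)⁻¹ : ℝ) : ℂ) • z)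

lemma one_sub_inner_aut_eq (z a y : Ball n) :
    1 - inner ℂ (aut z a : 𝔼) (y : 𝔼) = autNum (z : 𝔼) a y / (1 - inner ℂ (a : 𝔼) (z : 𝔼)) := by
  have ha := one_sub_inner_ne_zero a z
  have hs := one_add_defect_ne_zero (z : 𝔼)
  rw [eq_div_iff ha, coe_aut, autFun_eq z.norm_lt, inner_smul_left, map_inv₀, map_sub, map_one,
    inner_conj_symm, sub_mul, mul_right_comm, inv_mul_cancel₀ ha, inner_sub_left, shear_apply,
    inner_add_left, inner_smul_left, inner_smul_left, map_mul, inner_conj_symm, Complex.conj_ofReal,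
    Complex.conj_ofReal, autNum, inner_sub_right, inner_smul_right, Complex.ofReal_inv,
    Complex.ofReal_add, Complex.ofReal_one]
  field_simp
  ring

lemma le_norm_autNum (z a y : Ball n) :
    (1 - ‖(a : 𝔼)‖) * ‖1 - inner ℂ (z : 𝔼) (y : 𝔼)‖ ≤ ‖autNum (z : 𝔼) a y‖ := by
  have ha := one_sub_inner_ne_zero a z
  have h := one_sub_inner_aut_eq z a y
  rw [one_sub_inner_aut, div_left_inj' ha] at h
  rw [← h, norm_mul, norm_one_sub_inner_comm (a : 𝔼)]
  gcongr
  exact one_sub_norm_le_norm_one_sub_inner (aut z y).norm_lt.le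

lemma norm_autNum_sub_le {z z' : Ball n} (h : rho z z' ≤ 1 / 16) (a y : Ball n) :
    ‖autNum (z' : 𝔼) a y - autNum (z : 𝔼) a y‖ ≤
      100 * √(rho z z') * ‖1 - inner ℂ (z : 𝔼) (y : 𝔼)‖ := by
  have hρ := rho_nonneg z z'
  have hh : rho z z' ≤ 1 / 2 := by linarith
  have hA := norm_one_sub_inner_sub_le hh y
  have hu := norm_sub_le_sqrt_rho hh
  have ht := abs_defect_sub_le hh
  have hs2 := defect_sq_le z y
  have hyz := norm_sub_sq_le z y
  have hs := defect_pos z.norm_lt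
  have hs' := defect_pos z'.norm_lt
  have hk2 := Real.sq_sqrt hρ
  have hk0 := Real.sqrt_nonneg (rho z z')
  set k := √(rho z z') with hk
  have hk4 : k ≤ 1 / 4 := by nlinarith
  set L := ‖1 - inner ℂ (z : 𝔼) (y : 𝔼)‖ with hL
  have hL0 : 0 ≤ L := norm_nonneg _
  set s := defect (z : 𝔼) with hsdef
  set s' := defect (z' : 𝔼) with hsdef'
  set x : 𝔼 := (((1 + s)⁻¹ : ℝ) : ℂ) • (z : 𝔼) with hx
  set x' : 𝔼 := (((1 + s')⁻¹ : ℝ) : ℂ) • (z' : 𝔼) with hx'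
  have ht' : |s - s'| ≤ 4 * k * s := by
    refine ht.trans ?_
    rw [← hk2]
    nlinarith [mul_nonneg hk0 hs.le]
  have hs's : s' ≤ 2 * s := by
    have := (abs_le.mp ht').1
    nlinarith
  have hxx : ‖x - x'‖ ≤ 8 * k * s := by
    have e : x - x' = (((1 + s)⁻¹ : ℝ) : ℂ) • ((z : 𝔼) - z') +
        (((1 + s)⁻¹ - (1 + s')⁻¹ : ℝ) : ℂ) • (z' : 𝔼) := by
      rw [hx, hx', Complex.ofReal_sub, smul_sub, sub_smul]; abel
    have hi : |(1 + s)⁻¹ - (1 + s')⁻¹| ≤ |s - s'| := by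
      rw [inv_sub_inv (by positivity) (by positivity), abs_div, abs_of_pos (a := (1 + s) * (1 + s'))
        (by positivity), abs_sub_comm, add_sub_add_left_eq_sub]
      refine div_le_self (abs_nonneg _) ?_
      nlinarith
    have hi1 : (1 + s)⁻¹ ≤ 1 := inv_le_one_of_one_le₀ (by linarith)
    rw [e]
    refine (norm_add_le _ _).trans ?_
    rw [norm_smul, norm_smul, Complex.norm_real, Complex.norm_real, Real.norm_eq_abs,
      Real.norm_eq_abs, abs_of_pos (by positivity)]
    have h1 : (1 + s)⁻¹ * ‖(z : 𝔼) - z'‖ ≤ 4 * k * s :=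
      (mul_le_of_le_one_left (norm_nonneg _) hi1).trans hu
    have h2 : |(1 + s)⁻¹ - (1 + s')⁻¹| * ‖(z' : 𝔼)‖ ≤ 4 * k * s :=
      (mul_le_of_le_one_right (abs_nonneg _) z'.norm_lt.le).trans (hi.trans ht')
    linarith
  have hx1 : ‖x‖ ≤ 1 := by
    rw [hx, norm_smul, Complex.norm_real, Real.norm_eq_abs, abs_of_pos (by positivity)]
    exact mul_le_one₀ (inv_le_one_of_one_le₀ (by linarith)) (norm_nonneg _) z.norm_lt.le
  have hyx : ‖(y : 𝔼) - x‖ ≤ ‖(y : 𝔼) - z‖ + s := by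
    have e : (y : 𝔼) - x = ((y : 𝔼) - z) + ((s * (1 + s)⁻¹ : ℝ) : ℂ) • (z : 𝔼) := by
      have : ((s * (1 + s)⁻¹ : ℝ) : ℂ) = 1 - (((1 + s)⁻¹ : ℝ) : ℂ) := by
        rw [← Complex.ofReal_one, ← Complex.ofReal_sub]
        congr 1
        field_simp
        ring
      rw [this, hx, sub_smul, one_smul]; abel
    rw [e]
    refine (norm_add_le _ _).trans ?_
    gcongr
    rw [norm_smul, Complex.norm_real, Real.norm_eq_abs, abs_of_pos (by positivity)]
    have hi1 : (1 + s)⁻¹ ≤ 1 := inv_le_one_of_one_le₀ (by linarith)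
    calc _ ≤ s * 1 * 1 := by
          gcongr
          exact z.norm_lt.le
      _ = s := by ring
  have hsyx : s * ‖(y : 𝔼) - x‖ ≤ 4 * L := by
    nlinarith [norm_nonneg ((y : 𝔼) - z), sq_nonneg (s - ‖(y : 𝔼) - z‖)]
  have hain : ∀ e : 𝔼, ‖inner ℂ (a : 𝔼) e‖ ≤ ‖e‖ := fun e =>
    (norm_inner_le_norm _ _).trans (mul_le_of_le_one_left (norm_nonneg _) a.norm_lt.le)
  -- Each of the four terms is at most a constant times `k L`. In the last two, the gain of `s`
  -- in `|s - s'| ≤ 4 k s` and `|x - x'| ≤ 8 k s` is essential: `s²` and `s |y - x|` are `O(L)`.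
  have e : autNum (z' : 𝔼) a y - autNum (z : 𝔼) a y =
      ((1 - inner ℂ (z' : 𝔼) (y : 𝔼)) - (1 - inner ℂ (z : 𝔼) (y : 𝔼))) *
          (1 - inner ℂ (a : 𝔼) x) +
        (1 - inner ℂ (z' : 𝔼) (y : 𝔼)) * inner ℂ (a : 𝔼) (x - x') -
        ((s - s' : ℝ) : ℂ) * inner ℂ (a : 𝔼) ((y : 𝔼) - x) +
        (s' : ℂ) * inner ℂ (a : 𝔼) (x - x') := by
    rw [autNum, autNum, ← hsdef, ← hsdef', ← hx, ← hx', Complex.ofReal_sub]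
    simp only [inner_sub_right]
    ring
  have hL' : ‖1 - inner ℂ (z' : 𝔼) (y : 𝔼)‖ ≤ 2 * L := by
    have := norm_add_le ((1 - inner ℂ (z' : 𝔼) (y : 𝔼)) - (1 - inner ℂ (z : 𝔼) (y : 𝔼)))
      (1 - inner ℂ (z : 𝔼) (y : 𝔼))
    rw [sub_add_cancel, ← hL] at this
    nlinarith
  have b1 : ‖((1 - inner ℂ (z' : 𝔼) (y : 𝔼)) - (1 - inner ℂ (z : 𝔼) (y : 𝔼))) *
      (1 - inner ℂ (a : 𝔼) x)‖ ≤ 2 * k * L := by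
    rw [norm_mul]
    have h1 : ‖1 - inner ℂ (a : 𝔼) x‖ ≤ 2 := by
      have := norm_sub_le (1 : ℂ) (inner ℂ (a : 𝔼) x)
      rw [norm_one] at this
      linarith [hain x]
    calc _ ≤ (4 * rho z z' * L) * 2 := by gcongr
      _ ≤ _ := by rw [← hk2]; nlinarith [mul_nonneg hk0 hL0]
  have hs1 : s ≤ 1 := defect_le_one _
  have b2 : ‖(1 - inner ℂ (z' : 𝔼) (y : 𝔼)) * inner ℂ (a : 𝔼) (x - x')‖ ≤ 16 * k * L := by
    rw [norm_mul]
    calc _ ≤ 2 * L * (8 * k * 1) := by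
          gcongr
          exact (hain _).trans (hxx.trans (by gcongr))
      _ = _ := by ring
  have b3 : ‖((s - s' : ℝ) : ℂ) * inner ℂ (a : 𝔼) ((y : 𝔼) - x)‖ ≤ 16 * k * L := by
    rw [norm_mul, Complex.norm_real, Real.norm_eq_abs]
    calc _ ≤ 4 * k * s * ‖(y : 𝔼) - x‖ := by
          gcongr
          exact hain _
      _ = 4 * k * (s * ‖(y : 𝔼) - x‖) := by ring
      _ ≤ 4 * k * (4 * L) := by gcongr
      _ = _ := by ring
  have b4 : ‖(s' : ℂ) * inner ℂ (a : 𝔼) (x - x')‖ ≤ 32 * k * L := by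
    rw [norm_mul, Complex.norm_real, Real.norm_eq_abs, abs_of_pos hs']
    calc _ ≤ 2 * s * (8 * k * s) := by
          gcongr
          exact (hain _).trans hxx
      _ = 16 * k * s ^ 2 := by ring
      _ ≤ 16 * k * (2 * L) := by gcongr
      _ = _ := by ring
  rw [e]
  refine (norm_add_le _ _).trans ((add_le_add_left (norm_sub_le _ _) _).trans
    ((add_le_add_left (add_le_add_left (norm_add_le _ _) _) _).trans ?_))
  nlinarith [mul_nonneg hk0 hL0]

end BergmanBall
end

noncomputable section

namespace BergmanBall

set_option linter.unusedSectionVars false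

variable {n d : ℕ}

local notation "𝔼" => EuclideanSpace ℂ (Fin n)

lemma div_cpow_of_re_pos {x y : ℂ} (hx : 0 < x.re) (hy : 0 < y.re) (c : ℂ) :
    (x / y) ^ c = x ^ c / y ^ c := by
  have hx0 : x ≠ 0 := fun h => by simp [h] at hx
  have hy0 : y ≠ 0 := fun h => by simp [h] at hy
  have hyi : 0 < (y⁻¹).re := by
    rw [Complex.inv_re]
    exact div_pos hy (Complex.normSq_pos.mpr hy0)
  have hax := abs_lt.mp (Complex.abs_arg_lt_pi_div_two_iff.mpr (Or.inl hx))
  have hay := abs_lt.mp (Complex.abs_arg_lt_pi_div_two_iff.mpr (Or.inl hyi))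
  have harg : y.arg ≠ Real.pi := Complex.slitPlane_arg_ne_pi (Or.inl hy)
  have hlog : Complex.log (x * y⁻¹) = Complex.log x + Complex.log y⁻¹ :=
    Complex.log_mul hx0 (inv_ne_zero hy0) ⟨by linarith, by linarith⟩
  rw [div_eq_mul_inv, Complex.cpow_def_of_ne_zero (mul_ne_zero hx0 (inv_ne_zero hy0)), hlog,
    add_mul, Complex.exp_add, ← Complex.cpow_def_of_ne_zero hx0,
    ← Complex.cpow_def_of_ne_zero (inv_ne_zero hy0), Complex.inv_cpow _ _ harg, ← div_eq_mul_inv]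

lemma tendsto_cpow_one {X : Type*} {l : Filter X} {f : X → ℂ} (hf : Tendsto f l (𝓝 1)) (c : ℂ) :
    Tendsto (fun x => f x ^ c) l (𝓝 1) := by
  have h : ContinuousAt (fun z : ℂ => z ^ c) 1 :=
    continuousAt_id.cpow continuousAt_const (by simp [Complex.one_mem_slitPlane])
  have := h.tendsto.comp hf
  rwa [Complex.one_cpow] at this

/-- Triples `(z, z', y)` with `ρ(z, z')` small and `y` arbitrary. Convergence along this filter
is convergence as `ρ(z, z') → 0`, uniformly in `y`. -/
def nearRho (n : ℕ) : Filter (Ball n × Ball n × Ball n) :=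
  comap (fun x => rho x.1 x.2.1) (𝓝 0)

lemma tendsto_one_nearRho {f : Ball n × Ball n × Ball n → ℂ} {C : ℝ}
    (h : ∀ z z' y : Ball n, rho z z' ≤ 1 / 16 → ‖f (z, z', y) - 1‖ ≤ C * √(rho z z')) :
    Tendsto f (nearRho n) (𝓝 1) := by
  have hρ : Tendsto (fun x : Ball n × Ball n × Ball n => rho x.1 x.2.1) (nearRho n) (𝓝 0) :=
    tendsto_comap
  rw [tendsto_iff_norm_sub_tendsto_zero]
  refine squeeze_zero' (Eventually.of_forall fun _ => norm_nonneg _)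
    (g := fun x => C * √(rho x.1 x.2.1)) ?_ ?_
  · filter_upwards [hρ.eventually_le_const (by norm_num : (0 : ℝ) < 1 / 16)] with x hx
    exact h x.1 x.2.1 x.2.2 hx
  · have := (Real.continuous_sqrt.tendsto 0).comp hρ
    rw [Real.sqrt_zero] at this
    simpa using this.const_mul C

lemma rho_le_sqrt_rho {z z' : Ball n} : rho z z' ≤ √(rho z z') := by
  have h0 := rho_nonneg z z'
  refine Real.le_sqrt_of_sq_le ?_
  nlinarith [rho_lt_one z z']

lemma tendsto_defect_div : Tendsto (fun x : Ball n × Ball n × Ball n =>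
    ((defect (x.2.1 : 𝔼) / defect (x.1 : 𝔼) : ℝ) : ℂ)) (nearRho n) (𝓝 1) := by
  refine tendsto_one_nearRho (C := 16) fun z z' y h => ?_
  have hs := defect_pos z.norm_lt
  have h1 := abs_defect_sub_le (z := z) (z' := z') (by linarith)
  have e : ((defect (z' : 𝔼) / defect (z : 𝔼) : ℝ) : ℂ) - 1 =
      ((-(defect (z : 𝔼) - defect (z' : 𝔼)) / defect (z : 𝔼) : ℝ) : ℂ) := by
    rw [← Complex.ofReal_one, ← Complex.ofReal_sub]
    congr 1
    field_simp
    ring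
  simp only
  rw [e, Complex.norm_real, Real.norm_eq_abs, abs_div, abs_neg, abs_of_pos hs, div_le_iff₀ hs]
  refine h1.trans ?_
  gcongr
  exact rho_le_sqrt_rho

lemma tendsto_one_sub_inner_div (a : Ball n) : Tendsto (fun x : Ball n × Ball n × Ball n =>
    (1 - inner ℂ (x.2.1 : 𝔼) (a : 𝔼)) / (1 - inner ℂ (x.1 : 𝔼) (a : 𝔼))) (nearRho n) (𝓝 1) := by
  refine tendsto_one_nearRho (C := 4) fun z z' y h => ?_
  have h1 := norm_one_sub_inner_sub_le (z := z) (z' := z') (by linarith) a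
  have hne := one_sub_inner_ne_zero z a
  have hpos := norm_one_sub_inner_pos z a
  simp only
  rw [div_sub_one hne, norm_div, div_le_iff₀ hpos]
  refine h1.trans ?_
  gcongr
  exact rho_le_sqrt_rho

lemma tendsto_autNum_div (a : Ball n) : Tendsto (fun x : Ball n × Ball n × Ball n =>
    autNum (x.2.1 : 𝔼) a x.2.2 / autNum (x.1 : 𝔼) a x.2.2) (nearRho n) (𝓝 1) := by
  refine tendsto_one_nearRho (C := 100 / (1 - ‖(a : 𝔼)‖)) fun z z' y h => ?_
  have ha : 0 < 1 - ‖(a : 𝔼)‖ := by linarith [a.norm_lt]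
  have hL := norm_one_sub_inner_pos z y
  have h1 := norm_autNum_sub_le (z := z) (z' := z') h a y
  have h2 := le_norm_autNum z a y
  have hpos : 0 < ‖autNum (z : 𝔼) a y‖ := lt_of_lt_of_le (by positivity) h2
  simp only
  rw [div_sub_one (norm_pos_iff.mp hpos), norm_div, div_le_iff₀ hpos]
  refine h1.trans ?_
  have hk := Real.sqrt_nonneg (rho z z')
  calc _ = 100 / (1 - ‖(a : 𝔼)‖) * √(rho z z') *
        ((1 - ‖(a : 𝔼)‖) * ‖1 - inner ℂ (z : 𝔼) (y : 𝔼)‖) := by field_simp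
    _ ≤ _ := by gcongr

lemma tendsto_one_sub_inner_aut_div (a : Ball n) :
    Tendsto (fun x : Ball n × Ball n × Ball n =>
      (1 - inner ℂ (aut x.2.1 a : 𝔼) (x.2.2 : 𝔼)) / (1 - inner ℂ (aut x.1 a : 𝔼) (x.2.2 : 𝔼)))
        (nearRho n) (𝓝 1) := by
  have h1 := tendsto_autNum_div a
  have h2 := ((Complex.continuous_conj.tendsto _).comp (tendsto_one_sub_inner_div a)).inv₀
    (by simp)
  have h := h1.mul h2
  simp only [map_one, inv_one, mul_one] at h
  refine h.congr fun x => ?_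
  rw [one_sub_inner_aut_eq, one_sub_inner_aut_eq, Function.comp_apply, map_div₀, map_sub, map_sub,
    map_one, inner_conj_symm, inner_conj_symm, inv_div, div_div_div_eq, ← mul_div_mul_comm,
    mul_comm (1 - inner ℂ (a : 𝔼) (x.2.1 : 𝔼))]

lemma one_sub_inner_re_pos' (z w : Ball n) : 0 < (1 - inner ℂ (z : 𝔼) (w : 𝔼)).re :=
  one_sub_inner_re_pos z.norm_lt.le w.norm_lt

lemma tendsto_kern_aut_div (α : ℝ) (a : Ball n) : Tendsto (fun x : Ball n × Ball n × Ball n =>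
    kern α (aut x.2.1 a : 𝔼) x.2.2 / kern α (aut x.1 a : 𝔼) x.2.2) (nearRho n) (𝓝 1) := by
  have h := (tendsto_cpow_one (tendsto_one_sub_inner_aut_div a)
    (((n : ℝ) + 1 + α : ℝ) : ℂ)).inv₀ one_ne_zero
  rw [inv_one] at h
  refine h.congr fun x => ?_
  rw [div_cpow_of_re_pos (one_sub_inner_re_pos' _ _) (one_sub_inner_re_pos' _ _), kern, kern,
    inv_div, inv_div_inv]

lemma tendsto_wt_div {p : ℝ≥0∞} (α : ℝ) (a : Ball n) :
    Tendsto (fun x : Ball n × Ball n × Ball n => wt p α x.2.1 a / wt p α x.1 a)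
      (nearRho n) (𝓝 1) := by
  have h1 := tendsto_cpow_one (((tendsto_defect_div (n := n)).pow 2).trans (by simp))
    ((((n : ℝ) + 1 + α) / p.toReal : ℝ) : ℂ)
  have h2 := (tendsto_cpow_one (tendsto_one_sub_inner_div a)
    ((2 * ((n : ℝ) + 1 + α) / p.toReal : ℝ) : ℂ)).inv₀ one_ne_zero
  have h := h1.mul h2
  rw [inv_one, mul_one] at h
  refine h.congr fun x => ?_
  have hz := x.1.one_sub_norm_sq_pos
  have hz' := x.2.1.one_sub_norm_sq_pos
  rw [div_cpow_of_re_pos (one_sub_inner_re_pos' _ _) (one_sub_inner_re_pos' _ _), wt, wt,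
    inv_div, div_div_div_comm, ← Complex.ofReal_pow, div_pow, defect_sq x.1.norm_lt,
    defect_sq x.2.1.norm_lt, ← Complex.ofReal_cpow (div_pos hz' hz).le,
    Real.div_rpow hz'.le hz.le, Complex.ofReal_div, div_eq_mul_inv _ (_ / _), inv_div]

variable {p q : ℝ≥0∞} [Fact (1 ≤ p)] [Fact (1 ≤ q)] [hp : Fact (1 < p)] [hpt : Fact (p < ∞)]
  [hq : Fact (1 < q)] [hqt : Fact (q < ∞)] [hpq : p.HolderConjugate q]
  {α : ℝ} [hα : Fact (-1 < α)]

lemma Bergman.norm_le_mul_norm {f g : Bergman n d p α} {c : ℝ}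
    (h : ∀ w, ‖f w‖ ≤ c * ‖g w‖) : ‖f‖ ≤ c * ‖g‖ := by
  rw [← Bergman.norm_toLp f, ← Bergman.norm_toLp g]
  refine Lp.norm_le_mul_norm_of_ae_le_mul ?_
  filter_upwards [f.coeFn_toLp, g.coeFn_toLp] with w h1 h2
  rw [h1, h2]
  exact h w

lemma adj_U_kernVec (z a : Ball n) (v : Vec d p) :
    adj p (U d q α z) (kernVec a v : Bergman n d p α) =
      (starRingEnd ℂ) (wt q α z a) • kernVec (aut z a) v := by
  have e : (starRingEnd ℂ) (wt q α z a) • (kernVec (aut z a) v : Bergman n d p α) =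
      kernVec (aut z a) ((starRingEnd ℂ) (wt q α z a) • v) := by
    ext1 w
    rw [Bergman.smul_apply, kernVec_apply, kernVec_apply, smul_comm]
  rw [e]
  refine Bergman.ext_pairing (q := q) fun g => ?_
  rw [pairing_adj_U, pairing_kernVec_left, pairing_kernVec_left, U_apply', dot_smul_right,
    dot_smul_left]

/-- The map `z ↦ (U_z^{(q,α)})^* K_a v` is uniformly continuous from `(𝔹ₙ, ρ)` to `A^p_α`. -/
lemma uniformContinuous_adj_U_kernVec (a : Ball n) (v : Vec d p) {ε : ℝ} (hε : 0 < ε) :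
    ∃ δ > 0, ∀ z z' : Ball n, rho z z' < δ →
      ‖adj p (U d q α z') (kernVec a v : Bergman n d p α) -
        adj p (U d q α z) (kernVec a v : Bergman n d p α)‖ ≤ ε := by
  set M := ‖bergmanProj n d p α‖ * ‖(kernVec a v : Bergman n d p α)‖ with hM
  have hM0 : 0 ≤ M := by positivity
  have h := ((Complex.continuous_conj.tendsto _).comp (tendsto_wt_div (p := q) α a)).mul
    (tendsto_kern_aut_div α a)
  rw [map_one, mul_one] at h
  have hev := (Metric.tendsto_nhds.mp h) (ε / (M + 1)) (by positivity)
  rw [nearRho, eventually_comap] at hev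
  obtain ⟨δ, hδ, hb⟩ := Metric.eventually_nhds_iff.mp hev
  refine ⟨δ, hδ, fun z z' hzz => ?_⟩
  have hle : ‖adj p (U d q α z') (kernVec a v : Bergman n d p α) -
      adj p (U d q α z) (kernVec a v : Bergman n d p α)‖ ≤ ε / (M + 1) *
        ‖adj p (U d q α z) (kernVec a v : Bergman n d p α)‖ := by
    refine Bergman.norm_le_mul_norm fun y => ?_
    have h1 := hb (y := rho z z') (by rwa [dist_zero_right, Real.norm_of_nonneg (rho_nonneg _ _)])
      (z, z', y) rfl
    rw [dist_eq_norm, Function.comp_apply, map_div₀] at h1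
    have hw : (starRingEnd ℂ) (wt q α z a) ≠ 0 := by simpa using wt_ne_zero z a
    have hk : kern α (aut z a : 𝔼) y ≠ 0 := inv_ne_zero (one_sub_inner_cpow_ne_zero _ _ _)
    rw [adj_U_kernVec, adj_U_kernVec, Bergman.sub_apply, Bergman.smul_apply, Bergman.smul_apply,
      kernVec_apply, kernVec_apply, smul_smul, smul_smul, ← sub_smul, norm_smul, norm_smul,
      ← mul_assoc]
    refine mul_le_mul_of_nonneg_right ?_ (norm_nonneg v)
    simp only at h1
    generalize (starRingEnd ℂ) (wt q α z a) = A at h1 hw ⊢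
    generalize (starRingEnd ℂ) (wt q α z' a) = A' at h1 ⊢
    generalize kern α (aut z a : 𝔼) y = K at h1 hk ⊢
    generalize kern α (aut z' a : 𝔼) y = K' at h1 ⊢
    have e : A' * K' - A * K = (A' / A * (K' / K) - 1) * (A * K) := by field_simp
    rw [e, norm_mul]
    exact mul_le_mul_of_nonneg_right h1.le (norm_nonneg _)
  refine hle.trans ?_
  have h2 := norm_adj_U_apply_le q z (kernVec a v : Bergman n d p α)
  rw [div_mul_eq_mul_div, div_le_iff₀ (by positivity)]
  nlinarith

lemma continuous_of_rho {F : Ball n → ℂ}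
    (h : ∀ ε > 0, ∃ δ > 0, ∀ z w : Ball n, rho z w < δ → dist (F z) (F w) < ε) : Continuous F := by
  refine continuous_iff_continuousAt.mpr fun z => ?_
  refine Metric.tendsto_nhds.mpr fun ε hε => ?_
  obtain ⟨δ, hδ, hF⟩ := h ε hε
  have hc : Continuous fun w : Ball n => rho z w :=
    continuous_norm.comp (continuous_subtype_val.comp (continuous_aut z))
  have := hc.tendsto z
  rw [rho_self] at this
  filter_upwards [this.eventually_lt_const hδ] with w hw
  rw [dist_comm]
  exact hF z w hw

lemma pairing_sub_left (f f' : Bergman n d p α) (g : Bergman n d q α) :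
    pairing (f - f') g = pairing f g - pairing f' g := by
  have : q.HolderConjugate p := hpq.symm
  rw [← conj_pairing, pairing_sub_right, map_sub, conj_pairing, conj_pairing]

/-- The coordinates of the values of `S_z K_a v`, as functions of `z`, belong to `𝒜`. -/
lemma exists_ucAlgebra_eq_conj_kernVec (S : Bergman n d p α →L[ℂ] Bergman n d p α) (a : Ball n)
    (v : Vec d p) (w : Ball n) (i : Fin d) :
    ∃ A : ucAlgebra n, ∀ z, (A : Ball n →ᵇ ℂ) z =
      conj q S z (kernVec a v : Bergman n d p α) w i := by
  have : q.HolderConjugate p := hpq.symm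
  set k : Bergman n d p α := kernVec a v with hk
  set k' : Bergman n d q α := kernVec w (PiLp.single q i (1 : ℂ)) with hk'
  set E : Ball n → Bergman n d p α := fun z => S (adj p (U d q α z) k) with hE
  set E' : Ball n → Bergman n d q α := fun z => adj q (U d p α z) k' with hE'
  set F : Ball n → ℂ := fun z => conj q S z k w i with hF
  have hFE : ∀ z, F z = pairing (E z) (E' z) := fun z => by
    have h1 : F z = pairing (U d p α z (E z)) k' := Bergman.apply_eq_pairing q _ w i
    rw [h1, ← conj_pairing, ← pairing_adj_U, conj_pairing]
  obtain ⟨C, hC, hEC⟩ : ∃ C, 0 ≤ C ∧ ∀ z, ‖E z‖ ≤ C :=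
    ⟨‖S‖ * (‖bergmanProj n d p α‖ * ‖k‖), by positivity, fun z =>
      (S.le_opNorm _).trans (mul_le_mul_of_nonneg_left (norm_adj_U_apply_le q z k)
        (norm_nonneg _))⟩
  obtain ⟨C', hC', hEC'⟩ : ∃ C, 0 ≤ C ∧ ∀ z, ‖E' z‖ ≤ C :=
    ⟨‖bergmanProj n d q α‖ * ‖k'‖, by positivity, fun z => norm_adj_U_apply_le p z k'⟩
  have huc : ∀ ε > 0, ∃ δ > 0, ∀ z z' : Ball n, rho z z' < δ → dist (F z) (F z') < ε := by
    intro ε hε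
    obtain ⟨δ, hδ, h⟩ := uniformContinuous_adj_U_kernVec (q := q) (α := α) a v
      (ε := ε / (4 * ((d : ℝ) + 1) * (‖S‖ + 1) * (C' + 1))) (by positivity)
    obtain ⟨δ', hδ', h'⟩ := uniformContinuous_adj_U_kernVec (p := q) (q := p) (α := α) w
      (PiLp.single q i (1 : ℂ) : Vec d q) (ε := ε / (4 * ((d : ℝ) + 1) * (C + 1))) (by positivity)
    refine ⟨min δ δ', lt_min hδ hδ', fun z z' hzz => ?_⟩
    have b1 := h z z' (hzz.trans_le (min_le_left _ _))
    have b2 := h' z z' (hzz.trans_le (min_le_right _ _))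
    rw [dist_comm, dist_eq_norm, hFE, hFE]
    have e : pairing (E z') (E' z') - pairing (E z) (E' z) =
        pairing (E z' - E z) (E' z') + pairing (E z) (E' z' - E' z) := by
      rw [pairing_sub_left, pairing_sub_right]; ring
    have c1 : ‖E z' - E z‖ ≤ ‖S‖ * (ε / (4 * ((d : ℝ) + 1) * (‖S‖ + 1) * (C' + 1))) := by
      rw [hE]
      simp only
      rw [← map_sub]
      exact (S.le_opNorm _).trans (mul_le_mul_of_nonneg_left b1 (norm_nonneg _))
    have hd : (0 : ℝ) ≤ d := Nat.cast_nonneg d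
    have hS := norm_nonneg S
    have d1 : ‖pairing (E z' - E z) (E' z')‖ ≤ ε / 4 := by
      refine (norm_pairing_le _ _).trans ?_
      calc _ ≤ (d : ℝ) * (‖S‖ * (ε / (4 * ((d : ℝ) + 1) * (‖S‖ + 1) * (C' + 1))) * C') := by
            gcongr
            exact hEC' z'
        _ ≤ ((d : ℝ) + 1) * ((‖S‖ + 1) * (ε / (4 * ((d : ℝ) + 1) * (‖S‖ + 1) * (C' + 1))) *
            (C' + 1)) := by
            gcongr <;> linarith
        _ = _ := by field_simp
    have d2 : ‖pairing (E z) (E' z' - E' z)‖ ≤ ε / 4 := by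
      refine (norm_pairing_le _ _).trans ?_
      calc _ ≤ (d : ℝ) * (C * (ε / (4 * ((d : ℝ) + 1) * (C + 1)))) := by
            gcongr
            exact hEC z
        _ ≤ ((d : ℝ) + 1) * ((C + 1) * (ε / (4 * ((d : ℝ) + 1) * (C + 1)))) := by
            gcongr <;> linarith
        _ = _ := by field_simp
    rw [e]
    have := norm_add_le (pairing (E z' - E z) (E' z')) (pairing (E z) (E' z' - E' z))
    linarith
  refine ⟨⟨BoundedContinuousFunction.ofNormedAddCommGroup F (continuous_of_rho huc)
    (d * (C * C')) fun z => ?_, huc⟩, fun z => rfl⟩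
  rw [hFE]
  refine (norm_pairing_le _ _).trans ?_
  gcongr
  · exact hEC z
  · exact hEC' z

end BergmanBall
end

noncomputable section

namespace BergmanBall

/-! ### The ball is dense in the maximal ideal space -/

set_option linter.unusedSectionVars false

variable {n d : ℕ}

lemma pointEval_apply (z : Ball n) (a : ucAlgebra n) :
    pointEval z a = (a : Ball n →ᵇ ℂ) z := rfl

lemma exists_ucAlgebra_star (a : ucAlgebra n) :
    ∃ b : ucAlgebra n, ∀ z, (b : Ball n →ᵇ ℂ) z = star ((a : Ball n →ᵇ ℂ) z) := by
  refine ⟨⟨star (a : Ball n →ᵇ ℂ), fun ε hε => ?_⟩, fun z => rfl⟩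
  obtain ⟨δ, hδ, h⟩ := a.2 ε hε
  refine ⟨δ, hδ, fun z w hzw => ?_⟩
  rw [BoundedContinuousFunction.star_apply, BoundedContinuousFunction.star_apply, dist_star_star]
  exact h z w hzw

/-- `𝒜` is inverse closed. -/
lemma exists_ucAlgebra_mul_eq_one (b : ucAlgebra n) (hb : ∀ z, 1 ≤ ‖(b : Ball n →ᵇ ℂ) z‖) :
    ∃ c : ucAlgebra n, b * c = 1 := by
  set F : Ball n → ℂ := fun z => ((b : Ball n →ᵇ ℂ) z)⁻¹ with hF
  have hb0 : ∀ z, (b : Ball n →ᵇ ℂ) z ≠ 0 := fun z h => by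
    have := hb z
    rw [h, norm_zero] at this
    linarith
  have huc : ∀ ε > 0, ∃ δ > 0, ∀ z w : Ball n, rho z w < δ → dist (F z) (F w) < ε := by
    intro ε hε
    obtain ⟨δ, hδ, h⟩ := b.2 ε hε
    refine ⟨δ, hδ, fun z w hzw => lt_of_le_of_lt ?_ (h z w hzw)⟩
    have e : F z - F w = ((b : Ball n →ᵇ ℂ) w - (b : Ball n →ᵇ ℂ) z) /
        ((b : Ball n →ᵇ ℂ) z * (b : Ball n →ᵇ ℂ) w) := by
      rw [hF]
      exact inv_sub_inv (hb0 z) (hb0 w)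
    rw [dist_eq_norm, e, norm_div, norm_mul, dist_eq_norm, norm_sub_rev]
    exact div_le_self (norm_nonneg _) (one_le_mul_of_one_le_of_one_le (hb z) (hb w))
  refine ⟨⟨BoundedContinuousFunction.ofNormedAddCommGroup F (continuous_of_rho huc) 1 fun z => ?_,
    huc⟩, ?_⟩
  · rw [hF, norm_inv]
    exact inv_le_one_of_one_le₀ (hb z)
  · refine Subtype.ext (BoundedContinuousFunction.ext fun z => ?_)
    exact mul_inv_cancel₀ (hb0 z)

lemma nhds_eq_comap_pi (x : MaxIdealSpace n) :
    𝓝 x = comap (fun y : MaxIdealSpace n => fun a : ucAlgebra n => y a)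
      (𝓝 fun a : ucAlgebra n => x a) := by
  have h : IsInducing fun y : WeakDual ℂ (ucAlgebra n) => fun a : ucAlgebra n => y a := ⟨rfl⟩
  exact (h.comp IsInducing.subtypeVal).nhds_eq_comap x

/-- The ball is dense in the maximal ideal space. Otherwise there are `a₁, …, aₖ ∈ 𝒜` such that
`b = ∑ |aᵢ - x(aᵢ)|²` is bounded below; then `b` is invertible in `𝒜`, although `x(b) = 0`. -/
instance neBot_comap_pointEval (x : MaxIdealSpace n) : (comap pointEval (𝓝 x)).NeBot := by
  refine comap_neBot fun t ht => ?_
  rw [nhds_eq_comap_pi, mem_comap] at ht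
  obtain ⟨u, hu, hut⟩ := ht
  rw [nhds_pi, Filter.mem_pi] at hu
  obtain ⟨I, hI, s, hs, hIs⟩ := hu
  choose ε hε hεs using fun a => Metric.mem_nhds_iff.mp (hs a)
  by_contra! hcon
  have hfar : ∀ z : Ball n, ∃ a ∈ I, ε a ≤ ‖(a : Ball n →ᵇ ℂ) z - x a‖ := by
    intro z
    by_contra! h
    refine hcon z (hut (hIs fun a ha => hεs a ?_))
    rw [Metric.mem_ball, dist_eq_norm]
    exact h a ha
  -- The element `b = ∑ |c_a|²`, where `c_a = (a - x(a)) / ε_a`, is at least `1` on the ball, hence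
  -- invertible in `𝒜`, although `x` annihilates it.
  choose st hst using fun a : ucAlgebra n => exists_ucAlgebra_star a
  set c : ucAlgebra n → ucAlgebra n := fun a => ((ε a)⁻¹ : ℂ) • (a - algebraMap ℂ _ (x a)) with hc
  have hxc : ∀ a, x (c a) = 0 := fun a => by
    have h1 : x (algebraMap ℂ (ucAlgebra n) (x a)) = x a := AlgHomClass.commutes x (x a)
    rw [hc]
    simp only
    rw [map_smul, map_sub, h1, sub_self, smul_zero]
  have hcz : ∀ a z, (c a : Ball n →ᵇ ℂ) z = ((ε a)⁻¹ : ℂ) * ((a : Ball n →ᵇ ℂ) z - x a) :=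
    fun a z => rfl
  set b : ucAlgebra n := ∑ a ∈ hI.toFinset, st (c a) * c a with hb
  have hbz : ∀ z, (b : Ball n →ᵇ ℂ) z =
      ((∑ a ∈ hI.toFinset, ‖(c a : Ball n →ᵇ ℂ) z‖ ^ 2 : ℝ) : ℂ) := by
    intro z
    rw [← pointEval_apply, hb, map_sum, Complex.ofReal_sum]
    refine Finset.sum_congr rfl fun a _ => ?_
    rw [map_mul, pointEval_apply, pointEval_apply, hst, mul_comm]
    have := Complex.mul_conj ((c a : Ball n →ᵇ ℂ) z)
    rw [Complex.normSq_eq_norm_sq] at this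
    exact this
  have hb1 : ∀ z, 1 ≤ ‖(b : Ball n →ᵇ ℂ) z‖ := by
    intro z
    rw [hbz, Complex.norm_real, Real.norm_of_nonneg (by positivity)]
    obtain ⟨a, ha, haz⟩ := hfar z
    refine le_trans ?_ (Finset.single_le_sum (f := fun a => ‖(c a : Ball n →ᵇ ℂ) z‖ ^ 2)
      (fun a _ => by positivity) (hI.mem_toFinset.mpr ha))
    have : 1 ≤ ‖(c a : Ball n →ᵇ ℂ) z‖ := by
      rw [hcz, norm_mul, norm_inv, Complex.norm_real, Real.norm_of_nonneg (hε a).le,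
        inv_mul_eq_div, one_le_div (hε a)]
      exact haz
    exact one_le_pow₀ this
  obtain ⟨b', hb'⟩ := exists_ucAlgebra_mul_eq_one b hb1
  have hxb : x b = 0 := by
    rw [hb, map_sum]
    exact Finset.sum_eq_zero fun a _ => by rw [map_mul, hxc, mul_zero]
  have h1 := congrArg x hb'
  rw [map_mul, hxb, zero_mul, map_one] at h1
  exact zero_ne_one h1

lemma tendsto_ucAlgebra (x : MaxIdealSpace n) (a : ucAlgebra n) :
    Tendsto (fun z => (a : Ball n →ᵇ ℂ) z) (comap pointEval (𝓝 x)) (𝓝 (x a)) := by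
  have h : Continuous fun y : MaxIdealSpace n => y a :=
    (WeakDual.eval_continuous a).comp continuous_subtype_val
  exact (h.tendsto x).comp tendsto_comap

/-! ### Convergence of `S_z` in the strong operator topology -/

section Limits

variable {ι E : Type*} [NormedAddCommGroup E] [NormedSpace ℂ E]

/-- A bounded family of operators which converges on a set with dense span converges in the strong
operator topology. -/
lemma exists_clm_tendsto [CompleteSpace E] {l : Filter ι} [l.NeBot] {T : ι → E →L[ℂ] E} {C : ℝ}
    (hC : 0 ≤ C) (hT : ∀ i f, ‖T i f‖ ≤ C * ‖f‖) {D : Set E}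
    (hD : Dense (Submodule.span ℂ D : Set E))
    (h : ∀ f ∈ D, ∃ g, Tendsto (fun i => T i f) l (𝓝 g)) :
    ∃ L : E →L[ℂ] E, ∀ f, Tendsto (fun i => T i f) l (𝓝 (L f)) := by
  have hspan : ∀ f ∈ Submodule.span ℂ D, ∃ g, Tendsto (fun i => T i f) l (𝓝 g) := by
    intro f hf
    induction hf using Submodule.span_induction with
    | mem f hf => exact h f hf
    | zero => exact ⟨0, by simp only [map_zero]; exact tendsto_const_nhds⟩
    | add f g _ _ hf hg =>
      obtain ⟨f', hf⟩ := hf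
      obtain ⟨g', hg⟩ := hg
      exact ⟨f' + g', by simpa only [map_add] using hf.add hg⟩
    | smul c f _ hf =>
      obtain ⟨f', hf⟩ := hf
      exact ⟨c • f', by simpa only [map_smul] using hf.const_smul c⟩
  have hall : ∀ f, ∃ g, Tendsto (fun i => T i f) l (𝓝 g) := by
    intro f
    rw [← cauchy_map_iff_exists_tendsto, Metric.cauchy_iff]
    refine ⟨inferInstance, fun ε hε => ?_⟩
    obtain ⟨g, hg, hgs⟩ := Metric.dense_iff.mp hD f (ε / (4 * (C + 1))) (by positivity)
    obtain ⟨g', hg'⟩ := hspan g hgs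
    refine ⟨_, image_mem_map (hg' (Metric.ball_mem_nhds g' (ε := ε / 4) (by positivity))), ?_⟩
    rw [Metric.mem_ball', dist_eq_norm, lt_div_iff₀ (by positivity)] at hg
    have hclose : ∀ i, dist (T i f) (T i g) ≤ ε / 4 := fun i => by
      rw [dist_eq_norm, ← map_sub]
      refine (hT i _).trans ?_
      nlinarith [norm_nonneg (f - g)]
    rintro _ ⟨i, hi, rfl⟩ _ ⟨j, hj, rfl⟩
    rw [Set.mem_preimage, Metric.mem_ball] at hi hj
    have h1 := dist_triangle4 (T i f) (T i g) (T j g) (T j f)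
    have h2 := dist_triangle_right (T i g) (T j g) g'
    have h3 := hclose j
    rw [dist_comm] at h3
    linarith [hclose i]
  choose L hL using hall
  refine ⟨LinearMap.mkContinuous
    { toFun := L
      map_add' := fun f g => tendsto_nhds_unique (hL (f + g))
        (by simpa only [map_add] using (hL f).add (hL g))
      map_smul' := fun c f => tendsto_nhds_unique (hL (c • f))
        (by simpa only [map_smul, RingHom.id_apply] using (hL f).const_smul c) } C fun f => ?_, hL⟩
  exact le_of_tendsto (hL f).norm (Eventually.of_forall fun i => hT i f)

end Limits

/-- A function on a space which has limits along the traces of all neighbourhood filters of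
a larger space extends continuously. -/
lemma continuous_of_tendsto_comap {X M E : Type*} [TopologicalSpace M] [TopologicalSpace E]
    [RegularSpace E] {e : X → M} (he : ∀ x, (comap e (𝓝 x)).NeBot) {u : X → E} {g : M → E}
    (h : ∀ x, Tendsto u (comap e (𝓝 x)) (𝓝 (g x))) : Continuous g := by
  refine continuous_iff_continuousAt.mpr fun x => ?_
  refine (closed_nhds_basis (g x)).tendsto_right_iff.mpr fun V hV => ?_
  obtain ⟨W, hW, hWV⟩ := mem_comap.mp (h x hV.1)
  filter_upwards [eventually_mem_nhds_iff.mpr hW] with y hy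
  have := he y
  exact hV.2.mem_of_tendsto (h y) (mem_of_superset (preimage_mem_comap hy) hWV)

variable {p q : ℝ≥0∞} [Fact (1 ≤ p)] [Fact (1 ≤ q)] [hp : Fact (1 < p)] [hpt : Fact (p < ∞)]
  [hq : Fact (1 < q)] [hqt : Fact (q < ∞)] [hpq : p.HolderConjugate q]
  {α : ℝ} [hα : Fact (-1 < α)]

lemma continuous_pairing_left (g : Bergman n d q α) :
    Continuous fun f : Bergman n d p α => pairing f g := by
  refine (LipschitzWith.of_dist_le_mul (K := ⟨d * ‖g‖, by positivity⟩) fun f f' => ?_).continuous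
  rw [dist_eq_norm, dist_eq_norm, ← pairing_sub_left]
  refine (norm_pairing_le _ _).trans (le_of_eq ?_)
  change _ = d * ‖g‖ * ‖f - f'‖
  ring

variable (q) in
/-- The orbit of a kernel function converges: it is totally bounded, and its cluster points are
determined by the limits of functions in `𝒜`. -/
lemma exists_tendsto_conj_kernVec {S : Bergman n d p α →L[ℂ] Bergman n d p α}
    (hS : S ∈ toeplitzAlgebra n d p α) (x : MaxIdealSpace n) (a : Ball n) (v : Vec d p) :
    ∃ g, Tendsto (fun z => conj q S z (kernVec a v : Bergman n d p α)) (comap pointEval (𝓝 x))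
      (𝓝 g) := by
  set u : Ball n → Bergman n d p α := fun z => conj q S z (kernVec a v) with hu
  have hK : IsCompact (closure (Set.range u)) :=
    ((orbitTotallyBounded_conj (q := q) hS).2 (kernVec a v)).closure.isCompact_of_isClosed
      isClosed_closure
  have hmem : closure (Set.range u) ∈ map u (comap pointEval (𝓝 x)) :=
    mem_map.mpr (univ_mem' fun z => subset_closure ⟨z, rfl⟩)
  choose A hA using fun (w : Ball n) (i : Fin d) =>
    exists_ucAlgebra_eq_conj_kernVec (q := q) S a v w i
  -- A cluster point is determined by its coordinates, because the coordinates of `S_z k_a` at `w`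
  -- are functions of `z` that belong to `𝒜`.
  have hcl : ∀ c, ClusterPt c (map u (comap pointEval (𝓝 x))) → ∀ w i, c w i = x (A w i) := by
    intro c hc w i
    have hcont : Continuous fun f : Bergman n d p α => f w i := by
      simp only [Bergman.apply_eq_pairing q]
      exact continuous_pairing_left _
    have h1 : ClusterPt (c w i) (map (fun f : Bergman n d p α => f w i)
        (map u (comap pointEval (𝓝 x)))) := hc.map hcont.continuousAt tendsto_map
    have h2 : map (fun f : Bergman n d p α => f w i) (map u (comap pointEval (𝓝 x))) ≤
        𝓝 (x (A w i)) := by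
      rw [map_map]
      refine (tendsto_ucAlgebra x (A w i)).congr fun z => ?_
      exact hA w i z
    have : (𝓝 (c w i) ⊓ 𝓝 (x (A w i))).NeBot := NeBot.mono h1 (inf_le_inf_left _ h2)
    exact eq_of_nhds_neBot this
  have := neBot_comap_pointEval x
  obtain ⟨c, -, hc⟩ := hK.exists_clusterPt (f := map u (comap pointEval (𝓝 x)))
    (le_principal_iff.mpr hmem)
  refine ⟨c, hK.le_nhds_of_unique_clusterPt hmem fun c' _ hc' => ?_⟩
  ext w i
  rw [hcl c' hc', hcl c hc]

variable (q) in
lemma exists_tendsto_conj {S : Bergman n d p α →L[ℂ] Bergman n d p α}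
    (hS : S ∈ toeplitzAlgebra n d p α) (x : MaxIdealSpace n) :
    ∃ L : Bergman n d p α →L[ℂ] Bergman n d p α, ∀ f,
      Tendsto (fun z => conj q S z f) (comap pointEval (𝓝 x)) (𝓝 (L f)) := by
  obtain ⟨C, hC, hb⟩ := (orbitTotallyBounded_conj (q := q) hS).1
  refine exists_clm_tendsto hC hb dense_span_kernVec ?_
  rintro _ ⟨a, v, rfl⟩
  exact exists_tendsto_conj_kernVec q hS x a v

/-- `S_z` converges to `S_x` in the strong operator topology as `z` tends to `x`. -/
lemma tendsto_conj_conjLim {S : Bergman n d p α →L[ℂ] Bergman n d p α}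
    (hS : S ∈ toeplitzAlgebra n d p α) (x : MaxIdealSpace n) (f : Bergman n d p α) :
    Tendsto (fun z => conj q S z f) (comap pointEval (𝓝 x)) (𝓝 (conjLim q S x f)) := by
  obtain ⟨L, hL⟩ := exists_tendsto_conj q hS x
  have hwot : Tendsto (fun z => ContinuousLinearMapWOT.ofCLM (conj q S z))
      (comap pointEval (𝓝 x)) (𝓝 (ContinuousLinearMapWOT.ofCLM L)) :=
    ContinuousLinearMapWOT.tendsto_iff_forall_dual_apply_tendsto.mpr fun g y =>
      (y.continuous.tendsto _).comp (hL g)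
  have : conjLim q S x = L := by
    rw [conjLim, hwot.limUnder_eq]
  rw [this]
  exact hL f

lemma conjLim_pointEval {S : Bergman n d p α →L[ℂ] Bergman n d p α}
    (hS : S ∈ toeplitzAlgebra n d p α) (z : Ball n) (f : Bergman n d p α) :
    conjLim q S (pointEval z) f = conj q S z f := by
  have h1 : pure z ≤ comap (pointEval (n := n)) (𝓝 (pointEval z)) := by
    rw [← map_le_iff_le_comap, map_pure]
    exact pure_le_nhds _
  exact tendsto_nhds_unique ((tendsto_conj_conjLim hS (pointEval z) f).mono_left h1)
    (tendsto_pure_nhds _ z)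

end BergmanBall
end

open BergmanBall in
theorem proposition4p12 {n d : ℕ} (hn : 1 ≤ n) (hd : 1 ≤ d)
    {p q : ℝ≥0∞} [Fact (1 ≤ p)] [Fact (1 ≤ q)] (hp : 1 < p) (hp' : p < ∞) (hpq : p⁻¹ + q⁻¹ = 1)
    {α : ℝ} [Fact (-1 < α)] :
    -- the operators entering the definitions of `𝒯_{p,α}` and of `S_z` exist
    ((∀ φ : Ball n → Matrix (Fin d) (Fin d) ℂ, IsBddSymbol α φ →
        ∃ T : Bergman n d p α →L[ℂ] Bergman n d p α, IsToeplitz φ T) ∧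
      (∀ (z : Ball n) (f : Bergman n d p α) (w : Ball n),
        U d p α z f w = weightedComp α z f w) ∧
      (∀ (z : Ball n) (g : Bergman n d q α) (w : Ball n),
        U d q α z g w = weightedComp α z g w) ∧
      (∀ (z : Ball n) (f : Bergman n d p α) (g : Bergman n d q α),
        pairing (adj p (U d q α z) f) g = pairing f (U d q α z g))) ∧
    ∀ S ∈ toeplitzAlgebra n d p α,
      -- convergence along nets, in the strong operator topology
      (∀ (Ω : Type*) [Preorder Ω] [IsDirectedOrder Ω] [Nonempty Ω] (z : Ω → Ball n)
        (x : MaxIdealSpace n), Tendsto (fun ω => pointEval (z ω)) atTop (𝓝 x) →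
        ∀ f : Bergman n d p α,
          Tendsto (fun ω => conj q S (z ω) f) atTop (𝓝 (conjLim q S x f))) ∧
      -- continuous extension of `Ψ_S` to the maximal ideal space
      ∃ Ψ : MaxIdealSpace n → (Bergman n d p α →Lₚₜ[ℂ] Bergman n d p α),
        Continuous Ψ ∧ (∀ z f, Ψ (pointEval z) f = conj q S z f) ∧
          ∀ x f, Ψ x f = conjLim q S x f := by
  have : Fact (1 < p) := ⟨hp⟩
  have : Fact (p < ∞) := ⟨hp'⟩
  have : p.HolderConjugate q := ⟨by simpa using hpq⟩
  have : Fact (1 < q) := ⟨(ENNReal.HolderConjugate.lt_top_iff_one_lt p q).mp hp'⟩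
  have : Fact (q < ∞) := ⟨(ENNReal.HolderConjugate.lt_top_iff_one_lt q p).mpr hp⟩
  refine ⟨⟨fun φ hφ => ⟨toeplitz hφ, isToeplitz_toeplitz hφ⟩, U_apply, U_apply, pairing_adj_U⟩,
    fun S hS => ⟨fun Ω _ _ _ z x hz f => ?_, ?_⟩⟩
  · exact (tendsto_conj_conjLim hS x f).comp (tendsto_comap_iff.mpr hz)
  · refine ⟨fun x => ContinuousLinearMap.toPointwiseConvergenceCLM ℂ (RingHom.id ℂ) _ _
      (conjLim q S x), ?_, fun z f =>
      conjLim_pointEval hS z f, fun x f => rfl⟩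
    exact PointwiseConvergenceCLM.continuous_of_continuous_eval fun f =>
      continuous_of_tendsto_comap neBot_comap_pointEval fun x => tendsto_conj_conjLim hS x f
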